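/- Let $\mathcal S$ be a compact metric space with its Borel $\sigma$-algebra, $\mu$ a probability measure on $\mathcal S$, and $\kappa:\mathcal S\times\mathcal S\to[0,\infty)$ a symmetric continuous function (a kernel). **Notation.** For a finite measure $\nu$ on $\mathcal S$ put $\kappa\nu(r)=\int\kappa(r,s)\,\nu(ds)$, and write $\langle\nu,f\rangle=\int f\,d\nu$ and $|\nu|$ for the total mass of $\nu$. Let $\Sigma(\kappa,\nu)$ be the operator norm on $L^2(\nu)$ of $f\mapsto\int\kappa(\cdot,y)f(y)\,\nu(dy)$ (it is $0$ if $\nu=0$). Let $\mathcal M_{\mathbb N_0}(\mathcal S)$ be the set of finite $\mathbb N_0$-valued measures on $\mathcal S$, with the $\sigma$-algebra generated by the evaluations $k\mapsto k(A)$, $A$ Borel, and let $\mathbb Q_\nu$ be the law on it of the Poisson point process with finite intensity measure $\nu$. For $k=\sum_{i=1}^n\delta_{x_i}$ let $\tau(k)=\sum_T\prod_{\{i,j\}\in E(T)}\kappa(x_i,x_j)$, the sum being over all spanning trees $T$ on $\{1,\dots,n\}$, with $\tau(0)=0$. For a finite measure $\lambda$ on $\mathcal M_{\mathbb N_0}(\mathcal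 S)$ put $c_\lambda(R)=\int k(R)\,\lambda(dk)$, and let $\mathcal L$ be the set of those $\lambda$ with $\lambda(\{0\})=0$ and $c_\lambda\le\mu$. For $\lambda\in\mathcal L$ put $$I_{\rm Mi}(\lambda)=\Big\langle\lambda,\log\frac{d\lambda}{\tau\,d\mathbb Q_\mu}\Big\rangle+|c_\lambda|-2|\lambda|+\tfrac12\langle c_\lambda,\kappa\mu\rangle\in(-\infty,\infty]$$ if $\lambda\ll\mathbb Q_\mu$, where $\log\frac{d\lambda}{\tau\,d\mathbb Q_\mu}=\log\frac{d\lambda}{d\mathbb Q_\mu}-\log\tau$ and $\log 0=-\infty$, and $I_{\rm Mi}(\lambda)=+\infty$ otherwise. For a finite measure $\nu\le\mu$ on $\mathcal S$ put $$I_{\rm Me}(\nu)=\Big\langle\nu,\log\frac{d\nu}{(\kappa\nu)\,d\mu}\Big\rangle+\tfrac12\langle\nu,\kappa\mu\rangle$$ if $\nu\ll(\kappa\nu)\mu$, and $I_{\rm Me}(\nu)=+\infty$ otherwise. **Proposition.** Let $c$ be a measure on $\mathcal S$ with $c\le\mu$. (i) If $\Sigma(\kappa,c)\le1$, then $$\inf_{\lambda\in\mathcal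 L:\,c_\lambda=c}I_{\rm Mi}(\lambda)=\Big\langle c,\log\frac{dc}{d\mu}\Big\rangle+\tfrac12\langle c,\kappa(\mu-c)\rangle ,$$ and the measure $$\lambda_c(dk)=e^{\theta_c(\mathcal S)}\,\tau(k)\,\mathbb Q_{\theta_c}(dk),\qquad \theta_c(dr)=e^{-\kappa c(r)}\,c(dr),$$ lies in $\mathcal L$, satisfies $c_{\lambda_c}=c$, and is the unique minimizer. (ii) If $\Sigma(\kappa,c)>1$, then among the measures $b\ne c$ on $\mathcal S$ that solve $$b\le c,\qquad \kappa(c-b)(r)\,b(dr)=(c-b)(dr)$$ there is a smallest one $b^*$ (that is, $b^*\le b$ for every such $b$). It satisfies $\Sigma(\kappa,b^*)=1$ and $$\inf_{\lambda\in\mathcal L:\,c_\lambda=c}I_{\rm Mi}(\lambda)\;\ge\;\inf_{\lambda\in\mathcal L:\,c_\lambda=b^*}I_{\rm Mi}(\lambda)+I_{\rm Me}(c-b^*).$$ -/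

import Mathlib

open MeasureTheory
open scoped ENNReal

namespace SparseGraph

/-- The integral of an extended-real function `f` with respect to `ν`: the integral of the positive
part minus the integral of the negative part (meaningful as soon as one of the two is finite). -/
noncomputable def extIntegral {α : Type*} [MeasurableSpace α] (ν : Measure α) (f : α → EReal) :
    EReal :=
  ((∫⁻ x, (f x).toENNReal ∂ν : ℝ≥0∞) : EReal) - ((∫⁻ x, (-f x).toENNReal ∂ν : ℝ≥0∞) : EReal)

/-- Type-configurations: measures on `S` all of whose values are natural numbers. As a subtype of
`Measure S`, this carries the sigma-algebra generated by the evaluations `k ↦ k A`. -/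
abbrev Config (S : Type*) [MeasurableSpace S] : Type _ :=
  {k : Measure S // ∀ A : Set S, MeasurableSet A → ∃ n : ℕ, k A = n}

/-- The configuration `∑ i, δ_{x i}` of a type vector `x`. -/
noncomputable def pointConfig {S : Type*} [MeasurableSpace S] {n : ℕ} (x : Fin n → S) :
    Config S :=
  ⟨∑ i, Measure.dirac (x i), fun A hA => by
    classical
    refine ⟨∑ i, if x i ∈ A then 1 else 0, ?_⟩
    simp [Measure.finsetSum_apply, Measure.dirac_apply' _ hA, Set.indicator_apply]⟩

/-- Every nonzero configuration has an atom. -/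
theorem Config.exists_atom {S : Type*} [MetricSpace S] [CompactSpace S] [MeasurableSpace S]
    [BorelSpace S] (k : Config S) (hk : k.1 ≠ 0) : ∃ r : S, 1 ≤ k.1 {r} := by
  obtain ⟨m, hm⟩ := k.2 Set.univ MeasurableSet.univ
  have : IsFiniteMeasure k.1 := ⟨by rw [hm]; exact ENNReal.natCast_lt_top m⟩
  have huniv : k.1 Set.univ ≠ 0 := by simpa using hk
  obtain ⟨r, -, hr⟩ := exists_mem_forall_mem_nhdsWithin_pos_measure huniv
  refine ⟨r, ?_⟩
  have hlim : Filter.Tendsto (fun n : ℕ => k.1 (Metric.closedBall r (1 / ((n : ℝ) + 1))))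
      Filter.atTop (nhds (k.1 (⋂ n : ℕ, Metric.closedBall r (1 / ((n : ℝ) + 1))))) := by
    refine tendsto_measure_iInter_atTop
      (fun n => Metric.isClosed_closedBall.measurableSet.nullMeasurableSet) ?_
      ⟨0, measure_ne_top _ _⟩
    intro a b hab
    exact Metric.closedBall_subset_closedBall (one_div_le_one_div_of_le (by positivity)
      (by have : (a : ℝ) ≤ b := by exact_mod_cast hab
          linarith))
  have hset : (⋂ n : ℕ, Metric.closedBall r (1 / ((n : ℝ) + 1))) = {r} := by
    ext s
    simp only [Set.mem_iInter, Metric.mem_closedBall, Set.mem_singleton_iff]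
    constructor
    · intro h
      exact dist_le_zero.mp (ge_of_tendsto' tendsto_one_div_add_atTop_nhds_zero_nat h)
    · rintro rfl n
      rw [dist_self]
      positivity
  rw [hset] at hlim
  refine ge_of_tendsto' hlim fun n => ?_
  obtain ⟨j, hj⟩ := k.2 _ (Metric.isClosed_closedBall (x := r)
    (ε := 1 / ((n : ℝ) + 1))).measurableSet
  have hpos : 0 < k.1 (Metric.closedBall r (1 / ((n : ℝ) + 1))) :=
    hr _ (mem_nhdsWithin_of_mem_nhds (Metric.closedBall_mem_nhds r (by positivity)))
  rw [hj] at hpos ⊢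
  exact_mod_cast hpos

/-- Every configuration has a compatible type vector. -/
theorem Config.exists_compatible {S : Type*} [MetricSpace S] [CompactSpace S] [MeasurableSpace S]
    [BorelSpace S] (k : Config S) : ∃ (n : ℕ) (x : Fin n → S), pointConfig x = k := by
  obtain ⟨m, hm⟩ := k.2 Set.univ MeasurableSet.univ
  induction m generalizing k with
  | zero =>
    refine ⟨0, Fin.elim0, Subtype.ext ?_⟩
    have : k.1 = 0 := by simpa using hm
    simp [pointConfig, this]
  | succ m ih =>
    have hk : k.1 ≠ 0 := by
      intro h
      simp [h] at hm
      exact absurd hm.symm (by positivity)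
    have : IsFiniteMeasure k.1 := ⟨by rw [hm]; exact ENNReal.natCast_lt_top _⟩
    obtain ⟨r, hr⟩ := k.exists_atom hk
    have hle : Measure.dirac r ≤ k.1 := by
      refine Measure.le_iff.mpr fun A hA => ?_
      rw [Measure.dirac_apply' _ hA]
      by_cases h : r ∈ A
      · simpa [h] using hr.trans (measure_mono (Set.singleton_subset_iff.mpr h))
      · simp [h]
    have hsub : ∀ A : Set S, MeasurableSet A → ∃ n : ℕ, (k.1 - Measure.dirac r) A = n := by
      intro A hA
      obtain ⟨j, hj⟩ := k.2 A hA
      rw [Measure.sub_apply hA hle, hj, Measure.dirac_apply' _ hA]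
      by_cases h : r ∈ A
      · exact ⟨j - 1, by simp [h]⟩
      · exact ⟨j, by simp [h]⟩
    have hmass : (k.1 - Measure.dirac r) Set.univ = m := by
      rw [Measure.sub_apply MeasurableSet.univ hle, hm]
      simp
    obtain ⟨n, x, hx⟩ := ih ⟨k.1 - Measure.dirac r, hsub⟩ hmass
    refine ⟨n + 1, Fin.cons r x, Subtype.ext ?_⟩
    have hx' : ∑ i, Measure.dirac (x i) = k.1 - Measure.dirac r := congrArg Subtype.val hx
    simp only [pointConfig, Fin.sum_univ_succ, Fin.cons_zero, Fin.cons_succ, hx']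
    rw [add_comm]
    exact Measure.sub_add_cancel_of_le hle

open Classical in
/-- The total weight of the spanning trees on `{0, …, n - 1}`, a tree having the weight
`∏ κ (x i) (x j)` over its edges `{i, j}`, each written with `i < j`. There is no tree for
`n = 0`. -/
noncomputable def treeWeight {S : Type*} (κ : S → S → ℝ) {n : ℕ} (x : Fin n → S) : ℝ :=
  ∑ T : SimpleGraph (Fin n) with T.IsTree,
    ∏ p : Fin n × Fin n with p.1 < p.2 ∧ T.Adj p.1 p.2, κ (x p.1) (x p.2)

/-- `τ(k)`: the tree weight of a type vector compatible with `k` (for symmetric `κ`, the value does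
not depend on which one). -/
noncomputable def tau {S : Type*} [MetricSpace S] [CompactSpace S] [MeasurableSpace S]
    [BorelSpace S] (κ : S → S → ℝ) (k : Config S) : ℝ :=
  treeWeight κ k.exists_compatible.choose_spec.choose

/-- `(κν)(r) = ∫ κ(r, s) ν(ds)`. -/
noncomputable def kernelInt {S : Type*} [MeasurableSpace S] (κ : S → S → ℝ) (ν : Measure S)
    (r : S) : ℝ :=
  ∫ s, κ r s ∂ν

/-- `Σ(κ, ν)`: the norm of the operator `f ↦ ∫ κ(·, y) f(y) ν(dy)` on `L²(ν)`. -/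
noncomputable def opNorm {S : Type*} [MeasurableSpace S] (κ : S → S → ℝ) (ν : Measure S) : ℝ≥0∞ :=
  ⨆ (f : S → ℝ) (_ : MemLp f 2 ν) (_ : eLpNorm f 2 ν = 1),
    eLpNorm (fun r => ∫ s, κ r s * f s ∂ν) 2 ν

/-- The law of the Poisson point process with finite intensity measure `ν`: a Poisson distributed
number `n` of points with parameter `ν(S)`, which given `n` are independent with law `ν / ν(S)`. -/
noncomputable def poissonLaw {S : Type*} [MeasurableSpace S] (ν : Measure S) :
    Measure (Config S) :=
  ENNReal.ofReal (Real.exp (-ν.real Set.univ)) •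
    Measure.sum fun n : ℕ =>
      ((n.factorial : ℝ≥0∞))⁻¹ • (Measure.pi fun _ : Fin n => ν).map pointConfig

/-- The integrated type-configuration `c_l(R) = ∫ k(R) l(dk)`. -/
noncomputable def integratedConfig {S : Type*} [MeasurableSpace S] (l : Measure (Config S)) :
    Measure S :=
  l.bind Subtype.val

/-- The state space `𝓛`: finite measures `l` on configurations, without mass at the zero
configuration, such that `c_l ≤ μ`. -/
def stateSpace {S : Type*} [MeasurableSpace S] (μ : Measure S) : Set (Measure (Config S)) :=
  {l | IsFiniteMeasure l ∧ l {k | k.1 = 0} = 0 ∧ integratedConfig l ≤ μ}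

open Classical in
/-- The microscopic rate function
`H(l | Q_μ) - 1 - ⟨l, log τ⟩ + |c_l| - |l| + ½ ⟨c_l, κμ⟩`, where `H` is the relative entropy
`|Q_μ| - |l| + ⟨l, log (dl/dQ_μ)⟩`. The two logarithms are integrated jointly, as
`log (dl/dQ_μ) - log τ = log (dl/(τ dQ_μ))`, and the value is `+∞` unless `l ≪ Q_μ`. -/
noncomputable def rateMi {S : Type*} [MetricSpace S] [CompactSpace S] [MeasurableSpace S]
    [BorelSpace S] (κ : S → S → ℝ) (μ : Measure S) (l : Measure (Config S)) : EReal :=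
  if l ≪ poissonLaw μ then
    extIntegral l (fun k =>
        ENNReal.log (l.rnDeriv (poissonLaw μ) k) - ENNReal.log (ENNReal.ofReal (tau κ k)))
      + (((poissonLaw μ).real Set.univ - l.real Set.univ - 1
          + (integratedConfig l).real Set.univ - l.real Set.univ
          + 1 / 2 * ∫ r, kernelInt κ μ r ∂(integratedConfig l) : ℝ) : EReal)
  else ⊤

open Classical in
/-- The mesoscopic rate function `⟨ν, log (dν/((κν) dμ))⟩ + ½ ⟨ν, κμ⟩`, with value `+∞` if `ν` is
not absolutely continuous with respect to `(κν) μ`. -/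
noncomputable def rateMe {S : Type*} [MeasurableSpace S] (κ : S → S → ℝ) (μ ν : Measure S) :
    EReal :=
  if ν ≪ μ.withDensity (fun r => ENNReal.ofReal (kernelInt κ ν r)) then
    extIntegral ν (fun r => ENNReal.log
        (ν.rnDeriv (μ.withDensity fun r => ENNReal.ofReal (kernelInt κ ν r)) r))
      + ((1 / 2 * ∫ r, kernelInt κ μ r ∂ν : ℝ) : EReal)
  else ⊤

/-- The measure `θ_c(dr) = e^{-κc(r)} c(dr)`. -/
noncomputable def theta {S : Type*} [MeasurableSpace S] (κ : S → S → ℝ) (c : Measure S) :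
    Measure S :=
  c.withDensity fun r => ENNReal.ofReal (Real.exp (-kernelInt κ c r))

/-- The measure `l_c(dk) = e^{θ_c(S)} τ(k) Q_{θ_c}(dk)`. -/
noncomputable def minimizer {S : Type*} [MetricSpace S] [CompactSpace S] [MeasurableSpace S]
    [BorelSpace S] (κ : S → S → ℝ) (c : Measure S) : Measure (Config S) :=
  ENNReal.ofReal (Real.exp ((theta κ c).real Set.univ)) •
    (poissonLaw (theta κ c)).withDensity fun k => ENNReal.ofReal (tau κ k)

/-- The measures `b ≤ c` with `κ(c - b)(r) b(dr) = (c - b)(dr)`. -/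
def characteristicSolutions {S : Type*} [MeasurableSpace S] (κ : S → S → ℝ) (c : Measure S) :
    Set (Measure S) :=
  {b | b ≤ c ∧ b.withDensity (fun r => ENNReal.ofReal (kernelInt κ (c - b) r)) = c - b}

/-- The infimum of the microscopic rate function over `{l ∈ 𝓛 : c_l = c}`. -/
noncomputable def constrainedInf {S : Type*} [MetricSpace S] [CompactSpace S] [MeasurableSpace S]
    [BorelSpace S] (κ : S → S → ℝ) (μ c : Measure S) : EReal :=
  sInf (rateMi κ μ '' {l | l ∈ stateSpace μ ∧ integratedConfig l = c})

end SparseGraph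

open SparseGraph

/-! Everything rests on one identity, `rateMi_eq`. The measure `λ_b` has density `e τ(k) ∏ h(x_i)`
with respect to `Q_μ`, where `h = dθ_b/dμ = (db/dμ) e^{-κb}`. Hence `log (dλ/(τ dQ_μ))` is `log
(dλ/dλ_b)` plus `1` plus a sum over the points of `k`, and the integral of such a sum depends on `λ`
only through `c_λ`. So on `{c_λ = c}` the rate function equals `klDiv λ λ_b` plus a constant
`rateConst κ μ b c`, as soon as `c ≪ b ≤ μ`, `log (db/dμ)` is `c`-integrable and `λ_b` is finite.
The divergence is nonnegative and vanishes only at `λ = λ_b`.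

Part (i) takes `b = c`. What has to be shown is that `λ_c` meets its own constraint. Marking a
vertex gives `c_{λ_c} = Φ θ_c` with `Φ` the generating function of rooted trees. Splitting a tree at
the first edge between the root and a given vertex yields `Φ = exp (KΦ)`, and `Φ` is the least
solution (`rootedGF_eq_expSum`, `rootedGF_le`). Another solution is `e^{κc}`, and `ρ = 1 - e^{-κc}
Φ` satisfies `ρ = 1 - exp (-Tρ)` with `T` the kernel operator on `L²(c)`; if `T` has norm at most
one, `ρ = 0` almost everywhere (`rootedGF_ae_eq`). The mass of `λ_c` comes from counting a tree as
its vertices minus its edges (`lintegral_rootedGF`).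

Part (ii) uses the same identity with `b = b*` and gets the lower bound at once, because `rateConst
κ μ b* c` is `rateConst κ μ b* b*` plus the mesoscopic rate of `c - b*` (`rateConst_charMeasure`,
`rateMe_sub_eq`). With `g = κ(c - b)` the characteristic equation says `b = c/(1 + g)` and `g = ∫
κ(·, s) g/(1 + g) dc`, a fixed point equation for a monotone map. Iterating from above gives the
largest `g`, hence the smallest `b`. The iterates are positive supersolutions, so the Schur test
bounds the norm for `b*` by one; in particular `b* ≠ c`. Since `g` is then a nonzero eigenfunction
with eigenvalue one, the norm is exactly one (`exists_isLeast_characteristicSolutions`). -/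

namespace SparseGraph
set_option linter.unusedSectionVars false

/-! ### Spanning trees: cutting at an edge and gluing. -/

section Trees
open Classical

/-- The edges of a graph on a finite vertex set, as a finite set. -/
noncomputable def edgesOf {V : Type*} [Fintype V] (T : SimpleGraph V) : Finset (Sym2 V) :=
  Finset.univ.filter (· ∈ T.edgeSet)

/-- The total weight of the spanning trees on `V`, with edge weights `K s(x i, x j)`. -/
noncomputable def treeSum {S R V : Type*} [CommSemiring R] [Fintype V] (K : Sym2 S → R)
    (x : V → S) : R :=
  ∑ T : SimpleGraph V with T.IsTree, ∏ e ∈ edgesOf T, K (e.map x)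

variable {V : Type*}

/-- The only edge of `T` between `A` and its complement joins `r ∉ A` to `j ∈ A`. -/
structure CutAt (T : SimpleGraph V) (A : Finset V) (r j : V) : Prop where
  root : r ∉ A
  mem : j ∈ A
  cross : ∀ a b, a ∉ A → b ∈ A → (T.Adj a b ↔ a = r ∧ b = j)

/-- The part of `T` inside `A`. -/
abbrev inPart (T : SimpleGraph V) (A : Finset V) : SimpleGraph {a // a ∈ A} :=
  T.comap Subtype.val

/-- The part of `T` outside `A`. -/
abbrev outPart (T : SimpleGraph V) (A : Finset V) : SimpleGraph {a // a ∉ A} :=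
  T.comap Subtype.val

theorem CutAt.edgesOf_eq [Fintype V] {T : SimpleGraph V} {A : Finset V} {r j : V}
    (h : CutAt T A r j) :
    edgesOf T = insert s(r, j) ((edgesOf (inPart T A)).image (Sym2.map Subtype.val) ∪
      (edgesOf (outPart T A)).image (Sym2.map Subtype.val)) := by
  ext e
  induction e with | _ a b
  simp only [edgesOf, Finset.mem_filter, Finset.mem_univ, true_and, SimpleGraph.mem_edgeSet,
    Finset.mem_insert, Finset.mem_union, Finset.mem_image, Sym2.exists, Sym2.map_mk,
    SimpleGraph.comap_adj, Subtype.exists]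
  constructor
  · intro hab
    by_cases ha : a ∈ A <;> by_cases hb : b ∈ A
    · exact Or.inr (Or.inl ⟨a, ha, b, hb, hab, rfl⟩)
    · obtain ⟨rfl, rfl⟩ := (h.cross b a hb ha).1 hab.symm
      exact Or.inl Sym2.eq_swap
    · obtain ⟨rfl, rfl⟩ := (h.cross a b ha hb).1 hab
      exact Or.inl rfl
    · exact Or.inr (Or.inr ⟨a, ha, b, hb, hab, rfl⟩)
  · have key : ∀ a' b' : V, T.Adj a' b' → s(a', b') = s(a, b) → T.Adj a b := by
      intro a' b' h1 h2
      rw [← SimpleGraph.mem_edgeSet, ← h2]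
      exact h1
    rintro (h1 | ⟨a', -, b', -, h1, h2⟩ | ⟨a', -, b', -, h1, h2⟩)
    · exact key r j ((h.cross r j h.root h.mem).2 ⟨rfl, rfl⟩) h1.symm
    · exact key _ _ h1 h2
    · exact key _ _ h1 h2

theorem CutAt.prod_edgesOf [Fintype V] {R : Type*} [CommMonoid R] {T : SimpleGraph V}
    {A : Finset V} {r j : V} (h : CutAt T A r j) (F : Sym2 V → R) :
    ∏ e ∈ edgesOf T, F e = F s(r, j) * ((∏ e ∈ edgesOf (inPart T A), F (e.map Subtype.val)) *
      ∏ e ∈ edgesOf (outPart T A), F (e.map Subtype.val)) := by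
  have hinj1 : Function.Injective (Sym2.map (Subtype.val : {a // a ∈ A} → V)) :=
    Sym2.map.injective Subtype.val_injective
  have hinj2 : Function.Injective (Sym2.map (Subtype.val : {a // a ∉ A} → V)) :=
    Sym2.map.injective Subtype.val_injective
  rw [h.edgesOf_eq, Finset.prod_insert, Finset.prod_union, Finset.prod_image (hinj1.injOn),
    Finset.prod_image (hinj2.injOn)]
  · rw [Finset.disjoint_left]
    intro e h1 h2
    obtain ⟨e1, -, rfl⟩ := Finset.mem_image.1 h1
    obtain ⟨e2, -, h3⟩ := Finset.mem_image.1 h2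
    induction e1 with | _ a b
    induction e2 with | _ a' b'
    have : a.1 ∈ Sym2.map (Subtype.val : {a // a ∉ A} → V) s(a', b') := by rw [h3]; simp
    simp only [Sym2.map_mk, Sym2.mem_iff] at this
    rcases this with h | h
    · exact a'.2 (h ▸ a.2)
    · exact b'.2 (h ▸ a.2)
  · intro h1
    rcases Finset.mem_union.1 h1 with h1 | h1
    · obtain ⟨e1, -, h2⟩ := Finset.mem_image.1 h1
      induction e1 with | _ a b
      have : r ∈ Sym2.map (Subtype.val : {a // a ∈ A} → V) s(a, b) := by rw [h2]; simp
      simp only [Sym2.map_mk, Sym2.mem_iff] at this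
      rcases this with h' | h'
      · exact h.root (h' ▸ a.2)
      · exact h.root (h' ▸ b.2)
    · obtain ⟨e1, -, h2⟩ := Finset.mem_image.1 h1
      induction e1 with | _ a b
      have : j ∈ Sym2.map (Subtype.val : {a // a ∉ A} → V) s(a, b) := by rw [h2]; simp
      simp only [Sym2.map_mk, Sym2.mem_iff] at this
      rcases this with h' | h'
      · exact a.2 (h' ▸ h.mem)
      · exact b.2 (h' ▸ h.mem)

theorem card_edgesOf [Fintype V] (T : SimpleGraph V) : (edgesOf T).card = Nat.card T.edgeSet := by
  rw [Nat.card_eq_fintype_card, Fintype.card_subtype]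
  congr

theorem CutAt.card_edgesOf_eq [Fintype V] {T : SimpleGraph V} {A : Finset V} {r j : V}
    (h : CutAt T A r j) :
    (edgesOf T).card = 1 + ((edgesOf (inPart T A)).card + (edgesOf (outPart T A)).card) := by
  -- With weight `1` on every edge, written in `Multiplicative ℕ`, the product formula counts edges.
  have := h.prod_edgesOf (fun _ => Multiplicative.ofAdd (1 : ℕ))
  simp only [Finset.prod_const, ← ofAdd_nsmul, ← ofAdd_add, smul_eq_mul, mul_one] at this
  exact Multiplicative.ofAdd.injective this

/-- A walk to `r` can change sides only along `{r, j}`. Induction along the walk therefore joins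
each vertex, inside its own part, to the end of that edge lying there; acyclicity passes to induced
subgraphs. -/
theorem CutAt.isTree_parts [Fintype V] {T : SimpleGraph V} {A : Finset V} {r j : V}
    (h : CutAt T A r j) (hT : T.IsTree) : (inPart T A).IsTree ∧ (outPart T A).IsTree := by
  have key : ∀ a, (∀ ha : a ∈ A, (inPart T A).Reachable ⟨j, h.mem⟩ ⟨a, ha⟩) ∧
      (∀ ha : a ∉ A, (outPart T A).Reachable ⟨r, h.root⟩ ⟨a, ha⟩) := by
    intro a
    obtain ⟨w⟩ := hT.connected.preconnected a r
    induction w with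
    | nil => exact ⟨fun ha => absurd ha h.root, fun ha => SimpleGraph.Reachable.refl _⟩
    | @cons u v w huv p ih =>
      have ih := ih h
      refine ⟨fun hu => ?_, fun hu => ?_⟩
      · by_cases hv : v ∈ A
        · exact (ih.1 hv).trans (SimpleGraph.Adj.reachable (by simpa using huv.symm))
        · obtain ⟨rfl, rfl⟩ := (h.cross v u hv hu).1 huv.symm
          rfl
      · by_cases hv : v ∈ A
        · obtain ⟨rfl, rfl⟩ := (h.cross u v hu hv).1 huv
          rfl
        · exact (ih.2 hv).trans (SimpleGraph.Adj.reachable (by simpa using huv.symm))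
  have hne1 : Nonempty {a // a ∈ A} := ⟨⟨j, h.mem⟩⟩
  have hne2 : Nonempty {a // a ∉ A} := ⟨⟨r, h.root⟩⟩
  refine ⟨⟨⟨fun a b => ?_⟩, hT.isAcyclic.of_comap (Function.Embedding.subtype _)⟩,
    ⟨⟨fun a b => ?_⟩, hT.isAcyclic.of_comap (Function.Embedding.subtype _)⟩⟩
  · exact ((key a).1 a.2).symm.trans ((key b).1 b.2)
  · exact ((key a).2 a.2).symm.trans ((key b).2 b.2)

/-- The new edge connects the two parts, and the edge count `1 + e₁ + e₂` is one less than the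
number of vertices, so no separate argument for acyclicity is needed. -/
theorem CutAt.isTree [Fintype V] {T : SimpleGraph V} {A : Finset V} {r j : V}
    (h : CutAt T A r j) (h1 : (inPart T A).IsTree) (h2 : (outPart T A).IsTree) : T.IsTree := by
  rw [SimpleGraph.isTree_iff_connected_and_card] at h1 h2 ⊢
  have hcard : Nat.card V = Nat.card {a // a ∈ A} + Nat.card {a // a ∉ A} := by
    simp only [Nat.card_eq_fintype_card]
    have := Fintype.card_subtype_compl (· ∈ A)
    have := Fintype.card_subtype_le (· ∈ A)
    omega
  have hE := h.card_edgesOf_eq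
  simp only [card_edgesOf] at hE
  have key : ∀ a, T.Reachable r a := by
    intro a
    by_cases ha : a ∈ A
    · have hj : T.Reachable r j :=
        SimpleGraph.Adj.reachable ((h.cross r j h.root h.mem).2 ⟨rfl, rfl⟩)
      have := (h1.1.preconnected ⟨j, h.mem⟩ ⟨a, ha⟩).map
        (SimpleGraph.Embedding.comap (Function.Embedding.subtype _) T).toHom
      exact hj.trans this
    · exact (h2.1.preconnected ⟨r, h.root⟩ ⟨a, ha⟩).map
        (SimpleGraph.Embedding.comap (Function.Embedding.subtype _) T).toHom
  have : Nonempty V := ⟨r⟩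
  exact ⟨⟨fun a b => (key a).symm.trans (key b)⟩, by omega⟩

/-- The graph obtained from graphs on `A` and on its complement by adding the edge `{r, j}`. -/
def glue (A : Finset V) (r j : V) (T₁ : SimpleGraph {a // a ∈ A}) (T₂ : SimpleGraph {a // a ∉ A}) :
    SimpleGraph V :=
  T₁.map Subtype.val ⊔ T₂.map Subtype.val ⊔ SimpleGraph.edge r j

theorem glue_adj (A : Finset V) (r j : V) (T₁ : SimpleGraph {a // a ∈ A})
    (T₂ : SimpleGraph {a // a ∉ A}) (a b : V) : (glue A r j T₁ T₂).Adj a b ↔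
      ((∃ ha hb, T₁.Adj ⟨a, ha⟩ ⟨b, hb⟩) ∨ ∃ ha hb, T₂.Adj ⟨a, ha⟩ ⟨b, hb⟩) ∨
        (a = r ∧ b = j ∨ a = j ∧ b = r) ∧ a ≠ b := by
  have h1 : (∃ a' b', T₁.Adj a' b' ∧ a'.1 = a ∧ b'.1 = b) ↔ ∃ ha hb, T₁.Adj ⟨a, ha⟩ ⟨b, hb⟩ :=
    ⟨by rintro ⟨a', b', h, rfl, rfl⟩; exact ⟨a'.2, b'.2, h⟩,
      fun ⟨ha, hb, h⟩ => ⟨_, _, h, rfl, rfl⟩⟩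
  have h2 : (∃ a' b', T₂.Adj a' b' ∧ a'.1 = a ∧ b'.1 = b) ↔ ∃ ha hb, T₂.Adj ⟨a, ha⟩ ⟨b, hb⟩ :=
    ⟨by rintro ⟨a', b', h, rfl, rfl⟩; exact ⟨a'.2, b'.2, h⟩,
      fun ⟨ha, hb, h⟩ => ⟨_, _, h, rfl, rfl⟩⟩
  rw [glue, SimpleGraph.sup_adj, SimpleGraph.sup_adj, SimpleGraph.edge_adj]
  refine or_congr (or_congr (Iff.trans ?_ h1) (Iff.trans ?_ h2)) Iff.rfl
  · exact SimpleGraph.map_adj (Function.Embedding.subtype _) _ _ _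
  · exact SimpleGraph.map_adj (Function.Embedding.subtype _) _ _ _

theorem glue_adj_of_mem {A : Finset V} {r j : V} (hr : r ∉ A)
    (T₁ : SimpleGraph {a // a ∈ A}) (T₂ : SimpleGraph {a // a ∉ A}) (a b : {a // a ∈ A}) :
    (glue A r j T₁ T₂).Adj a b ↔ T₁.Adj a b := by
  have ha : a.1 ≠ r := fun h => hr (h ▸ a.2)
  have hb : b.1 ≠ r := fun h => hr (h ▸ b.2)
  simp [glue_adj, ha, hb]

theorem glue_adj_of_not_mem {A : Finset V} {r j : V} (hj : j ∈ A)
    (T₁ : SimpleGraph {a // a ∈ A}) (T₂ : SimpleGraph {a // a ∉ A}) (a b : {a // a ∉ A}) :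
    (glue A r j T₁ T₂).Adj a b ↔ T₂.Adj a b := by
  have ha : a.1 ≠ j := fun h => a.2 (h ▸ hj)
  have hb : b.1 ≠ j := fun h => b.2 (h ▸ hj)
  simp [glue_adj, ha, hb, a.2, b.2]

theorem cutAt_glue {A : Finset V} {r j : V} (hr : r ∉ A) (hj : j ∈ A)
    (T₁ : SimpleGraph {a // a ∈ A}) (T₂ : SimpleGraph {a // a ∉ A}) :
    CutAt (glue A r j T₁ T₂) A r j := by
  refine ⟨hr, hj, fun a b ha hb => ?_⟩
  have haj : a ≠ j := fun h => ha (h ▸ hj)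
  have hab : a ≠ b := fun h => ha (h ▸ hb)
  simp [glue_adj, ha, hb, haj, hab]

theorem CutAt.eq_glue {T : SimpleGraph V} {A : Finset V} {r j : V} (h : CutAt T A r j) :
    glue A r j (inPart T A) (outPart T A) = T := by
  ext a b
  by_cases ha : a ∈ A <;> by_cases hb : b ∈ A
  · exact glue_adj_of_mem h.root _ _ ⟨a, ha⟩ ⟨b, hb⟩
  · rw [SimpleGraph.adj_comm, (cutAt_glue h.root h.mem _ _).cross b a hb ha,
      SimpleGraph.adj_comm, h.cross b a hb ha]
  · rw [(cutAt_glue h.root h.mem _ _).cross a b ha hb, h.cross a b ha hb]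
  · exact glue_adj_of_not_mem h.mem _ _ ⟨a, ha⟩ ⟨b, hb⟩

/-- Follow a walk inside `A` backwards from `v ∈ B`: the only edge leaving `B` ends in `r`, and `r ∉
A`, so the walk never leaves `B`. Applied both ways, this makes the cut set unique. -/
theorem CutAt.subset {T : SimpleGraph V} {A B : Finset V} {r v j k : V} (hA : CutAt T A r j)
    (hB : CutAt T B r k) (hvA : v ∈ A) (hvB : v ∈ B) (hT : (inPart T A).Connected) : A ⊆ B := by
  intro a ha
  obtain ⟨w⟩ := hT.preconnected ⟨a, ha⟩ ⟨v, hvA⟩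
  suffices ∀ x y : {a // a ∈ A}, (inPart T A).Walk x y → y.1 ∈ B → x.1 ∈ B from this _ _ w hvB
  intro x y w hy
  induction w with
  | nil => exact hy
  | @cons x y z hxy p ih =>
    by_contra hx
    have := ((hB.cross x y hx (ih hy)).1 hxy).1
    exact hA.root (this ▸ x.2)

/-- The edge is the first one on the path from `r` to `v`. It is a bridge, and `A` is the component
of `v` once it is deleted. -/
theorem existsUnique_cutAt [Fintype V] {T : SimpleGraph V} (hT : T.IsTree) {r v : V}
    (hrv : r ≠ v) : ∃! q : Finset V × V, v ∈ q.1 ∧ CutAt T q.1 r q.2 := by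
  obtain ⟨p, hp, -⟩ := hT.existsUnique_path r v
  have hex : ∃ q : Finset V × V, v ∈ q.1 ∧ CutAt T q.1 r q.2 := by
    cases p with
    | nil => exact absurd rfl hrv
    | @cons _ j _ hrj p =>
      rw [SimpleGraph.Walk.cons_isPath_iff] at hp
      set T' := T.deleteEdges {s(r, j)} with hT'
      have hjv : T'.Reachable j v := by
        refine ⟨p.toDeleteEdges _ ?_⟩
        rintro e he rfl
        exact hp.2 (p.fst_mem_support_of_mem_edges he)
      have hbr : ¬ T'.Reachable r j := by
        have := SimpleGraph.isAcyclic_iff_forall_adj_isBridge.1 hT.isAcyclic hrj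
        exact SimpleGraph.isBridge_iff.1 this
      refine ⟨(Finset.univ.filter fun a => T'.Reachable a v, j), by simp, ?_, by simpa using hjv, ?_⟩
      · simp only [Finset.mem_filter, Finset.mem_univ, true_and]
        exact fun h => hbr (h.trans hjv.symm)
      · intro a b ha hb
        simp only [Finset.mem_filter, Finset.mem_univ, true_and] at ha hb
        constructor
        · intro hab
          by_cases he : s(a, b) = s(r, j)
          · rcases Sym2.eq_iff.1 he with h | ⟨rfl, rfl⟩
            · exact h
            · exact absurd hjv ha
          · refine absurd ((SimpleGraph.Adj.reachable ?_).trans hb) ha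
            rw [hT', SimpleGraph.deleteEdges_adj]
            exact ⟨hab, he⟩
        · rintro ⟨rfl, rfl⟩
          exact hrj
  obtain ⟨⟨A, j⟩, hvA, hA⟩ := hex
  refine ⟨(A, j), ⟨hvA, hA⟩, ?_⟩
  rintro ⟨B, k⟩ ⟨hvB, hB⟩
  have hAB : A = B := (hA.subset hB hvA hvB (hA.isTree_parts hT).1.connected).antisymm
    (hB.subset hA hvB hvA (hB.isTree_parts hT).1.connected)
  subst hAB
  have : k = j := ((hA.cross r k hA.root hB.mem).1
    ((hB.cross r k hB.root hB.mem).2 ⟨rfl, rfl⟩)).2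
  rw [this]

/-- Restricting to the two parts and gluing along `{r, j}` are inverse bijections between the trees
with this cut and pairs of trees, and the weight factorizes accordingly. -/
theorem treeSum_cutAt [Fintype V] {S R : Type*} [CommSemiring R] (K : Sym2 S → R) (x : V → S)
    {A : Finset V} {r j : V} (hr : r ∉ A) (hj : j ∈ A) :
    ∑ T : SimpleGraph V with T.IsTree ∧ CutAt T A r j, ∏ e ∈ edgesOf T, K (e.map x) =
      K s(x r, x j) * (treeSum K (fun a : {a // a ∈ A} => x a) *
        treeSum K (fun a : {a // a ∉ A} => x a)) := by
  rw [treeSum, treeSum, Finset.sum_mul_sum, ← Finset.sum_product', Finset.mul_sum]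
  refine Finset.sum_bij' (fun T _ => (inPart T A, outPart T A))
    (fun q _ => glue A r j q.1 q.2) ?_ ?_ ?_ ?_ ?_
  · intro T hT
    simp only [Finset.mem_filter, Finset.mem_univ, true_and] at hT
    simpa using hT.2.isTree_parts hT.1
  · intro q hq
    simp only [Finset.mem_product, Finset.mem_filter, Finset.mem_univ, true_and] at hq
    simp only [Finset.mem_filter, Finset.mem_univ, true_and]
    have hc := cutAt_glue hr hj q.1 q.2
    have h1 : inPart (glue A r j q.1 q.2) A = q.1 := by
      ext a b; exact glue_adj_of_mem hr q.1 q.2 a b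
    have h2 : outPart (glue A r j q.1 q.2) A = q.2 := by
      ext a b; exact glue_adj_of_not_mem hj q.1 q.2 a b
    exact ⟨hc.isTree (by rw [h1]; exact hq.1) (by rw [h2]; exact hq.2), hc⟩
  · intro T hT
    simp only [Finset.mem_filter, Finset.mem_univ, true_and] at hT
    exact hT.2.eq_glue
  · intro q hq
    refine Prod.ext ?_ ?_
    · ext a b; exact glue_adj_of_mem hr q.1 q.2 a b
    · ext a b; exact glue_adj_of_not_mem hj q.1 q.2 a b
  · intro T hT
    simp only [Finset.mem_filter, Finset.mem_univ, true_and] at hT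
    rw [hT.2.prod_edgesOf]
    simp [Sym2.map_map]

/-- Splitting a tree at the first edge of the path from `r` to `v`. -/
theorem treeSum_split [Fintype V] {S R : Type*} [CommSemiring R] (K : Sym2 S → R) (x : V → S)
    {r v : V} (hrv : r ≠ v) :
    treeSum K x = ∑ A : Finset V with v ∈ A ∧ r ∉ A, (∑ j : {a // a ∈ A}, K s(x r, x j)) *
      (treeSum K (fun a : {a // a ∈ A} => x a) * treeSum K (fun a : {a // a ∉ A} => x a)) := by
  -- The inner sum has exactly one term, by uniqueness of the cut; afterwards the two sums are
  -- interchanged.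
  have h1 : treeSum K x = ∑ T : SimpleGraph V with T.IsTree,
      ∑ q : Finset V × V with v ∈ q.1 ∧ CutAt T q.1 r q.2, ∏ e ∈ edgesOf T, K (e.map x) := by
    refine Finset.sum_congr rfl fun T hT => ?_
    obtain ⟨q, hq, hu⟩ := existsUnique_cutAt (Finset.mem_filter.1 hT).2 hrv
    rw [Finset.sum_const, Finset.card_eq_one.2 ⟨q, ?_⟩, one_smul]
    ext q'
    simp only [Finset.mem_filter, Finset.mem_univ, true_and, Finset.mem_singleton]
    exact ⟨fun h => hu q' h, fun h => h ▸ hq⟩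
  rw [h1, Finset.sum_comm' (t' := Finset.univ.filter fun q : Finset V × V =>
      (v ∈ q.1 ∧ r ∉ q.1) ∧ q.2 ∈ q.1)
    (s' := fun q => Finset.univ.filter fun T => T.IsTree ∧ CutAt T q.1 r q.2)]
  · have : (Finset.univ.filter fun q : Finset V × V => (v ∈ q.1 ∧ r ∉ q.1) ∧ q.2 ∈ q.1) =
        ((Finset.univ.filter fun A : Finset V => v ∈ A ∧ r ∉ A).sigma
          (fun A => A)).image (fun q : (_ : Finset V) × V => (q.1, q.2)) := by
      ext ⟨A, j⟩
      simp
    rw [this, Finset.sum_image, Finset.sum_sigma]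
    · refine Finset.sum_congr rfl fun A hA => ?_
      simp only [Finset.mem_filter, Finset.mem_univ, true_and] at hA
      rw [Finset.sum_mul, ← Finset.sum_coe_sort A]
      exact Finset.sum_congr rfl fun j _ => treeSum_cutAt K x hA.2 j.2
    · rintro ⟨A, j⟩ - ⟨B, k⟩ - h
      simp only [Prod.mk.injEq] at h
      obtain ⟨rfl, rfl⟩ := h
      rfl
  · rintro T q
    simp only [Finset.mem_filter, Finset.mem_univ, true_and]
    exact ⟨fun h => ⟨⟨h.1, h.2.2⟩, ⟨h.2.1, h.2.2.root⟩, h.2.2.mem⟩,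
      fun h => ⟨h.1.1, h.2.1.1, h.1.2⟩⟩

theorem treeSum_comp_equiv {W S R : Type*} [Fintype V] [Fintype W] [CommSemiring R]
    (K : Sym2 S → R) (x : W → S) (σ : V ≃ W) : treeSum K (x ∘ σ) = treeSum K x := by
  refine Finset.sum_bij' (fun T _ => σ.simpleGraph T) (fun T _ => σ.symm.simpleGraph T)
    ?_ ?_ ?_ ?_ ?_
  · intro T hT
    simp only [Finset.mem_filter, Finset.mem_univ, true_and] at hT ⊢
    exact (SimpleGraph.Iso.comap σ.symm T).isTree_iff.2 hT
  · intro T hT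
    simp only [Finset.mem_filter, Finset.mem_univ, true_and] at hT ⊢
    exact (SimpleGraph.Iso.comap σ T).isTree_iff.2 hT
  · intro T _
    exact σ.simpleGraph.symm_apply_apply T
  · intro T _
    exact σ.simpleGraph.apply_symm_apply T
  · intro T _
    refine Finset.prod_bij' (fun e _ => e.map σ) (fun e _ => e.map σ.symm) ?_ ?_ ?_ ?_ ?_
    · intro e; induction e with | _ a b
      simp only [edgesOf, Finset.mem_filter, Finset.mem_univ, true_and]
      intro h
      simpa [Equiv.simpleGraph] using h
    · intro e; induction e with | _ a b
      simp only [edgesOf, Finset.mem_filter, Finset.mem_univ, true_and]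
      intro h
      simpa [Equiv.simpleGraph] using h
    · intro e _; simp [Sym2.map_map]
    · intro e _; simp [Sym2.map_map]
    · intro e _; simp [Sym2.map_map]

theorem treeSum_of_unique {S R : Type*} [Unique V] [Fintype V] [CommSemiring R]
    (K : Sym2 S → R) (x : V → S) : treeSum K x = 1 := by
  have h : ∀ T : SimpleGraph V, T = ⊥ := fun T => Subsingleton.elim _ _
  rw [treeSum, Finset.sum_eq_single ⊥]
  · rw [Finset.prod_eq_one]
    intro e
    simp [edgesOf]
  · intro T _ hT; exact absurd (h T) hT
  · intro hT
    exact absurd (SimpleGraph.IsTree.of_subsingleton) (by simpa using hT)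

theorem treeSum_of_isEmpty {S R : Type*} [IsEmpty V] [Fintype V] [CommSemiring R]
    (K : Sym2 S → R) (x : V → S) : treeSum K x = 0 := by
  rw [treeSum, Finset.filter_eq_empty_iff.2, Finset.sum_empty]
  intro T _ hT
  exact (not_nonempty_iff.2 ‹_›) hT.connected.nonempty

theorem treeWeight_eq_treeSum {S : Type*} {κ : S → S → ℝ} (hκ : ∀ r s, κ r s = κ s r) {n : ℕ}
    (x : Fin n → S) : treeWeight κ x = treeSum (Sym2.lift ⟨κ, hκ⟩) x := by
  rw [treeWeight, treeSum]
  refine Finset.sum_congr (Finset.ext fun T => by simp) fun T _ => ?_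
  refine Finset.prod_bij (fun p _ => s(p.1, p.2)) ?_ ?_ ?_ ?_
  · intro p; simp [edgesOf]
  · rintro ⟨a, b⟩ h ⟨a', b'⟩ h' he
    simp only [Finset.mem_filter, Finset.mem_univ, true_and] at h h'
    rcases Sym2.eq_iff.1 he with ⟨h1, h2⟩ | ⟨h1, h2⟩
    · exact Prod.ext h1 h2
    · simp only at h1 h2
      subst h1 h2
      exact absurd (h.1.trans h'.1) (lt_irrefl _)
  · intro e he
    induction e with | _ a b
    simp only [edgesOf, Finset.mem_filter, Finset.mem_univ, true_and,
      SimpleGraph.mem_edgeSet] at he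
    rcases lt_or_gt_of_ne he.ne with h | h
    · exact ⟨(a, b), by simp [h, he], rfl⟩
    · exact ⟨(b, a), by simp [h, he.symm], Sym2.eq_swap⟩
  · intro p _
    simp

theorem ofReal_treeSum {S : Type*} [Fintype V] {K : Sym2 S → ℝ} (hK : ∀ e, 0 ≤ K e) (x : V → S) :
    ENNReal.ofReal (treeSum K x) = treeSum (fun e => ENNReal.ofReal (K e)) x := by
  rw [treeSum, ENNReal.ofReal_sum_of_nonneg fun T _ => Finset.prod_nonneg fun e _ => hK _]
  refine Finset.sum_congr rfl fun T _ => ?_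
  rw [ENNReal.ofReal_prod_of_nonneg fun e _ => hK _]

end Trees

/-! ### Exponential recursions for coefficients in `[0, ∞]`. -/

theorem tsum_sum_antidiagonal (F : ℕ → ℕ → ℝ≥0∞) :
    ∑' n, ∑ p ∈ Finset.HasAntidiagonal.antidiagonal n, F p.1 p.2 = ∑' m, ∑' n, F m n := by
  rw [← ENNReal.tsum_prod, ← Finset.HasAntidiagonal.sigmaAntidiagonalEquivProd.tsum_eq, ENNReal.tsum_sigma']
  refine tsum_congr fun n => ?_
  rw [← Finset.tsum_subtype]
  rfl

open PowerSeries in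
/-- The coefficients of `exp (a 0 * X + a 1 * X ^ 2 + ⋯)`. -/
noncomputable def expCoeff (a : ℕ → ℝ≥0∞) (n : ℕ) : ℝ≥0∞ :=
  ∑' k : ℕ, coeff n ((X * PowerSeries.mk a) ^ k) * (k.factorial : ℝ≥0∞)⁻¹

theorem expCoeff_zero (a : ℕ → ℝ≥0∞) : expCoeff a 0 = 1 := by
  rw [expCoeff, tsum_eq_single 0]
  · simp
  · intro k hk
    simp [hk]

open PowerSeries in
-- This is `(exp A)' = exp A · A'` read off coefficientwise, from `(A ^ (k + 1))' = (k + 1) A ^ k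
-- A'` for each term of the exponential series. The term of order zero has no coefficient at `n +
-- 1`.
theorem expCoeff_succ (a : ℕ → ℝ≥0∞) (n : ℕ) : (n + 1) * expCoeff a (n + 1) =
    ∑ p ∈ Finset.HasAntidiagonal.antidiagonal n, expCoeff a p.1 * ((p.2 + 1) * a p.2) := by
  set A : PowerSeries ℝ≥0∞ := X * PowerSeries.mk a with hA
  have hcoeff : ∀ n, coeff (n + 1) A = a n := fun n => by simp [hA, mul_comm X]
  have h1 : ∀ k : ℕ, (n + 1 : ℝ≥0∞) * (coeff (n + 1) (A ^ (k + 1)) *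
      ((k + 1).factorial : ℝ≥0∞)⁻¹) = ∑ p ∈ Finset.HasAntidiagonal.antidiagonal n,
        coeff p.1 (A ^ k) * (k.factorial : ℝ≥0∞)⁻¹ * ((p.2 + 1) * a p.2) := by
    intro k
    have h2 : coeff n (derivative ℝ≥0∞ (A ^ (k + 1))) =
        coeff (n + 1) (A ^ (k + 1)) * (n + 1) := by
      rw [coeff_derivative]
    have h3 : derivative ℝ≥0∞ (A ^ (k + 1)) =
        (k + 1 : ℕ) • (A ^ k * derivative ℝ≥0∞ A) := by
      rw [Derivation.leibniz_pow]
      simp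
    have h4 : coeff n (A ^ k * derivative ℝ≥0∞ A) =
        ∑ p ∈ Finset.HasAntidiagonal.antidiagonal n, coeff p.1 (A ^ k) * ((p.2 + 1) * a p.2) := by
      rw [coeff_mul]
      refine Finset.sum_congr rfl fun p _ => ?_
      rw [coeff_derivative, hcoeff, mul_comm (a p.2)]
    rw [h3, map_nsmul, h4] at h2
    rw [← mul_assoc, mul_comm (n + 1 : ℝ≥0∞), ← h2, nsmul_eq_mul, Nat.factorial_succ,
      Nat.cast_mul, ENNReal.mul_inv (by simp) (by simp)]
    rw [mul_comm ((k + 1 : ℕ) : ℝ≥0∞), mul_assoc, ← mul_assoc ((k + 1 : ℕ) : ℝ≥0∞),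
      ENNReal.mul_inv_cancel (by simp) (by simp), one_mul, Finset.sum_mul]
    refine Finset.sum_congr rfl fun p _ => ?_
    ring
  simp only [expCoeff]
  rw [← ENNReal.tsum_mul_left, tsum_eq_zero_add' ENNReal.summable]
  simp_rw [← hA, h1]
  rw [Summable.tsum_finsetSum fun _ _ => ENNReal.summable]
  simp [ENNReal.tsum_mul_right]

open PowerSeries in
-- Evaluation of the power series at `X = 1`; all terms are nonnegative, so the sums may be
-- interchanged without any convergence assumption.
theorem tsum_expCoeff (a : ℕ → ℝ≥0∞) :
    ∑' n, expCoeff a n = ∑' k : ℕ, (∑' n, a n) ^ k * (k.factorial : ℝ≥0∞)⁻¹ := by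
  set A : PowerSeries ℝ≥0∞ := X * PowerSeries.mk a with hA
  have hAs : ∑' n, coeff n A = ∑' n, a n := by
    rw [tsum_eq_zero_add' ENNReal.summable, hA]
    simp [mul_comm X]
  have hpow : ∀ k : ℕ, ∑' n, coeff n (A ^ k) = (∑' n, a n) ^ k := by
    intro k
    induction k with
    | zero =>
      rw [tsum_eq_single 0]
      · simp
      · intro n hn; simp [coeff_one, hn]
    | succ k ih =>
      simp_rw [pow_succ, coeff_mul]
      rw [tsum_sum_antidiagonal fun i j => coeff i (A ^ k) * coeff j A]
      simp_rw [ENNReal.tsum_mul_left, ENNReal.tsum_mul_right]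
      rw [ih, hAs]
  simp_rw [expCoeff]
  rw [ENNReal.tsum_comm]
  simp_rw [ENNReal.tsum_mul_right, ← hA, hpow]

/-- The recursion determines the `n`-th coefficient from the `a m` with `m < n` only, so `a` may be
altered from `n` on. This is what allows truncation. -/
theorem eq_expCoeff_of_recursion {a b φ : ℕ → ℝ≥0∞} (h0 : φ 0 = 1)
    (h : ∀ n : ℕ, (n + 1) * φ (n + 1) =
      ∑ p ∈ Finset.HasAntidiagonal.antidiagonal n, φ p.1 * ((p.2 + 1) * a p.2)) (n : ℕ)
    (hab : ∀ m < n, a m = b m) : φ n = expCoeff b n := by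
  induction n using Nat.strong_induction_on with
  | _ n ih =>
    cases n with
    | zero => rw [h0, expCoeff_zero]
    | succ n =>
      have : (n + 1 : ℝ≥0∞) * φ (n + 1) = (n + 1) * expCoeff b (n + 1) := by
        rw [h, expCoeff_succ]
        refine Finset.sum_congr rfl fun p hp => ?_
        have := Finset.HasAntidiagonal.mem_antidiagonal.1 hp
        rw [ih p.1 (by omega) fun m hm => hab m (by omega), hab p.2 (by omega)]
      exact (ENNReal.mul_right_inj (by simp) (by finiteness)).1 this

/-- A sequence of coefficients satisfying the recursion of `exp ∘ A` sums up to `exp (A 1)`. -/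
theorem tsum_eq_of_exp_recursion {a φ : ℕ → ℝ≥0∞} (h0 : φ 0 = 1)
    (h : ∀ n : ℕ, (n + 1) * φ (n + 1) =
      ∑ p ∈ Finset.HasAntidiagonal.antidiagonal n, φ p.1 * ((p.2 + 1) * a p.2)) :
    ∑' n, φ n = ∑' k : ℕ, (∑' n, a n) ^ k * (k.factorial : ℝ≥0∞)⁻¹ := by
  rw [← tsum_expCoeff]
  exact tsum_congr fun n => eq_expCoeff_of_recursion h0 h n fun _ _ => rfl

/-- Setting `a` to zero from `N` on leaves the coefficients up to index `N` unchanged, and their sum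
is at most the full sum for the truncated `a`. The shift from `N + 1` to `N` is what drives the
induction in `rootedGF_le`. -/
theorem sum_range_le_of_exp_recursion {a φ : ℕ → ℝ≥0∞} (h0 : φ 0 = 1)
    (h : ∀ n : ℕ, (n + 1) * φ (n + 1) =
      ∑ p ∈ Finset.HasAntidiagonal.antidiagonal n, φ p.1 * ((p.2 + 1) * a p.2)) (N : ℕ) :
    ∑ n ∈ Finset.range (N + 1), φ n ≤
      ∑' k : ℕ, (∑ n ∈ Finset.range N, a n) ^ k * (k.factorial : ℝ≥0∞)⁻¹ := by
  set b : ℕ → ℝ≥0∞ := fun m => if m ∈ Finset.range N then a m else 0 with hb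
  have hsum : ∑ n ∈ Finset.range N, a n = ∑' n, b n := by
    rw [tsum_eq_sum (s := Finset.range N) fun n hn => if_neg hn]
    exact Finset.sum_congr rfl fun n hn => (if_pos hn).symm
  rw [hsum, ← tsum_expCoeff]
  refine le_trans (le_of_eq ?_) (ENNReal.sum_le_tsum (Finset.range (N + 1)))
  refine Finset.sum_congr rfl fun n hn => eq_expCoeff_of_recursion h0 h n fun m hm => ?_
  have := Finset.mem_range.1 hn
  rw [hb]
  exact (if_pos (Finset.mem_range.2 (by omega))).symm

theorem tsum_pow_div_factorial {x : ℝ≥0∞} (hx : x ≠ ∞) :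
    ∑' k : ℕ, x ^ k * (k.factorial : ℝ≥0∞)⁻¹ = ENNReal.ofReal (Real.exp x.toReal) := by
  have h : HasSum (fun k : ℕ => x.toReal ^ k / k.factorial) (Real.exp x.toReal) := by
    rw [Real.exp_eq_exp_ℝ]
    exact NormedSpace.expSeries_div_hasSum_exp x.toReal
  rw [← h.tsum_eq, ENNReal.ofReal_tsum_of_nonneg (fun k => by positivity) h.summable]
  refine tsum_congr fun k => ?_
  rw [ENNReal.ofReal_div_of_pos (by positivity), ENNReal.ofReal_pow ENNReal.toReal_nonneg,
    ENNReal.ofReal_toReal hx, ENNReal.ofReal_natCast, div_eq_mul_inv]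

/-! ### Point configurations, their measurable structure and the tree weight. -/

section Configurations

variable {S : Type*} [MeasurableSpace S]

theorem measurable_pointConfig (n : ℕ) : Measurable (pointConfig : (Fin n → S) → Config S) := by
  refine Measurable.subtype_mk (Measure.measurable_of_measurable_coe _ fun A hA => ?_)
  simp only [Measure.finsetSum_apply, Measure.dirac_apply' _ hA]
  exact Finset.measurable_sum _ fun i _ =>
    (measurable_const.indicator hA).comp (measurable_pi_apply i)

theorem lintegral_pointConfig {n : ℕ} (x : Fin n → S) {f : S → ℝ≥0∞} (hf : Measurable f) :
    ∫⁻ r, f r ∂(pointConfig x).1 = ∑ i, f (x i) := by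
  simp [pointConfig, lintegral_finsetSum_measure, lintegral_dirac' _ hf]

/-- The mass at a point is the size of the fibre over it, so the fibres of the two vectors are
equinumerous and bijections between them assemble. -/
theorem exists_equiv_of_pointConfig_eq [MeasurableSingletonClass S] {n m : ℕ} {x : Fin n → S}
    {y : Fin m → S} (h : pointConfig x = pointConfig y) : ∃ σ : Fin n ≃ Fin m, x = y ∘ σ := by
  classical
  have hcard : ∀ (k : ℕ) (z : Fin k → S) (s : S),
      (pointConfig z).1 {s} = (Fintype.card {i // z i = s} : ℝ≥0∞) := by
    intro k z s
    simp only [pointConfig, Measure.finsetSum_apply, Measure.dirac_apply]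
    simp [Set.indicator_apply, Fintype.card_subtype]
  have hfib : ∀ s, Nonempty ({i // x i = s} ≃ {i // y i = s}) := by
    intro s
    have := hcard n x s
    rw [h, hcard m y s] at this
    exact ⟨Fintype.equivOfCardEq (by exact_mod_cast this.symm)⟩
  let e := fun s => (hfib s).some
  refine ⟨(Equiv.sigmaFiberEquiv x).symm.trans
    ((Equiv.sigmaCongrRight e).trans (Equiv.sigmaFiberEquiv y)), ?_⟩
  ext i
  simp only [Function.comp_apply, Equiv.trans_apply]
  exact (((e (x i)) ⟨i, rfl⟩).2).symm

theorem Config.isFiniteMeasure (k : Config S) : IsFiniteMeasure k.1 := by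
  obtain ⟨m, hm⟩ := k.2 Set.univ MeasurableSet.univ
  exact ⟨by rw [hm]; exact ENNReal.natCast_lt_top m⟩

/-- A countable algebra generating the sigma-algebra of `S` determines a finite measure, so
countably many events `k A = m` separate configurations. This enters the descent of measurability in
`Config.measurable_of_pointConfig`. -/
instance Config.countablySeparated [MeasurableSpace.CountablyGenerated S] :
    MeasurableSpace.CountablySeparated (Config S) := by
  obtain ⟨b, hbc, hb⟩ := ‹MeasurableSpace.CountablyGenerated S›
  set C := generateSetAlgebra b
  have hC : C.Countable := countable_generateSetAlgebra hbc
  have hgen : ‹MeasurableSpace S› = MeasurableSpace.generateFrom C := by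
    rw [generateFrom_generateSetAlgebra_eq, hb]
  have hmeas : ∀ A ∈ C, MeasurableSet A := fun A hA => hgen ▸
    MeasurableSpace.measurableSet_generateFrom hA
  refine ⟨⟨(fun q : Set S × ℕ => {k : Config S | k.1 q.1 = q.2}) '' (C ×ˢ Set.univ),
    (hC.prod Set.countable_univ).image _, ?_, ?_⟩⟩
  · rintro _ ⟨⟨A, m⟩, ⟨hA, -⟩, rfl⟩
    exact ((Measure.measurable_coe (hmeas A hA)).comp measurable_subtype_coe)
      (measurableSet_singleton _)
  · intro k _ k' _ h
    have := k.isFiniteMeasure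
    have heq : ∀ A ∈ C, k.1 A = k'.1 A := by
      intro A hA
      obtain ⟨m, hm⟩ := k.2 A (hmeas A hA)
      have := (h _ ⟨(A, m), ⟨hA, Set.mem_univ _⟩, rfl⟩).1 hm
      rw [hm, this]
    refine Subtype.ext (ext_of_generate_finite C hgen ?_ heq
      (heq _ isSetAlgebra_generateSetAlgebra.univ_mem))
    intro A hA B hB _
    exact isSetAlgebra_generateSetAlgebra.inter_mem hA hB

end Configurations

section Tau

variable {S : Type*} [MetricSpace S] [CompactSpace S] [MeasurableSpace S] [BorelSpace S]

/-- A function on configurations is measurable if it is measurable in terms of the points. -/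
theorem Config.measurable_of_pointConfig {β : Type*} [MeasurableSpace β] {g : Config S → β}
    (hg : ∀ n, Measurable fun x : Fin n → S => g (pointConfig x)) : Measurable g := by
  rcases isEmpty_or_nonempty S with hS | hS
  · have : Subsingleton (Config S) :=
      ⟨fun k k' => Subtype.ext (Subsingleton.elim _ _)⟩
    exact Subsingleton.measurable
  have hproj : ∀ n : ℕ, Measurable fun (x : ℕ → S) (i : Fin n) => x i := fun n =>
    measurable_pi_lambda _ fun i => measurable_pi_apply _
  -- A single standard Borel space that maps onto all configurations: a number of points, and a
  -- sequence of which only the first entries are used.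
  let f : ℕ × (ℕ → S) → Config S := fun q => pointConfig fun i : Fin q.1 => q.2 i
  have hf : Measurable f := measurable_from_prod_countable_right fun n =>
    (measurable_pointConfig n).comp (hproj n)
  have hsurj : Function.Surjective f := by
    intro k
    obtain ⟨n, x, hx⟩ := k.exists_compatible
    refine ⟨(n, fun i => if h : i < n then x ⟨i, h⟩ else Classical.arbitrary S), ?_⟩
    rw [← hx]
    simp [f]
  have hgf : Measurable (g ∘ f) := measurable_from_prod_countable_right fun n =>
    (hg n).comp (hproj n)
  intro s hs
  -- A measurable surjection from a standard Borel space onto a countably separated space reflects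
  -- measurability of sets.
  exact (hf.measurableSet_preimage_iff_of_surjective hsurj).1 (hgf hs)

variable {κ : S → S → ℝ}

theorem tau_pointConfig (hκ : ∀ r s, κ r s = κ s r) {n : ℕ} (x : Fin n → S) :
    tau κ (pointConfig x) = treeWeight κ x := by
  have h := (pointConfig x).exists_compatible.choose_spec.choose_spec
  obtain ⟨σ, hσ⟩ := exists_equiv_of_pointConfig_eq h
  rw [tau, treeWeight_eq_treeSum hκ, treeWeight_eq_treeSum hκ, ← treeSum_comp_equiv _ x σ]
  exact congrArg _ hσ

/-- The kernel as a nonnegative weight on unordered pairs. -/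
noncomputable def edgeWeight (κ : S → S → ℝ) (hκ : ∀ r s, κ r s = κ s r) : Sym2 S → ℝ≥0∞ :=
  fun e => ENNReal.ofReal (Sym2.lift ⟨κ, hκ⟩ e)

theorem ofReal_tau_pointConfig (hκ : ∀ r s, κ r s = κ s r) (hκ0 : ∀ r s, 0 ≤ κ r s) {n : ℕ}
    (x : Fin n → S) :
    ENNReal.ofReal (tau κ (pointConfig x)) = treeSum (edgeWeight κ hκ) x := by
  rw [tau_pointConfig hκ, treeWeight_eq_treeSum hκ, ofReal_treeSum]
  · rfl
  · intro e; induction e with | _ a b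
    exact hκ0 a b

theorem measurable_treeSum (hκ : ∀ r s, κ r s = κ s r) (hc : Continuous (Function.uncurry κ))
    {V : Type*} [Fintype V] :
    Measurable fun x : V → S => treeSum (edgeWeight κ hκ) x := by
  refine Finset.measurable_sum _ fun T _ => Finset.measurable_prod _ fun e _ => ?_
  induction e with | _ a b
  exact (hc.measurable.comp ((measurable_pi_apply a).prodMk (measurable_pi_apply b))).ennreal_ofReal

theorem tau_nonneg (hκ0 : ∀ r s, 0 ≤ κ r s) (k : Config S) :
    0 ≤ tau κ k :=
  Finset.sum_nonneg fun _ _ => Finset.prod_nonneg fun _ _ => hκ0 _ _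

theorem measurable_tau (hκ : ∀ r s, κ r s = κ s r) (hκ0 : ∀ r s, 0 ≤ κ r s)
    (hc : Continuous (Function.uncurry κ)) :
    Measurable fun k : Config S => ENNReal.ofReal (tau κ k) := by
  refine Config.measurable_of_pointConfig fun n => ?_
  simp_rw [ofReal_tau_pointConfig hκ hκ0]
  exact measurable_treeSum hκ hc

end Tau

/-! ### Integration against the Poisson law. -/

section Poisson

variable {S : Type*} [MeasurableSpace S]

theorem lintegral_poissonLaw (ν : Measure S) [IsFiniteMeasure ν] {G : Config S → ℝ≥0∞}
    (hG : Measurable G) : ∫⁻ k, G k ∂poissonLaw ν = ENNReal.ofReal (Real.exp (-ν.real Set.univ)) *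
      ∑' n : ℕ, (n.factorial : ℝ≥0∞)⁻¹ *
        ∫⁻ x : Fin n → S, G (pointConfig x) ∂(Measure.pi fun _ => ν) := by
  rw [poissonLaw, lintegral_smul_measure, lintegral_sum_measure, smul_eq_mul]
  congr 1
  refine tsum_congr fun n => ?_
  rw [lintegral_smul_measure, lintegral_map hG (measurable_pointConfig n), smul_eq_mul]

instance isProbabilityMeasure_poissonLaw (ν : Measure S) [IsFiniteMeasure ν] :
    IsProbabilityMeasure (poissonLaw ν) := by
  refine ⟨?_⟩
  rw [← lintegral_one, lintegral_poissonLaw ν measurable_const]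
  simp only [lintegral_one, Measure.pi_univ, Finset.prod_const, Finset.card_univ,
    Fintype.card_fin]
  simp_rw [mul_comm _ (ν Set.univ ^ _)]
  rw [tsum_pow_div_factorial (measure_ne_top ν _), ← ENNReal.ofReal_mul (Real.exp_nonneg _),
    ← Real.exp_add]
  simp [Measure.real]

end Poisson

/-! ### Rooted trees integrated over the types, and their recursion. -/

section RootedTrees

variable {S : Type*} [MeasurableSpace S] {K : Sym2 S → ℝ≥0∞}

theorem measurable_treeSum_of_measurable (hK : Measurable fun p : S × S => K s(p.1, p.2))
    {V : Type*} [Fintype V] : Measurable fun x : V → S => treeSum K x := by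
  refine Finset.measurable_sum _ fun T _ => Finset.measurable_prod _ fun e _ => ?_
  induction e with | _ a b
  have : Measurable fun x : V → S => (x a, x b) :=
    (measurable_pi_apply a).prodMk (measurable_pi_apply b)
  exact hK.comp this

/-- The type vector on `Option V` with type `r` at the root `none`. -/
def withRoot {V : Type*} (r : S) (x : V → S) : Option V → S := fun o => o.elim r x

theorem measurable_withRoot {V : Type*} :
    Measurable fun p : S × (V → S) => withRoot p.1 p.2 := by
  refine measurable_pi_lambda _ fun o => ?_
  cases o with
  | none => exact measurable_fst
  | some v => exact (measurable_pi_apply v).comp measurable_snd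

/-- The integral over the types of the vertices in `V` of the weight of the trees on `V` with an
additional root of type `r`. -/
noncomputable def rootedIntegral (K : Sym2 S → ℝ≥0∞) (θ : Measure S) (V : Type*) [Fintype V]
    (r : S) : ℝ≥0∞ :=
  ∫⁻ x : V → S, treeSum K (withRoot r x) ∂(Measure.pi fun _ => θ)

/-- The coefficients of the generating function of rooted trees. -/
noncomputable def rootedCoeff (K : Sym2 S → ℝ≥0∞) (θ : Measure S) (n : ℕ) (r : S) : ℝ≥0∞ :=
  (n.factorial : ℝ≥0∞)⁻¹ * rootedIntegral K θ (Fin n) r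

theorem rootedCoeff_zero (θ : Measure S) (r : S) : rootedCoeff K θ 0 r = 1 := by
  have : ∀ x : Fin 0 → S, treeSum K (withRoot r x) = 1 := fun x => treeSum_of_unique _ _
  simp [rootedCoeff, rootedIntegral, this]

variable {θ : Measure S} [IsFiniteMeasure θ]

theorem lintegral_pi_comp_equiv {V W : Type*} [Fintype V] [Fintype W] (σ : V ≃ W)
    (F : (V → S) → ℝ≥0∞) : ∫⁻ x : W → S, F (x ∘ σ) ∂(Measure.pi fun _ => θ) =
      ∫⁻ x : V → S, F x ∂(Measure.pi fun _ => θ) := by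
  have := measurePreserving_piCongrLeft (fun _ : V => θ) σ.symm
  rw [← this.lintegral_comp_emb (MeasurableEquiv.measurableEmbedding _)]
  refine lintegral_congr fun x => congrArg F ?_
  ext v
  have := MeasurableEquiv.piCongrLeft_apply_apply (β := fun _ : V => S) σ.symm x (σ v)
  simpa using this.symm

theorem rootedIntegral_congr {V W : Type*} [Fintype V] [Fintype W] (σ : V ≃ W) (r : S) :
    rootedIntegral K θ V r = rootedIntegral K θ W r := by
  rw [rootedIntegral, rootedIntegral, ← lintegral_pi_comp_equiv σ]
  refine lintegral_congr fun x => ?_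
  rw [← treeSum_comp_equiv K (withRoot r x) (Equiv.optionCongr σ)]
  congr 1
  ext o
  cases o <;> rfl

theorem rootedIntegral_eq {V : Type*} [Fintype V] (r : S) : rootedIntegral K θ V r =
    ((Fintype.card V).factorial : ℝ≥0∞) * rootedCoeff K θ (Fintype.card V) r := by
  rw [rootedCoeff, ← mul_assoc, ENNReal.mul_inv_cancel (by simp [Nat.factorial_ne_zero]) (by simp),
    one_mul]
  exact rootedIntegral_congr (Fintype.equivFin V) r

theorem measurable_rootedCoeff (hK : Measurable fun p : S × S => K s(p.1, p.2)) (n : ℕ) :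
    Measurable (rootedCoeff K θ n) := by
  have : Measurable fun p : S × (Fin n → S) => treeSum K (withRoot p.1 p.2) :=
    (measurable_treeSum_of_measurable hK).comp measurable_withRoot
  exact this.lintegral_prod_right'.const_mul _

/-- Integrating an additive functional of the points against the tree weight. -/
theorem lintegral_sum_mul_treeSum_fin (hK : Measurable fun p : S × S => K s(p.1, p.2)) {f : S → ℝ≥0∞}
    (hf : Measurable f) (n : ℕ) :
    ∫⁻ x : Fin (n + 1) → S, (∑ j, f (x j)) * treeSum K x ∂(Measure.pi fun _ => θ) =
      ((n + 1).factorial : ℝ≥0∞) * ∫⁻ s, f s * rootedCoeff K θ n s ∂θ := by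
  have hT : ∀ {m : ℕ}, Measurable fun x : Fin m → S => treeSum K x := fun {m} =>
    measurable_treeSum_of_measurable hK
  have hT' : ∀ s, Measurable fun x : Fin n → S => treeSum K (withRoot s x) := fun s =>
    (measurable_treeSum_of_measurable hK).comp
      (measurable_withRoot.comp (measurable_const.prodMk measurable_id))
  -- Vertex `j` becomes the root; the `n + 1` choices contribute equally, which turns `n!` into `(n
  -- + 1)!`.
  have h1 : ∀ j : Fin (n + 1),
      ∫⁻ x : Fin (n + 1) → S, f (x j) * treeSum K x ∂(Measure.pi fun _ => θ) =
        ∫⁻ s, f s * rootedIntegral K θ (Fin n) s ∂θ := by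
    intro j
    have hmp := (measurePreserving_piFinSuccAbove (fun _ : Fin (n + 1) => θ) j).symm
    rw [← hmp.lintegral_comp_emb (MeasurableEquiv.measurableEmbedding _)]
    rw [lintegral_prod]
    · refine lintegral_congr fun s => ?_
      rw [rootedIntegral, ← lintegral_const_mul]
      · refine lintegral_congr fun x => ?_
        have hx : (MeasurableEquiv.piFinSuccAbove (fun _ => S) j).symm (s, x) =
            withRoot s x ∘ finSuccEquiv' j := by
          ext i
          cases i using Fin.succAboveCases j with
          | x =>
            change Fin.insertNth (α := fun _ => S) j s x j = _
            simp [withRoot]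
          | p i =>
            change Fin.insertNth (α := fun _ => S) j s x (j.succAbove i) = _
            simp [withRoot]
        rw [hx, treeSum_comp_equiv]
        simp [withRoot]
      · exact hT' s
    · refine Measurable.aemeasurable ?_
      refine Measurable.mul (hf.comp ?_) (hT.comp (MeasurableEquiv.measurable _))
      exact (measurable_pi_apply j).comp (MeasurableEquiv.measurable _)
  simp_rw [Finset.sum_mul]
  rw [lintegral_finsetSum (f := fun j (x : Fin (n + 1) → S) => f (x j) * treeSum K x) _
    fun j _ => (hf.comp (measurable_pi_apply j)).mul hT]
  simp_rw [h1]
  rw [Finset.sum_const, Finset.card_univ, Fintype.card_fin, nsmul_eq_mul, Nat.factorial_succ,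
    Nat.cast_mul, mul_assoc]
  congr 1
  simp_rw [rootedIntegral_eq, Fintype.card_fin]
  rw [← lintegral_const_mul (f := fun s => f s * rootedCoeff K θ n s) _
    (hf.mul (measurable_rootedCoeff hK n))]
  exact lintegral_congr fun s => by ring

theorem lintegral_sum_mul_treeSum (hK : Measurable fun p : S × S => K s(p.1, p.2)) {f : S → ℝ≥0∞}
    (hf : Measurable f) {V : Type*} [Fintype V] {n : ℕ} (hV : Fintype.card V = n + 1) :
    ∫⁻ x : V → S, (∑ j, f (x j)) * treeSum K x ∂(Measure.pi fun _ => θ) =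
      ((n + 1).factorial : ℝ≥0∞) * ∫⁻ s, f s * rootedCoeff K θ n s ∂θ := by
  rw [← lintegral_sum_mul_treeSum_fin hK hf,
    ← lintegral_pi_comp_equiv (Fintype.equivFinOfCardEq hV).symm]
  refine lintegral_congr fun x => ?_
  rw [treeSum_comp_equiv, ← (Fintype.equivFinOfCardEq hV).symm.sum_comp]
  rfl

/-- The branch at the root that contains `v` has vertex set `B`; it hangs on some `j ∈ B`, and what
is left is a tree that still contains the root. -/
theorem treeSum_withRoot_split {S V : Type*} {K : Sym2 S → ℝ≥0∞} [Fintype V] [DecidableEq V] (v : V) (r : S) (x : V → S) :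
    treeSum K (withRoot r x) = ∑ B : Finset V with v ∈ B,
      ((∑ j : {a // a ∈ B}, K s(r, x j)) * treeSum K (fun a : {a // a ∈ B} => x a)) *
        treeSum K (withRoot r fun a : {a // a ∉ B} => x a) := by
  rw [treeSum_split K (withRoot r x) (r := none) (v := some v) (by simp)]
  refine Finset.sum_bij' (fun A _ => Finset.eraseNone A) (fun B _ => B.map Function.Embedding.some)
    ?_ ?_ ?_ ?_ ?_
  · intro A hA
    simp only [Finset.mem_filter, Finset.mem_univ, true_and] at hA
    simpa using hA.1
  · intro B; simp
  · intro A hA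
    simp only [Finset.mem_filter, Finset.mem_univ, true_and] at hA
    rw [Finset.map_some_eraseNone, Finset.erase_eq_of_notMem hA.2]
  · intro B _; simp
  · intro A hA
    simp only [Finset.mem_filter, Finset.mem_univ, true_and] at hA
    set B := Finset.eraseNone A
    let e1 : {a // a ∈ B} ≃ {a // a ∈ A} :=
      { toFun := fun a => ⟨some a.1, Finset.mem_eraseNone.1 a.2⟩
        invFun := fun a => ⟨a.1.get (by
          rcases a with ⟨_ | a, ha⟩
          · exact absurd ha hA.2
          · rfl), by simp [B]⟩
        left_inv := fun a => by simp
        right_inv := fun a => by simp }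
    let e2 : Option {a // a ∉ B} ≃ {a // a ∉ A} :=
      { toFun := fun o => match o with
          | none => ⟨none, hA.2⟩
          | some a => ⟨some a.1, by simpa [B] using a.2⟩
        invFun := fun a => match a with
          | ⟨none, _⟩ => none
          | ⟨some a, ha⟩ => some ⟨a, by simpa [B] using ha⟩
        left_inv := fun o => by cases o <;> rfl
        right_inv := fun a => by rcases a with ⟨_ | a, ha⟩ <;> rfl }
    have h3 : (fun a : {a // a ∉ A} => withRoot r x a) ∘ e2 =
        withRoot r fun a : {a // a ∉ B} => x a := by
      ext o
      cases o <;> rfl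
    rw [← h3, mul_assoc]
    refine congrArg₂ _ ?_ (congrArg₂ _ ?_ ?_)
    · rw [← e1.sum_comp]
      rfl
    · have h1 := treeSum_comp_equiv K (fun a : {a // a ∈ A} => withRoot r x a) e1
      rw [show (fun a : {a // a ∈ A} => withRoot r x a) ∘ e1 = fun a : {a // a ∈ B} => x a
        from rfl] at h1
      convert h1.symm
    · have h2 := treeSum_comp_equiv K (fun a : {a // a ∉ A} => withRoot r x a) e2
      convert h2.symm

theorem lintegral_pi_mul_split {V : Type*} [Fintype V] (B : Finset V) [i₁ : Fintype {a // a ∈ B}]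
    [i₂ : Fintype {a // a ∉ B}] {F : ({a // a ∈ B} → S) → ℝ≥0∞} {G : ({a // a ∉ B} → S) → ℝ≥0∞}
    (hF : Measurable F) (hG : Measurable G) :
    ∫⁻ x : V → S, F (fun a => x a) * G (fun a => x a) ∂(Measure.pi fun _ => θ) =
      (∫⁻ x, F x ∂(Measure.pi fun _ => θ)) * ∫⁻ x, G x ∂(Measure.pi fun _ => θ) := by
  classical
  rw [← lintegral_prod_mul hF.aemeasurable hG.aemeasurable]
  have hmp := measurePreserving_piEquivPiSubtypeProd (fun _ : V => θ) (· ∈ B)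
  have h := hmp.lintegral_comp (f := fun q => F q.1 * G q.2)
    ((hF.comp measurable_fst).mul (hG.comp measurable_snd))
  have h' : ∀ x : V → S, (MeasurableEquiv.piEquivPiSubtypeProd (fun _ => S) (· ∈ B)) x =
      (fun a : {a // a ∈ B} => x a, fun a : {a // a ∉ B} => x a) := fun x => rfl
  simp only [h'] at h
  refine h.trans ?_
  congr!

/-- The types inside and outside the branch `B` are integrated independently. The choice of the
attachment vertex is an additive functional of the points of `B`, so it roots the branch there. -/
theorem rootedIntegral_split (hK : Measurable fun p : S × S => K s(p.1, p.2)) {V : Type*}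
    [Fintype V] [DecidableEq V] (v : V) (r : S) :
    rootedIntegral K θ V r = ∑ B : Finset V with v ∈ B,
      (((B.card).factorial : ℝ≥0∞) * ∫⁻ s, K s(r, s) * rootedCoeff K θ (B.card - 1) s ∂θ) *
        ((Fintype.card V - B.card).factorial * rootedCoeff K θ (Fintype.card V - B.card) r) := by
  have hKr : Measurable fun s => K s(r, s) := hK.comp (measurable_const.prodMk measurable_id)
  have hm1 : ∀ B : Finset V, Measurable fun x : {a // a ∈ B} → S =>
      (∑ j, K s(r, x j)) * treeSum K x := fun B =>
    (Finset.measurable_sum _ fun j _ => hKr.comp (measurable_pi_apply j)).mul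
      (measurable_treeSum_of_measurable hK)
  have hm2 : ∀ B : Finset V, Measurable fun x : {a // a ∉ B} → S => treeSum K (withRoot r x) :=
    fun B => (measurable_treeSum_of_measurable hK).comp
      (measurable_withRoot.comp (measurable_const.prodMk measurable_id))
  rw [rootedIntegral]
  simp_rw [treeSum_withRoot_split v]
  rw [lintegral_finsetSum]
  · refine Finset.sum_congr rfl fun B hB => ?_
    have hvB : v ∈ B := (Finset.mem_filter.1 hB).2
    have hpos : 0 < B.card := Finset.card_pos.2 ⟨v, hvB⟩
    rw [lintegral_pi_mul_split B (hm1 B) (hm2 B),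
      lintegral_sum_mul_treeSum hK hKr (n := B.card - 1) (by simp; omega)]
    have h2 := rootedIntegral_eq (K := K) (θ := θ) (V := {a // a ∉ B}) r
    rw [rootedIntegral] at h2
    rw [h2]
    have hc : Fintype.card {a // a ∉ B} = Fintype.card V - B.card := by
      rw [Fintype.card_subtype_compl]; simp
    rw [hc, Nat.sub_add_cancel hpos]
  · intro B _
    refine Measurable.mul (Measurable.mul ?_ ?_) ?_
    · exact Finset.measurable_sum _ fun j _ => hKr.comp (measurable_pi_apply _)
    · exact (measurable_treeSum_of_measurable hK).comp
        (measurable_pi_lambda _ fun a => measurable_pi_apply _)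
    · exact (hm2 B).comp (measurable_pi_lambda _ fun a => measurable_pi_apply _)

theorem sum_filter_mem_card {R : Type*} [CommSemiring R] (n : ℕ) (f : ℕ → R) :
    ∑ B : Finset (Fin (n + 1)) with 0 ∈ B, f B.card =
      ∑ m ∈ Finset.range (n + 1), (n.choose m : R) * f (m + 1) := by
  have h := Finset.sum_powerset_apply_card (fun m => f (m + 1))
    (x := Finset.univ.erase (0 : Fin (n + 1)))
  simp only [Finset.card_erase_of_mem (Finset.mem_univ _), Finset.card_univ, Fintype.card_fin,
    Nat.add_sub_cancel, nsmul_eq_mul] at h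
  rw [← h]
  refine Finset.sum_bij' (fun B _ => B.erase 0) (fun C _ => insert 0 C) ?_ ?_ ?_ ?_ ?_
  · intro B _
    exact Finset.mem_powerset.2 (Finset.erase_subset_erase _ (Finset.subset_univ _))
  · intro C _; simp
  · intro B hB
    exact Finset.insert_erase (Finset.mem_filter.1 hB).2
  · intro C hC
    refine Finset.erase_insert fun h0 => ?_
    simpa using Finset.mem_powerset.1 hC h0
  · intro B hB
    have h0 := (Finset.mem_filter.1 hB).2
    rw [Finset.card_erase_add_one h0]

/-- The recursion for the generating function `φ` of rooted trees, which says `φ' = φ (K φ)'`. -/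
theorem rootedCoeff_succ (hK : Measurable fun p : S × S => K s(p.1, p.2)) (n : ℕ) (r : S) :
    (n + 1) * rootedCoeff K θ (n + 1) r = ∑ p ∈ Finset.HasAntidiagonal.antidiagonal n,
      rootedCoeff K θ p.1 r * ((p.2 + 1) * ∫⁻ s, K s(r, s) * rootedCoeff K θ p.2 s ∂θ) := by
  have h := rootedIntegral_split (θ := θ) hK (0 : Fin (n + 1)) r
  rw [rootedIntegral_eq] at h
  simp only [Fintype.card_fin] at h
  rw [sum_filter_mem_card n fun m => ((m.factorial : ℝ≥0∞) *
    ∫⁻ s, K s(r, s) * rootedCoeff K θ (m - 1) s ∂θ) *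
        ((n + 1 - m).factorial * rootedCoeff K θ (n + 1 - m) r)] at h
  have hn : (n.factorial : ℝ≥0∞) ≠ 0 := by simp [Nat.factorial_ne_zero]
  have hn' : (n.factorial : ℝ≥0∞) ≠ ∞ := by simp
  refine (ENNReal.mul_right_inj hn hn').1 ?_
  rw [← mul_assoc, mul_comm (n.factorial : ℝ≥0∞) ((n : ℝ≥0∞) + 1)]
  have : ((n : ℝ≥0∞) + 1) * n.factorial = ((n + 1).factorial : ℝ≥0∞) := by
    rw [Nat.factorial_succ]; push_cast; ring
  rw [this, h, Finset.mul_sum, ← Finset.Nat.sum_antidiagonal_swap,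
    Finset.Nat.sum_antidiagonal_eq_sum_range_succ_mk]
  refine Finset.sum_congr rfl fun m hm => ?_
  have hmn : m ≤ n := Nat.lt_succ_iff.1 (Finset.mem_range.1 hm)
  -- Among the branches containing a fixed vertex, `n.choose m` have size `m + 1`. The factorials
  -- leave an extra `m + 1`, which is the derivative falling on the branch series.
  have hc : (n.choose m : ℝ≥0∞) * (m + 1).factorial * (n - m).factorial =
      n.factorial * (m + 1) := by
    have := Nat.choose_mul_factorial_mul_factorial hmn
    rw [← this, Nat.factorial_succ]
    push_cast
    ring
  simp only [Prod.swap_prod_mk, Nat.add_sub_add_right, Nat.add_sub_cancel]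
  calc _ = (n.choose m : ℝ≥0∞) * (m + 1).factorial * (n - m).factorial *
        (rootedCoeff K θ (n - m) r * ∫⁻ s, K s(r, s) * rootedCoeff K θ m s ∂θ) := by ring
    _ = _ := by rw [hc]; ring

end RootedTrees

/-! ### The generating function of rooted trees. -/

/-- The exponential function on the extended nonnegative reals. -/
noncomputable def expSum (x : ℝ≥0∞) : ℝ≥0∞ := ∑' k : ℕ, x ^ k * (k.factorial : ℝ≥0∞)⁻¹

theorem expSum_mono : Monotone expSum := fun x y h =>
  ENNReal.tsum_le_tsum fun k => by gcongr

theorem expSum_eq {x : ℝ≥0∞} (hx : x ≠ ∞) : expSum x = ENNReal.ofReal (Real.exp x.toReal) :=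
  tsum_pow_div_factorial hx

section GeneratingFunction

variable {S : Type*} [MeasurableSpace S] {K : Sym2 S → ℝ≥0∞}

/-- The generating function of trees rooted at a vertex of type `r`. -/
noncomputable def rootedGF (K : Sym2 S → ℝ≥0∞) (θ : Measure S) (r : S) : ℝ≥0∞ :=
  ∑' n, rootedCoeff K θ n r

variable {θ : Measure S} [IsFiniteMeasure θ]

theorem measurable_rootedGF (hK : Measurable fun p : S × S => K s(p.1, p.2)) :
    Measurable (rootedGF K θ) :=
  Measurable.tsum fun n => measurable_rootedCoeff hK n

theorem measurable_weight_right (hK : Measurable fun p : S × S => K s(p.1, p.2)) (r : S) :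
    Measurable fun s => K s(r, s) :=
  hK.comp (measurable_const.prodMk measurable_id)

theorem lintegral_weight_rootedGF (hK : Measurable fun p : S × S => K s(p.1, p.2)) (r : S) :
    ∫⁻ s, K s(r, s) * rootedGF K θ s ∂θ = ∑' n, ∫⁻ s, K s(r, s) * rootedCoeff K θ n s ∂θ := by
  rw [← lintegral_tsum fun n =>
    ((measurable_weight_right hK r).fun_mul (measurable_rootedCoeff hK n)).aemeasurable]
  simp_rw [ENNReal.tsum_mul_left]
  rfl

/-- `rootedCoeff_succ` is the exponential recursion with `a n = ∫ K(r, s) φ_n(s) θ(ds)`. Both sides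
may be infinite. -/
theorem rootedGF_eq_expSum (hK : Measurable fun p : S × S => K s(p.1, p.2)) (r : S) :
    rootedGF K θ r = expSum (∫⁻ s, K s(r, s) * rootedGF K θ s ∂θ) := by
  rw [lintegral_weight_rootedGF hK]
  exact tsum_eq_of_exp_recursion (rootedCoeff_zero θ r) fun n => rootedCoeff_succ hK n r

/-- Minimality, by induction over partial sums: the first `N + 1` coefficients sum to at most the
exponential of the kernel applied to the first `N`, hence to at most `expSum (K F) ≤ F`. -/
theorem rootedGF_le (hK : Measurable fun p : S × S => K s(p.1, p.2)) {F : S → ℝ≥0∞}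
    (hF : ∀ r, expSum (∫⁻ s, K s(r, s) * F s ∂θ) ≤ F r) (r : S) : rootedGF K θ r ≤ F r := by
  have h : ∀ N : ℕ, ∀ r, ∑ n ∈ Finset.range N, rootedCoeff K θ n r ≤ F r := by
    intro N
    induction N with
    | zero => simp
    | succ N ih =>
      intro r
      refine (sum_range_le_of_exp_recursion
        (a := fun m => ∫⁻ s, K s(r, s) * rootedCoeff K θ m s ∂θ) (rootedCoeff_zero θ r)
        (fun n => rootedCoeff_succ (θ := θ) hK n r) N).trans (le_trans (expSum_mono ?_) (hF r))
      rw [← lintegral_finsetSum (f := fun n s => K s(r, s) * rootedCoeff K θ n s) _ fun n _ =>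
        (measurable_weight_right hK r).fun_mul (measurable_rootedCoeff hK n)]
      refine lintegral_mono fun s => ?_
      simp only [← Finset.mul_sum]
      gcongr
      exact ih s
  rw [rootedGF, ENNReal.tsum_eq_iSup_nat]
  exact iSup_le fun N => h N r

/-- The total weight of all trees. -/
noncomputable def treeMass (K : Sym2 S → ℝ≥0∞) (θ : Measure S) : ℝ≥0∞ :=
  ∑' n : ℕ, (n.factorial : ℝ≥0∞)⁻¹ * ∫⁻ x : Fin n → S, treeSum K x ∂(Measure.pi fun _ => θ)

theorem tsum_lintegral_sum_mul_treeSum (hK : Measurable fun p : S × S => K s(p.1, p.2))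
    {f : S → ℝ≥0∞} (hf : Measurable f) :
    ∑' n : ℕ, (n.factorial : ℝ≥0∞)⁻¹ *
      ∫⁻ x : Fin n → S, (∑ j, f (x j)) * treeSum K x ∂(Measure.pi fun _ => θ) =
        ∫⁻ s, f s * rootedGF K θ s ∂θ := by
  rw [tsum_eq_zero_add' ENNReal.summable]
  simp only [Finset.univ_eq_empty, Finset.sum_empty, zero_mul, lintegral_const, mul_zero, zero_add]
  simp_rw [lintegral_sum_mul_treeSum_fin hK hf]
  have : ∀ n : ℕ, ∀ x : ℝ≥0∞, ((n + 1).factorial : ℝ≥0∞)⁻¹ * ((n + 1).factorial * x) = x := by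
    intro n x
    rw [← mul_assoc, ENNReal.inv_mul_cancel (by simp [Nat.factorial_ne_zero]) (by simp), one_mul]
  simp_rw [this, rootedGF, ← ENNReal.tsum_mul_left]
  rw [lintegral_tsum fun n => (hf.fun_mul (measurable_rootedCoeff hK n)).aemeasurable]

/-- The number of trees is the number of vertices minus the number of edges. -/
theorem lintegral_rootedGF (hK : Measurable fun p : S × S => K s(p.1, p.2)) :
    ∫⁻ s, rootedGF K θ s ∂θ = treeMass K θ +
      2⁻¹ * ∫⁻ r, rootedGF K θ r * ∫⁻ s, K s(r, s) * rootedGF K θ s ∂θ ∂θ := by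
  have hφ : ∀ n, Measurable (rootedCoeff K θ n) := measurable_rootedCoeff hK
  have hKφ : ∀ n, Measurable fun r => ∫⁻ s, K s(r, s) * rootedCoeff K θ n s ∂θ := fun n => by
    have : Measurable fun p : S × S => K s(p.1, p.2) * rootedCoeff K θ n p.2 :=
      hK.fun_mul ((hφ n).comp measurable_snd)
    exact this.lintegral_prod_right'
  set w : ℕ → ℝ≥0∞ := fun n =>
    (n.factorial : ℝ≥0∞)⁻¹ * ∫⁻ x : Fin n → S, treeSum K x ∂(Measure.pi fun _ => θ) with hw
  set I : ℕ → ℝ≥0∞ := fun n => ∫⁻ s, rootedCoeff K θ n s ∂θ with hI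
  set q : ℕ → ℕ → ℝ≥0∞ := fun i j =>
    ∫⁻ r, rootedCoeff K θ i r * ∫⁻ s, K s(r, s) * rootedCoeff K θ j s ∂θ ∂θ with hq
  have hw0 : w 0 = 0 := by simp [hw, treeSum_of_isEmpty]
  -- A tree on `n + 1` vertices can be rooted in `n + 1` ways.
  have hwI : ∀ n : ℕ, (n + 1) * w (n + 1) = I n := by
    intro n
    have h := lintegral_sum_mul_treeSum_fin (θ := θ) hK (measurable_const (a := (1 : ℝ≥0∞))) n
    simp only [Finset.sum_const, Finset.card_univ, Fintype.card_fin, nsmul_eq_mul, mul_one,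
      one_mul] at h
    rw [lintegral_const_mul _ (measurable_treeSum_of_measurable hK)] at h
    simp only [hw, hI]
    rw [← mul_assoc, mul_comm (_ + 1), mul_assoc]
    push_cast at h
    rw [h, ← mul_assoc, ENNReal.inv_mul_cancel (by simp [Nat.factorial_ne_zero]) (by simp), one_mul]
  have hqs : ∀ i j, q i j = q j i := by
    intro i j
    have h1 : ∀ i j, q i j =
        ∫⁻ r, ∫⁻ s, rootedCoeff K θ i r * (K s(r, s) * rootedCoeff K θ j s) ∂θ ∂θ := by
      intro i j
      refine lintegral_congr fun r => ?_
      rw [lintegral_const_mul _ ((measurable_weight_right hK r).fun_mul (hφ j))]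
    rw [h1, h1, lintegral_lintegral_swap]
    · refine lintegral_congr fun r => lintegral_congr fun s => ?_
      rw [Sym2.eq_swap]
      ring
    · exact (((hφ i).comp measurable_fst).fun_mul (hK.fun_mul ((hφ j).comp measurable_snd))).aemeasurable
  have hIq : ∀ n : ℕ, (n + 1) * I (n + 1) =
      ∑ p ∈ Finset.HasAntidiagonal.antidiagonal n, (p.2 + 1) * q p.1 p.2 := by
    intro n
    rw [hI, ← lintegral_const_mul _ (hφ _)]
    simp_rw [rootedCoeff_succ hK]
    rw [lintegral_finsetSum (f := fun (p : ℕ × ℕ) r => rootedCoeff K θ p.1 r *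
      ((p.2 + 1) * ∫⁻ s, K s(r, s) * rootedCoeff K θ p.2 s ∂θ)) _
      fun p _ => (hφ _).fun_mul ((hKφ _).const_mul _)]
    refine Finset.sum_congr rfl fun p _ => ?_
    rw [hq, ← lintegral_const_mul _ ((hφ _).fun_mul (hKφ _))]
    exact lintegral_congr fun r => by ring
  have hwq : ∀ n : ℕ, (n + 1) * w (n + 2) =
      2⁻¹ * ∑ p ∈ Finset.HasAntidiagonal.antidiagonal n, q p.1 p.2 := by
    intro n
    -- Since `q` is symmetric, `p.2 + 1` may be averaged with `p.1 + 1`, and the two add up to `n +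
    -- 2`.
    have h1 : 2 * ∑ p ∈ Finset.HasAntidiagonal.antidiagonal n, ((p.2 : ℝ≥0∞) + 1) * q p.1 p.2 =
        (n + 2) * ∑ p ∈ Finset.HasAntidiagonal.antidiagonal n, q p.1 p.2 := by
      rw [two_mul]
      nth_rewrite 1 [← Finset.Nat.sum_antidiagonal_swap]
      rw [← Finset.sum_add_distrib, Finset.mul_sum]
      refine Finset.sum_congr rfl fun p hp => ?_
      have : (n : ℝ≥0∞) = p.1 + p.2 := by
        rw [← Finset.HasAntidiagonal.mem_antidiagonal.1 hp]; push_cast; rfl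
      simp only [Prod.fst_swap, Prod.snd_swap]
      rw [hqs p.2 p.1, this]
      ring
    rw [← hIq, ← hwI] at h1
    have h2 : ((n : ℝ≥0∞) + 2) * (2 * ((n + 1) * w (n + 2))) =
        (n + 2) * ∑ p ∈ Finset.HasAntidiagonal.antidiagonal n, q p.1 p.2 := by
      rw [← h1]; push_cast; ring
    rw [ENNReal.mul_right_inj (by simp) (by finiteness)] at h2
    rw [← h2, ← mul_assoc 2⁻¹, ENNReal.inv_mul_cancel (by simp) (by simp), one_mul]
  have hA : ∫⁻ s, rootedGF K θ s ∂θ = ∑' n, I n :=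
    lintegral_tsum fun n => (hφ n).aemeasurable
  have hB : treeMass K θ = ∑' n, w (n + 1) := by
    rw [treeMass, tsum_eq_zero_add' ENNReal.summable]
    change w 0 + _ = _
    rw [hw0, zero_add]
  have hC : ∫⁻ r, rootedGF K θ r * ∫⁻ s, K s(r, s) * rootedGF K θ s ∂θ ∂θ =
      ∑' i, ∑' j, q i j := by
    simp_rw [lintegral_weight_rootedGF hK, rootedGF, ← ENNReal.tsum_mul_right]
    rw [lintegral_tsum fun i => ((hφ i).fun_mul (Measurable.tsum hKφ)).aemeasurable]
    refine tsum_congr fun i => ?_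
    simp_rw [← ENNReal.tsum_mul_left]
    rw [lintegral_tsum fun j => ((hφ i).fun_mul (hKφ j)).aemeasurable]
  rw [hA, hB, hC, ← tsum_sum_antidiagonal, ← ENNReal.tsum_mul_left]
  simp_rw [← hwq, ← hwI]
  -- A tree on `n + 1` vertices has `n` edges: vertices are one plus edges. Writing it additively
  -- avoids subtraction in `[0, ∞]`.
  have h3 : ∀ n : ℕ, ((n : ℝ≥0∞) + 1) * w (n + 1) = w (n + 1) + n * w (n + 1) := fun n => by ring
  simp_rw [h3]
  rw [ENNReal.tsum_add]
  congr 1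
  rw [tsum_eq_zero_add' ENNReal.summable]
  simp

end GeneratingFunction

/-! ### The kernel operator and the contraction argument. -/

section OperatorNorm

variable {S : Type*} [MeasurableSpace S]

theorem eLpNorm_two_sq (f : S → ℝ) (ν : Measure S) :
    eLpNorm f 2 ν ^ 2 = ∫⁻ r, ‖f r‖ₑ ^ 2 ∂ν := by
  have := eLpNorm_nnreal_pow_eq_lintegral (f := f) (μ := ν) (p := 2) (by norm_num)
  simpa using this

theorem eLpNorm_kernel_le (κ : S → S → ℝ) (ν : Measure S) {f : S → ℝ} (hf : MemLp f 2 ν) :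
    eLpNorm (fun r => ∫ s, κ r s * f s ∂ν) 2 ν ≤ opNorm κ ν * eLpNorm f 2 ν := by
  by_cases h0 : eLpNorm f 2 ν = 0
  · rw [eLpNorm_eq_zero_iff hf.1 (by norm_num)] at h0
    have : (fun r => ∫ s, κ r s * f s ∂ν) = 0 := by
      ext r
      have : (fun s => κ r s * f s) =ᵐ[ν] 0 := by
        filter_upwards [h0] with s hs
        simp [hs]
      rw [integral_congr_ae this]
      simp
    rw [this]
    simp
  · set a := eLpNorm f 2 ν
    have ha : a ≠ ∞ := hf.2.ne
    have har : 0 < a.toReal := ENNReal.toReal_pos h0 ha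
    have h1 : eLpNorm (a.toReal⁻¹ • f) 2 ν = 1 := by
      rw [eLpNorm_const_smul, Real.enorm_eq_ofReal (by positivity), ENNReal.ofReal_inv_of_pos har,
        ENNReal.ofReal_toReal ha, ENNReal.inv_mul_cancel h0 ha]
    have h2 : eLpNorm (fun r => ∫ s, κ r s * (a.toReal⁻¹ • f) s ∂ν) 2 ν ≤ opNorm κ ν :=
      le_iSup₂_of_le (a.toReal⁻¹ • f) (hf.const_smul _)
        (le_iSup_of_le h1 le_rfl)
    have h3 : (fun r => ∫ s, κ r s * (a.toReal⁻¹ • f) s ∂ν) =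
        a.toReal⁻¹ • fun r => ∫ s, κ r s * f s ∂ν := by
      ext r
      simp only [Pi.smul_apply, smul_eq_mul]
      rw [← integral_const_mul]
      congr 1
      ext s
      ring
    rw [h3, eLpNorm_const_smul, Real.enorm_eq_ofReal (by positivity),
      ENNReal.ofReal_inv_of_pos har, ENNReal.ofReal_toReal ha] at h2
    rwa [mul_comm, ← div_eq_mul_inv, ENNReal.div_le_iff h0 ha] at h2

end OperatorNorm

section Kernel

variable {S : Type*} [MetricSpace S] [CompactSpace S] [MeasurableSpace S] [BorelSpace S]
  {κ : S → S → ℝ}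

theorem exists_kernel_bound (hc : Continuous (Function.uncurry κ)) :
    ∃ M : ℝ, 0 < M ∧ ∀ r s, |κ r s| ≤ M := by
  obtain ⟨M, hM⟩ := isCompact_univ.exists_bound_of_continuousOn hc.continuousOn
  exact ⟨max M 1, by positivity, fun r s => (hM (r, s) (Set.mem_univ _)).trans (le_max_left _ _)⟩

theorem continuous_kernel_right (hc : Continuous (Function.uncurry κ)) (r : S) :
    Continuous (κ r) :=
  hc.comp (continuous_const.prodMk continuous_id)

theorem integrable_kernel_mul (hc : Continuous (Function.uncurry κ)) {ν : Measure S}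
    {f : S → ℝ} (hf : Integrable f ν) (r : S) : Integrable (fun s => κ r s * f s) ν := by
  obtain ⟨M, -, hM⟩ := exists_kernel_bound hc
  exact hf.bdd_mul (continuous_kernel_right hc r).aestronglyMeasurable
    (Filter.Eventually.of_forall fun s => hM r s)

theorem integrable_kernel (hc : Continuous (Function.uncurry κ)) (ν : Measure S)
    [IsFiniteMeasure ν] (r : S) : Integrable (κ r) ν := by
  simpa using integrable_kernel_mul hc (integrable_const (1 : ℝ)) r

theorem continuous_integral_kernel_mul (hc : Continuous (Function.uncurry κ)) {ν : Measure S}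
    {f : S → ℝ} (hf : Integrable f ν) : Continuous fun r => ∫ s, κ r s * f s ∂ν := by
  obtain ⟨M, -, hM⟩ := exists_kernel_bound hc
  refine continuous_of_dominated (bound := fun s => M * |f s|)
    (fun r => (integrable_kernel_mul hc hf r).1) (fun r => ?_) (hf.abs.const_mul M) ?_
  · refine Filter.Eventually.of_forall fun s => ?_
    rw [norm_mul]
    exact mul_le_mul_of_nonneg_right (hM r s) (abs_nonneg _)
  · refine Filter.Eventually.of_forall fun s => ?_
    exact (hc.comp (continuous_id.prodMk continuous_const)).mul continuous_const

theorem continuous_kernelInt (hc : Continuous (Function.uncurry κ)) (ν : Measure S)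
    [IsFiniteMeasure ν] : Continuous (kernelInt κ ν) := by
  have := continuous_integral_kernel_mul hc (integrable_const (1 : ℝ)) (ν := ν)
  simp only [mul_one] at this
  exact this

theorem kernelInt_nonneg (h0 : ∀ r s, 0 ≤ κ r s) (ν : Measure S) (r : S) : 0 ≤ kernelInt κ ν r :=
  integral_nonneg fun s => h0 r s

theorem kernelInt_le {M : ℝ} (hM : ∀ r s, |κ r s| ≤ M) (ν : Measure S)
    [IsFiniteMeasure ν] (r : S) : kernelInt κ ν r ≤ M * ν.real Set.univ := by
  refine (le_abs_self _).trans ?_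
  exact norm_integral_le_of_norm_le_const (f := κ r) (Filter.Eventually.of_forall fun s => hM r s)

theorem ofReal_integral_kernel_mul (hc : Continuous (Function.uncurry κ)) (h0 : ∀ r s, 0 ≤ κ r s)
    {ν : Measure S} {f : S → ℝ} (hf : Integrable f ν) (hf0 : ∀ s, 0 ≤ f s) (r : S) :
    ENNReal.ofReal (∫ s, κ r s * f s ∂ν) =
      ∫⁻ s, ENNReal.ofReal (κ r s) * ENNReal.ofReal (f s) ∂ν := by
  rw [ofReal_integral_eq_lintegral_ofReal (integrable_kernel_mul hc hf r)
    (Filter.Eventually.of_forall fun s => mul_nonneg (h0 r s) (hf0 s))]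
  exact lintegral_congr fun s => ENNReal.ofReal_mul (h0 r s)

theorem ofReal_kernelInt (hc : Continuous (Function.uncurry κ)) (h0 : ∀ r s, 0 ≤ κ r s)
    (ν : Measure S) [IsFiniteMeasure ν] (r : S) :
    ENNReal.ofReal (kernelInt κ ν r) = ∫⁻ s, ENNReal.ofReal (κ r s) ∂ν :=
  ofReal_integral_eq_lintegral_ofReal (integrable_kernel hc ν r)
    (Filter.Eventually.of_forall fun s => h0 r s)

theorem measurable_edgeWeight (hκ : ∀ r s, κ r s = κ s r) (hc : Continuous (Function.uncurry κ)) :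
    Measurable fun p : S × S => edgeWeight κ hκ s(p.1, p.2) :=
  hc.measurable.ennreal_ofReal

theorem edgeWeight_mk (hκ : ∀ r s, κ r s = κ s r) (r s : S) :
    edgeWeight κ hκ s(r, s) = ENNReal.ofReal (κ r s) := rfl

/-- A nonnegative bounded solution of `ρ = 1 - exp (-Tρ)` vanishes if `T` is a contraction. -/
theorem ae_eq_zero_of_opNorm_le_one (hc : Continuous (Function.uncurry κ))
    {ν : Measure S} [IsFiniteMeasure ν] (hν : opNorm κ ν ≤ 1) {ρ : S → ℝ}
    (hρ : Measurable ρ) (hρ0 : ∀ r, 0 ≤ ρ r) (hρ1 : ∀ r, ρ r ≤ 1)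
    (h : ∀ r, ρ r = 1 - Real.exp (-∫ s, κ r s * ρ s ∂ν)) : ρ =ᵐ[ν] 0 := by
  have hmem : MemLp ρ 2 ν := MemLp.of_bound hρ.aestronglyMeasurable 1
    (Filter.Eventually.of_forall fun r => by
      rw [Real.norm_eq_abs, abs_of_nonneg (hρ0 r)]; exact hρ1 r)
  have hint : Integrable ρ ν := hmem.integrable (by norm_num)
  set t : S → ℝ := fun r => ∫ s, κ r s * ρ s ∂ν with ht
  -- Pointwise `ρ ≤ Tρ` because `1 - e^{-x} ≤ x`, whereas the norm of `Tρ` is at most that of `ρ`;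
  -- so the two agree almost everywhere. As `1 - e^{-x} < x` for `x ≠ 0`, the common value is zero,
  -- also when the norm of `T` is exactly one.
  have hle : ∀ r, ρ r ≤ t r := fun r => by
    have := Real.add_one_le_exp (-t r)
    rw [h r]; linarith
  have hnorm : eLpNorm t 2 ν ≤ eLpNorm ρ 2 ν :=
    (eLpNorm_kernel_le κ ν hmem).trans (mul_le_of_le_one_left (zero_le) hν)
  have hsq := pow_le_pow_left' hnorm 2
  rw [eLpNorm_two_sq, eLpNorm_two_sq] at hsq
  have hfin : ∫⁻ r, ‖ρ r‖ₑ ^ 2 ∂ν ≠ ∞ := by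
    rw [← eLpNorm_two_sq]
    exact ENNReal.pow_ne_top hmem.2.ne
  have hmt : Measurable t := (continuous_integral_kernel_mul hc hint).measurable
  have := ae_eq_of_ae_le_of_lintegral_le (f := fun r => ‖ρ r‖ₑ ^ 2) (g := fun r => ‖t r‖ₑ ^ 2)
    (Filter.Eventually.of_forall fun r => by
      refine pow_le_pow_left' ?_ 2
      rw [Real.enorm_eq_ofReal (hρ0 r), Real.enorm_eq_ofReal ((hρ0 r).trans (hle r))]
      exact ENNReal.ofReal_le_ofReal (hle r)) hfin (hmt.enorm.pow_const 2).aemeasurable hsq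
  filter_upwards [this] with r hr
  have heq : ρ r = t r := by
    have h1 := (ENNReal.pow_right_strictMono two_ne_zero).injective hr
    rw [Real.enorm_eq_ofReal (hρ0 r), Real.enorm_eq_ofReal ((hρ0 r).trans (hle r))] at h1
    exact (ENNReal.ofReal_eq_ofReal_iff (hρ0 r) ((hρ0 r).trans (hle r))).1 h1
  by_contra hne
  have h2 := Real.add_one_lt_exp (x := -t r) (by rw [← heq]; simpa using hne)
  have h3 : ρ r = 1 - Real.exp (-t r) := h r
  linarith

end Kernel

/-! ### The measure `λ_c`: integrated configuration and mass. -/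

section Minimizer

variable {S : Type*} [MeasurableSpace S]

theorem lintegral_integratedConfig (l : Measure (Config S)) {f : S → ℝ≥0∞} (hf : Measurable f) :
    ∫⁻ r, f r ∂(integratedConfig l) = ∫⁻ k, ∫⁻ r, f r ∂k.1 ∂l :=
  Measure.lintegral_bind measurable_subtype_coe.aemeasurable hf.aemeasurable

theorem isFiniteMeasure_theta (κ : S → S → ℝ) (h0 : ∀ r s, 0 ≤ κ r s) (c : Measure S)
    [IsFiniteMeasure c] : IsFiniteMeasure (theta κ c) := by
  refine isFiniteMeasure_withDensity (ne_top_of_le_ne_top (measure_ne_top c Set.univ) ?_)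
  rw [← lintegral_one]
  refine lintegral_mono fun r => ?_
  rw [← ENNReal.ofReal_one]
  refine ENNReal.ofReal_le_ofReal (Real.exp_le_one_iff.2 ?_)
  have : 0 ≤ kernelInt κ c r := integral_nonneg fun s => h0 r s
  linarith

end Minimizer

section Minimizer

variable {S : Type*} [MetricSpace S] [CompactSpace S] [MeasurableSpace S] [BorelSpace S]
  {κ : S → S → ℝ}

/-- The factor `e^{θ_c(S)}` cancels the normalization of the Poisson law, which leaves a plain
exponential generating sum over trees. -/
theorem lintegral_minimizer (hκ : ∀ r s, κ r s = κ s r) (h0 : ∀ r s, 0 ≤ κ r s)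
    (hc : Continuous (Function.uncurry κ)) (c : Measure S) [IsFiniteMeasure c]
    {G : Config S → ℝ≥0∞} (hG : Measurable G) :
    ∫⁻ k, G k ∂(minimizer κ c) = ∑' n : ℕ, (n.factorial : ℝ≥0∞)⁻¹ *
      ∫⁻ x : Fin n → S, G (pointConfig x) * treeSum (edgeWeight κ hκ) x
        ∂(Measure.pi fun _ => theta κ c) := by
  have := isFiniteMeasure_theta κ h0 c
  have hτ := measurable_tau hκ h0 hc
  rw [minimizer, lintegral_smul_measure, lintegral_withDensity_eq_lintegral_mul _ hτ hG,
    lintegral_poissonLaw _ (hτ.mul hG), smul_eq_mul, ← mul_assoc, ← ENNReal.ofReal_mul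
    (Real.exp_nonneg _), ← Real.exp_add, add_neg_cancel, Real.exp_zero, ENNReal.ofReal_one, one_mul]
  refine tsum_congr fun n => ?_
  congr 1
  refine lintegral_congr fun x => ?_
  rw [Pi.mul_apply, ofReal_tau_pointConfig hκ h0, mul_comm]

theorem minimizer_univ (hκ : ∀ r s, κ r s = κ s r) (h0 : ∀ r s, 0 ≤ κ r s)
    (hc : Continuous (Function.uncurry κ)) (c : Measure S) [IsFiniteMeasure c] :
    minimizer κ c Set.univ = treeMass (edgeWeight κ hκ) (theta κ c) := by
  rw [← lintegral_one, lintegral_minimizer hκ h0 hc c measurable_const]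
  simp [treeMass]

theorem minimizer_zero (hκ : ∀ r s, κ r s = κ s r) (h0 : ∀ r s, 0 ≤ κ r s)
    (hc : Continuous (Function.uncurry κ)) (c : Measure S) [IsFiniteMeasure c] :
    minimizer κ c {k | k.1 = 0} = 0 := by
  have hset : {k : Config S | k.1 = 0} = {k | k.1 Set.univ = 0} := by
    ext k; simp
  have hm : MeasurableSet {k : Config S | k.1 Set.univ = 0} :=
    ((Measure.measurable_coe MeasurableSet.univ).comp measurable_subtype_coe)
      (measurableSet_singleton 0)
  rw [hset, ← lintegral_indicator_one hm, lintegral_minimizer hκ h0 hc c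
    (measurable_one.indicator hm), ENNReal.tsum_eq_zero]
  intro n
  rw [mul_eq_zero]
  right
  rw [lintegral_eq_zero_of_ae_eq_zero]
  refine Filter.Eventually.of_forall fun x => ?_
  rcases n with _ | n
  · simp [treeSum_of_isEmpty]
  · have : pointConfig x ∉ {k : Config S | k.1 Set.univ = 0} := by
      simp only [pointConfig, Set.mem_ofPred_eq, Measure.finsetSum_apply, measure_univ]
      simp
    simp only [Set.indicator_of_notMem this, zero_mul, Pi.zero_apply]

/-- Integrating a configuration against `f` marks one of its vertices, and the marked vertex serves
as the root. -/
theorem integratedConfig_minimizer (hκ : ∀ r s, κ r s = κ s r) (h0 : ∀ r s, 0 ≤ κ r s)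
    (hc : Continuous (Function.uncurry κ)) (c : Measure S) [IsFiniteMeasure c] :
    integratedConfig (minimizer κ c) =
      (theta κ c).withDensity (rootedGF (edgeWeight κ hκ) (theta κ c)) := by
  have := isFiniteMeasure_theta κ h0 c
  have hK := measurable_edgeWeight hκ hc
  refine Measure.ext_of_lintegral _ fun f hf => ?_
  have hmf : Measurable fun k : Config S => ∫⁻ r, f r ∂k.1 :=
    (Measure.measurable_lintegral hf).comp measurable_subtype_coe
  rw [lintegral_integratedConfig _ hf, lintegral_minimizer hκ h0 hc c hmf,
    lintegral_withDensity_eq_lintegral_mul _ (measurable_rootedGF hK) hf]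
  simp_rw [lintegral_pointConfig _ hf]
  rw [tsum_lintegral_sum_mul_treeSum hK hf]
  exact lintegral_congr fun s => mul_comm _ _

/-- In the subcritical and critical regimes, all vertices lie in finite components. -/
theorem rootedGF_ae_eq (hκ : ∀ r s, κ r s = κ s r) (h0 : ∀ r s, 0 ≤ κ r s)
    (hc : Continuous (Function.uncurry κ)) (c : Measure S) [IsFiniteMeasure c]
    (hcrit : opNorm κ c ≤ 1) :
    ∀ᵐ r ∂c, rootedGF (edgeWeight κ hκ) (theta κ c) r =
      ENNReal.ofReal (Real.exp (kernelInt κ c r)) := by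
  have := isFiniteMeasure_theta κ h0 c
  have hK := measurable_edgeWeight hκ hc
  have hmc : Measurable (kernelInt κ c) := (continuous_kernelInt hc c).measurable
  set Φ := rootedGF (edgeWeight κ hκ) (theta κ c) with hΦ
  have hmΦ : Measurable Φ := measurable_rootedGF hK
  set F : S → ℝ≥0∞ := fun r => ENNReal.ofReal (Real.exp (kernelInt κ c r)) with hF
  set E : S → ℝ≥0∞ := fun r => ENNReal.ofReal (Real.exp (-kernelInt κ c r)) with hE
  have hmE : Measurable E := (hmc.neg.exp).ennreal_ofReal
  have hEF : ∀ r, E r * F r = 1 := fun r => by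
    rw [hE, hF, ← ENNReal.ofReal_mul (Real.exp_nonneg _), ← Real.exp_add]
    simp
  have hθ : ∀ (u : S → ℝ≥0∞), Measurable u → ∀ r,
      ∫⁻ s, edgeWeight κ hκ s(r, s) * u s ∂(theta κ c) =
        ∫⁻ s, ENNReal.ofReal (κ r s) * (E s * u s) ∂c := by
    intro u hu r
    rw [theta, lintegral_withDensity_eq_lintegral_mul _ hmE ((measurable_weight_right hK r).fun_mul hu)]
    refine lintegral_congr fun s => ?_
    simp only [Pi.mul_apply, edgeWeight_mk]
    ring
  -- The function `e^{κc}` also solves the fixed point equation, because `e^{κc} θ_c = c`; and `Φ`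
  -- is the least solution. In particular `Φ` is finite.
  have hle : ∀ r, Φ r ≤ F r := by
    refine rootedGF_le hK fun r => ?_
    rw [hθ F (hmc.exp.ennreal_ofReal) r]
    simp_rw [hEF, mul_one]
    rw [← ofReal_kernelInt hc h0 c r, expSum_eq ENNReal.ofReal_ne_top,
      ENNReal.toReal_ofReal (kernelInt_nonneg h0 c r)]
  set ψ : S → ℝ := fun r => (E r * Φ r).toReal with hψ
  have hmψ : Measurable ψ := (hmE.mul hmΦ).ennreal_toReal
  have hEΦ : ∀ r, E r * Φ r ≤ 1 := fun r => (mul_le_mul_right (hle r) (E r)).trans (hEF r).le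
  have hψ0 : ∀ r, 0 ≤ ψ r := fun r => ENNReal.toReal_nonneg
  have hψ1 : ∀ r, ψ r ≤ 1 := fun r => ENNReal.toReal_le_of_le_ofReal zero_le_one (by simpa using hEΦ r)
  have hψi : Integrable ψ c := Integrable.of_bound hmψ.aestronglyMeasurable 1
    (Filter.Eventually.of_forall fun r => by
      rw [Real.norm_eq_abs, abs_of_nonneg (hψ0 r)]; exact hψ1 r)
  have hoψ : ∀ r, ENNReal.ofReal (ψ r) = E r * Φ r := fun r =>
    ENNReal.ofReal_toReal ((hEΦ r).trans_lt ENNReal.one_lt_top).ne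
  have hfix : ∀ r, ψ r = Real.exp (-(kernelInt κ c r - ∫ s, κ r s * ψ s ∂c)) := by
    intro r
    have h1 := rootedGF_eq_expSum (θ := theta κ c) hK r
    rw [hθ _ hmΦ r] at h1
    simp_rw [← hoψ] at h1
    have h2 : 0 ≤ ∫ s, κ r s * ψ s ∂c := integral_nonneg fun s => mul_nonneg (h0 r s) (hψ0 s)
    rw [← ofReal_integral_kernel_mul hc h0 hψi hψ0, expSum_eq ENNReal.ofReal_ne_top,
      ENNReal.toReal_ofReal h2] at h1
    rw [hψ]
    simp only
    rw [hΦ, h1, hE, ← ENNReal.ofReal_mul (Real.exp_nonneg _), ← Real.exp_add,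
      ENNReal.toReal_ofReal (Real.exp_nonneg _)]
    congr 1
    ring
  -- In terms of `ψ = e^{-κc} Φ ∈ [0, 1]` the fixed point equation reads `ψ = exp (-T(1 - ψ))`, with
  -- `T` the kernel operator for `c`.
  have hρ := ae_eq_zero_of_opNorm_le_one hc hcrit (ρ := fun r => 1 - ψ r)
    (measurable_const.sub hmψ) (fun r => by linarith [hψ1 r]) (fun r => by linarith [hψ0 r]) (by
      intro r
      rw [hfix r, kernelInt, ← integral_sub (integrable_kernel hc c r)
        (integrable_kernel_mul hc hψi r)]
      simp only [mul_sub, mul_one])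
  filter_upwards [hρ] with r hr
  have h1 : ψ r = 1 := (sub_eq_zero.1 hr).symm
  have h2 : E r * Φ r = 1 := by rw [← hoψ, h1, ENNReal.ofReal_one]
  have hE0 : E r ≠ 0 := fun h => by simp [h] at h2
  rw [← hEF r] at h2
  exact (ENNReal.mul_right_inj hE0 ENNReal.ofReal_ne_top).1 h2

theorem integratedConfig_minimizer_eq (hκ : ∀ r s, κ r s = κ s r) (h0 : ∀ r s, 0 ≤ κ r s)
    (hc : Continuous (Function.uncurry κ)) (c : Measure S) [IsFiniteMeasure c]
    (hcrit : opNorm κ c ≤ 1) : integratedConfig (minimizer κ c) = c := by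
  have := isFiniteMeasure_theta κ h0 c
  have hmc : Measurable (kernelInt κ c) := (continuous_kernelInt hc c).measurable
  rw [integratedConfig_minimizer hκ h0 hc]
  have hΦ := measurable_rootedGF (θ := theta κ c) (measurable_edgeWeight hκ hc)
  have h1 := withDensity_mul c (f := fun r => ENNReal.ofReal (Real.exp (-kernelInt κ c r)))
    hmc.fun_neg.exp.ennreal_ofReal hΦ
  refine h1.symm.trans ?_
  conv_rhs => rw [← withDensity_one (μ := c)]
  refine withDensity_congr_ae ?_
  filter_upwards [rootedGF_ae_eq hκ h0 hc c hcrit] with r hr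
  simp only [Pi.mul_apply, hr]
  rw [← ENNReal.ofReal_mul (Real.exp_nonneg _), ← Real.exp_add]
  simp

/-- Trees are vertices minus edges. Since `Φ θ_c = c`, there are `c(S)` vertices and `½ ⟨c, κc⟩`
edges. -/
theorem minimizer_mass (hκ : ∀ r s, κ r s = κ s r) (h0 : ∀ r s, 0 ≤ κ r s)
    (hc : Continuous (Function.uncurry κ)) (c : Measure S) [IsFiniteMeasure c]
    (hcrit : opNorm κ c ≤ 1) : IsFiniteMeasure (minimizer κ c) ∧
      (minimizer κ c).real Set.univ = c.real Set.univ - 1 / 2 * ∫ r, kernelInt κ c r ∂c := by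
  have := isFiniteMeasure_theta κ h0 c
  have hK := measurable_edgeWeight hκ hc
  have hΦ : Measurable (rootedGF (edgeWeight κ hκ) (theta κ c)) := measurable_rootedGF hK
  have h := lintegral_rootedGF (θ := theta κ c) hK
  have hci := integratedConfig_minimizer_eq hκ h0 hc c hcrit
  rw [integratedConfig_minimizer hκ h0 hc] at hci
  have key : ∀ u : S → ℝ≥0∞, Measurable u →
      ∫⁻ r, rootedGF (edgeWeight κ hκ) (theta κ c) r * u r ∂(theta κ c) = ∫⁻ r, u r ∂c := by
    intro u hu
    conv_rhs => rw [← hci]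
    rw [lintegral_withDensity_eq_lintegral_mul _ hΦ hu]
    rfl
  have h1 : ∫⁻ r, rootedGF (edgeWeight κ hκ) (theta κ c) r ∂(theta κ c) = c Set.univ := by
    have := key 1 measurable_one
    simpa using this
  have h2 : ∀ r, ∫⁻ s, edgeWeight κ hκ s(r, s) * rootedGF (edgeWeight κ hκ) (theta κ c) s
      ∂(theta κ c) = ENNReal.ofReal (kernelInt κ c r) := by
    intro r
    rw [ofReal_kernelInt hc h0, ← key (fun s => ENNReal.ofReal (κ r s))
      (measurable_weight_right hK r)]
    exact lintegral_congr fun s => mul_comm _ _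
  simp_rw [h2] at h
  have hmk : Measurable (kernelInt κ c) := (continuous_kernelInt hc c).measurable
  rw [key _ hmk.ennreal_ofReal, h1, ← minimizer_univ hκ h0 hc] at h
  have hfin : minimizer κ c Set.univ ≠ ∞ :=
    ne_top_of_le_ne_top (measure_ne_top c Set.univ) (h ▸ le_self_add)
  refine ⟨⟨hfin.lt_top⟩, ?_⟩
  obtain ⟨M, hM0, hM⟩ := exists_kernel_bound hc
  have hint : Integrable (kernelInt κ c) c := Integrable.of_bound hmk.aestronglyMeasurable
    (M * c.real Set.univ) (Filter.Eventually.of_forall fun r => by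
      rw [Real.norm_eq_abs, abs_of_nonneg (kernelInt_nonneg h0 c r)]
      exact kernelInt_le hM c r)
  rw [← ofReal_integral_eq_lintegral_ofReal hint
    (Filter.Eventually.of_forall (kernelInt_nonneg h0 c))] at h
  have h3 := congrArg ENNReal.toReal h
  rw [ENNReal.toReal_add hfin (by finiteness), ENNReal.toReal_mul, ENNReal.toReal_ofReal
    (integral_nonneg (kernelInt_nonneg h0 c))] at h3
  simp only [Measure.real]
  rw [h3]
  simp

end Minimizer

/-! ### The density of `λ_b` with respect to the Poisson law of `μ`. -/

section Products

variable {S : Type*} [MeasurableSpace S]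

theorem lintegral_pi_prod {n : ℕ} (μ : Fin n → Measure S) [∀ i, SigmaFinite (μ i)] {h : S → ℝ≥0∞}
    (hh : Measurable h) :
    ∫⁻ x, ∏ i, h (x i) ∂(Measure.pi μ) = ∏ i, ∫⁻ s, h s ∂(μ i) := by
  induction n with
  | zero => simp
  | succ n ih =>
    have hmp := (measurePreserving_piFinSuccAbove μ 0).symm
    have hm : Measurable fun x : Fin n → S => ∏ i, h (x i) :=
      Finset.measurable_prod _ fun i _ => hh.comp (measurable_pi_apply i)
    rw [← hmp.lintegral_comp_emb (MeasurableEquiv.measurableEmbedding _), Fin.prod_univ_succ]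
    have := ih (fun i => μ (Fin.succAbove 0 i))
    simp only [Fin.succAbove_zero] at this
    rw [← this, ← lintegral_prod_mul hh.aemeasurable hm.aemeasurable]
    refine lintegral_congr fun q => ?_
    rw [Fin.prod_univ_succ]
    rfl

theorem pi_withDensity_fin {n : ℕ} (μ : Measure S) [IsFiniteMeasure μ] {h : S → ℝ≥0∞}
    (hh : Measurable h) [IsFiniteMeasure (μ.withDensity h)] :
    (Measure.pi fun _ : Fin n => μ.withDensity h) =
      (Measure.pi fun _ : Fin n => μ).withDensity fun x => ∏ i, h (x i) := by
  refine Measure.pi_eq fun s hs => ?_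
  rw [withDensity_apply _ (MeasurableSet.univ_pi hs), Measure.restrict_pi_pi,
    lintegral_pi_prod _ hh]
  exact Finset.prod_congr rfl fun i _ => (withDensity_apply _ (hs i)).symm

end Products

/-- The function `x ↦ e^{-x}` on `[0, ∞]`. -/
noncomputable def expNeg (x : ℝ≥0∞) : ℝ≥0∞ := if x = ∞ then 0 else ENNReal.ofReal (Real.exp (-x.toReal))

theorem measurable_expNeg : Measurable expNeg :=
  Measurable.ite (measurableSet_singleton _) measurable_const
    (ENNReal.measurable_toReal.neg.exp.ennreal_ofReal)

theorem expNeg_zero : expNeg 0 = 1 := by simp [expNeg]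

theorem expNeg_add (x y : ℝ≥0∞) : expNeg (x + y) = expNeg x * expNeg y := by
  by_cases hx : x = ∞
  · simp [expNeg, hx]
  by_cases hy : y = ∞
  · simp [expNeg, hy]
  simp only [expNeg, hx, hy, ENNReal.add_eq_top, or_self, if_false]
  rw [ENNReal.toReal_add hx hy, neg_add, Real.exp_add, ENNReal.ofReal_mul (Real.exp_nonneg _)]

theorem expNeg_sum {ι : Type*} (s : Finset ι) (f : ι → ℝ≥0∞) :
    expNeg (∑ i ∈ s, f i) = ∏ i ∈ s, expNeg (f i) := by
  classical
  induction s using Finset.induction_on with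
  | empty => simp [expNeg_zero]
  | insert a s ha ih => rw [Finset.sum_insert ha, Finset.prod_insert ha, expNeg_add, ih]

/-- The function `-log` on `[0, 1]`, with values in `[0, ∞]`. -/
noncomputable def negLog (h : ℝ≥0∞) : ℝ≥0∞ := if h = 0 then ∞ else ENNReal.ofReal (-Real.log h.toReal)

theorem measurable_negLog : Measurable negLog :=
  Measurable.ite (measurableSet_singleton _) measurable_const
    (ENNReal.measurable_toReal.log.neg.ennreal_ofReal)

theorem expNeg_negLog {h : ℝ≥0∞} (hh : h ≤ 1) : expNeg (negLog h) = h := by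
  by_cases h0 : h = 0
  · simp [expNeg, negLog, h0]
  have ht : h ≠ ∞ := (hh.trans_lt ENNReal.one_lt_top).ne
  have hpos : 0 < h.toReal := ENNReal.toReal_pos h0 ht
  have hle : h.toReal ≤ 1 := ENNReal.toReal_le_of_le_ofReal zero_le_one (by simpa using hh)
  simp only [expNeg, negLog, h0, if_false, ENNReal.ofReal_ne_top]
  rw [ENNReal.toReal_ofReal (neg_nonneg.2 (Real.log_nonpos hpos.le hle)), neg_neg,
    Real.exp_log hpos, ENNReal.ofReal_toReal ht]

section ExtIntegral

variable {α : Type*} [MeasurableSpace α]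

theorem extIntegral_congr {ν : Measure α} {f g : α → EReal} (h : f =ᵐ[ν] g) :
    extIntegral ν f = extIntegral ν g := by
  rw [extIntegral, extIntegral]
  congr 2
  · exact lintegral_congr_ae (h.mono fun x hx => by simp only [hx])
  · exact lintegral_congr_ae (h.mono fun x hx => by simp only [hx])

theorem extIntegral_coe {ν : Measure α} {u : α → ℝ} (hu : Integrable u ν) :
    extIntegral ν (fun x => (u x : EReal)) = ((∫ x, u x ∂ν : ℝ) : EReal) := by
  rw [integral_eq_lintegral_pos_part_sub_lintegral_neg_part hu, extIntegral, EReal.coe_sub]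
  have h1 : ∫⁻ x, ENNReal.ofReal (u x) ∂ν ≠ ∞ := hu.lintegral_lt_top.ne
  have h2 : ∫⁻ x, ENNReal.ofReal (-u x) ∂ν ≠ ∞ := hu.neg.lintegral_lt_top.ne
  change ((∫⁻ x, ENNReal.ofReal (u x) ∂ν : ℝ≥0∞) : EReal) -
    ((∫⁻ x, ENNReal.ofReal (-u x) ∂ν : ℝ≥0∞) : EReal) = _
  rw [← EReal.coe_ennreal_toReal h1, ← EReal.coe_ennreal_toReal h2]

theorem extIntegral_eq_top {ν : Measure α} {f : α → EReal} (h1 : ∫⁻ x, (f x).toENNReal ∂ν = ∞)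
    (h2 : ∫⁻ x, (-f x).toENNReal ∂ν ≠ ∞) : extIntegral ν f = ⊤ := by
  rw [extIntegral, h1, ← EReal.coe_ennreal_toReal h2]
  exact EReal.top_sub_coe _

end ExtIntegral

section RateFormula

variable {S : Type*} [MetricSpace S] [CompactSpace S] [MeasurableSpace S] [BorelSpace S]
  {κ : S → S → ℝ}

/-- The density of `θ_b` with respect to `μ`, for `b ≤ μ`. -/
noncomputable def thetaDensity (κ : S → S → ℝ) (μ b : Measure S) (r : S) : ℝ≥0∞ :=
  min (b.rnDeriv μ r) 1 * ENNReal.ofReal (Real.exp (-kernelInt κ b r))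

theorem measurable_thetaDensity (hc : Continuous (Function.uncurry κ)) (μ b : Measure S)
    [IsFiniteMeasure b] : Measurable (thetaDensity κ μ b) :=
  ((Measure.measurable_rnDeriv b μ).min measurable_const).mul
    (continuous_kernelInt hc b).measurable.neg.exp.ennreal_ofReal

theorem thetaDensity_le_one (h0 : ∀ r s, 0 ≤ κ r s) (μ b : Measure S) (r : S) :
    thetaDensity κ μ b r ≤ 1 := by
  refine mul_le_one' (min_le_right _ _) ?_
  rw [ENNReal.ofReal_le_one]
  exact Real.exp_le_one_iff.2 (by linarith [kernelInt_nonneg h0 b r])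

/-- Cutting `db/dμ` off at `1` changes it only on a null set since `b ≤ μ`, and makes the bound by
one hold at every point. -/
theorem theta_eq_withDensity (hc : Continuous (Function.uncurry κ)) {μ b : Measure S}
    [IsFiniteMeasure μ] [IsFiniteMeasure b] (hb : b ≤ μ) :
    theta κ b = μ.withDensity (thetaDensity κ μ b) := by
  have hm : Measurable fun r => min (b.rnDeriv μ r) 1 :=
    (Measure.measurable_rnDeriv b μ).min measurable_const
  have h1 : μ.withDensity (fun r => min (b.rnDeriv μ r) 1) = b := by
    conv_rhs => rw [← Measure.withDensity_rnDeriv_eq b μ (Measure.absolutelyContinuous_of_le hb)]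
    refine withDensity_congr_ae ?_
    filter_upwards [Measure.rnDeriv_le_one_of_le hb] with r hr
    exact min_eq_left hr
  have h2 := withDensity_mul μ hm
    (continuous_kernelInt hc b).measurable.fun_neg.exp.ennreal_ofReal
  rw [h1] at h2
  exact h2.symm

/-- The sum of `-log (dθ_b/dμ)` over the points of a configuration. -/
noncomputable def logCost (κ : S → S → ℝ) (μ b : Measure S) (k : Config S) : ℝ≥0∞ :=
  ∫⁻ r, negLog (thetaDensity κ μ b r) ∂k.1

theorem measurable_logCost (hc : Continuous (Function.uncurry κ)) (μ b : Measure S)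
    [IsFiniteMeasure b] : Measurable (logCost κ μ b) :=
  (Measure.measurable_lintegral (measurable_negLog.comp (measurable_thetaDensity hc μ b))).comp
    measurable_subtype_coe

/-- The density of the minimizer with respect to the Poisson law. -/
noncomputable def minimizerDensity (κ : S → S → ℝ) (μ b : Measure S) (k : Config S) : ℝ≥0∞ :=
  ENNReal.ofReal (Real.exp 1) * (ENNReal.ofReal (tau κ k) * expNeg (logCost κ μ b k))

theorem measurable_minimizerDensity (hκ : ∀ r s, κ r s = κ s r) (h0 : ∀ r s, 0 ≤ κ r s)
    (hc : Continuous (Function.uncurry κ)) (μ b : Measure S) [IsFiniteMeasure b] :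
    Measurable (minimizerDensity κ μ b) :=
  ((measurable_tau hκ h0 hc).mul (measurable_expNeg.comp (measurable_logCost hc μ b))).const_mul _

/-- On `n` points, passing from `θ_b` to `μ` costs the product of `h(x_i)`. Written as `expNeg` of
an integral against `k`, it is visibly a function of the configuration alone. The factor `e` undoes
the normalization of the Poisson law of the probability measure `μ`. -/
theorem minimizer_eq_withDensity (hκ : ∀ r s, κ r s = κ s r) (h0 : ∀ r s, 0 ≤ κ r s)
    (hc : Continuous (Function.uncurry κ)) {μ b : Measure S} [IsProbabilityMeasure μ]
    [IsFiniteMeasure b] (hb : b ≤ μ) :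
    minimizer κ b = (poissonLaw μ).withDensity (minimizerDensity κ μ b) := by
  have hD := measurable_minimizerDensity hκ h0 hc μ b
  have hh := measurable_thetaDensity hc μ b
  have hfin := isFiniteMeasure_theta κ h0 b
  refine Measure.ext_of_lintegral _ fun G hG => ?_
  rw [lintegral_minimizer hκ h0 hc b hG, lintegral_withDensity_eq_lintegral_mul _ hD hG,
    lintegral_poissonLaw μ (hD.mul hG), ← ENNReal.tsum_mul_left]
  refine tsum_congr fun n => ?_
  rw [theta_eq_withDensity hc hb] at hfin ⊢
  have hprod : Measurable fun x : Fin n → S => ∏ i, thetaDensity κ μ b (x i) :=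
    Finset.measurable_prod _ fun i _ => hh.comp (measurable_pi_apply i)
  have hGm : Measurable fun x : Fin n → S => G (pointConfig x) * treeSum (edgeWeight κ hκ) x :=
    (hG.comp (measurable_pointConfig n)).mul (measurable_treeSum hκ hc)
  rw [pi_withDensity_fin μ hh, lintegral_withDensity_eq_lintegral_mul _ hprod hGm,
    mul_left_comm, ← lintegral_const_mul
      (f := fun x : Fin n → S => (minimizerDensity κ μ b * G) (pointConfig x)) _
      ((hD.mul hG).comp (measurable_pointConfig n))]
  congr 1
  refine lintegral_congr fun x => ?_
  have h1 : expNeg (logCost κ μ b (pointConfig x)) = ∏ i, thetaDensity κ μ b (x i) := by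
    rw [logCost, lintegral_pointConfig (f := fun r => negLog (thetaDensity κ μ b r)) x
      (measurable_negLog.comp hh), expNeg_sum]
    exact Finset.prod_congr rfl fun i _ => expNeg_negLog (thetaDensity_le_one h0 μ b _)
  have h2 : ENNReal.ofReal (Real.exp (-μ.real Set.univ)) * ENNReal.ofReal (Real.exp 1) = 1 := by
    rw [← ENNReal.ofReal_mul (Real.exp_nonneg _), ← Real.exp_add]
    simp
  simp only [Pi.mul_apply, minimizerDensity, ofReal_tau_pointConfig hκ h0, h1]
  calc _ = 1 * ((∏ i, thetaDensity κ μ b (x i)) *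
        (G (pointConfig x) * treeSum (edgeWeight κ hκ) x)) := (one_mul _).symm
    _ = _ := by rw [← h2]; ring

end RateFormula

/-! ### The microscopic rate function as a relative entropy. -/

open InformationTheory

section RateFormula

variable {S : Type*} [MetricSpace S] [CompactSpace S] [MeasurableSpace S] [BorelSpace S]
  {κ : S → S → ℝ}

theorem ofReal_log_le {a b m : ℝ} (ha : 0 ≤ a) (hm : 0 ≤ m) (h : b ≤ a + m) :
    ENNReal.ofReal b ≤ ENNReal.ofReal a + ENNReal.ofReal m := by
  rw [← ENNReal.ofReal_add ha hm]
  exact ENNReal.ofReal_le_ofReal h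

/-- The constant in the representation of the microscopic rate function as a relative entropy with
respect to the minimizer for `b`. -/
noncomputable def rateConst (κ : S → S → ℝ) (μ b c : Measure S) : ℝ :=
  c.real Set.univ - (minimizer κ b).real Set.univ + ∫ r, Real.log (b.rnDeriv μ r).toReal ∂c
    - ∫ r, kernelInt κ b r ∂c + 1 / 2 * ∫ r, kernelInt κ μ r ∂c

variable {μ b c : Measure S} [IsProbabilityMeasure μ]

theorem integrable_kernelInt (hc : Continuous (Function.uncurry κ)) (ν c : Measure S)
    [IsFiniteMeasure ν] [IsFiniteMeasure c] : Integrable (kernelInt κ ν) c := by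
  obtain ⟨M, -, hM⟩ := exists_kernel_bound hc
  refine Integrable.of_bound (continuous_kernelInt hc ν).measurable.aestronglyMeasurable
    (M * ν.real Set.univ) (Filter.Eventually.of_forall fun r => ?_)
  exact norm_integral_le_of_norm_le_const (f := κ r) (Filter.Eventually.of_forall fun s => hM r s)

/-- The total logarithmic cost under a law with integrated configuration `c`. -/
theorem lintegral_logCost (h0 : ∀ r s, 0 ≤ κ r s) (hc : Continuous (Function.uncurry κ))
    [IsFiniteMeasure b] [IsFiniteMeasure c] (hb : b ≤ μ) (hcb : c ≪ b)
    (hlog : Integrable (fun r => Real.log (b.rnDeriv μ r).toReal) c)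
    {l : Measure (Config S)} (hlc : integratedConfig l = c) :
    ∫⁻ k, logCost κ μ b k ∂l = ENNReal.ofReal
      (∫ r, (kernelInt κ b r - Real.log (b.rnDeriv μ r).toReal) ∂c) ∧
    0 ≤ ∫ r, (kernelInt κ b r - Real.log (b.rnDeriv μ r).toReal) ∂c := by
  have hbμ : b ≪ μ := Measure.absolutelyContinuous_of_le hb
  have hle : ∀ᵐ r ∂c, b.rnDeriv μ r ≤ 1 :=
    (hcb.trans hbμ).ae_le (Measure.rnDeriv_le_one_of_le hb)
  have hpos : ∀ᵐ r ∂c, 0 < b.rnDeriv μ r := hcb.ae_le (Measure.rnDeriv_pos hbμ)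
  have hlognp : ∀ᵐ r ∂c, Real.log (b.rnDeriv μ r).toReal ≤ 0 := by
    filter_upwards [hle] with r hr
    exact Real.log_nonpos ENNReal.toReal_nonneg
      (ENNReal.toReal_le_of_le_ofReal zero_le_one (by simpa using hr))
  have hnn : 0 ≤ᵐ[c] fun r => kernelInt κ b r - Real.log (b.rnDeriv μ r).toReal := by
    filter_upwards [hlognp] with r hr
    have := kernelInt_nonneg h0 b r
    simp only [Pi.zero_apply]
    linarith
  refine ⟨?_, integral_nonneg_of_ae hnn⟩
  have hm := measurable_negLog.comp (measurable_thetaDensity hc μ b)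
  -- An integral of a sum over points sees `l` only through its integrated configuration.
  have h1 := lintegral_integratedConfig l hm
  rw [hlc] at h1
  refine h1.symm.trans ?_
  rw [ofReal_integral_eq_lintegral_ofReal
    (f := fun r => kernelInt κ b r - Real.log (b.rnDeriv μ r).toReal)
    ((integrable_kernelInt hc b c).sub hlog) hnn]
  refine lintegral_congr_ae ?_
  filter_upwards [hle, hpos] with r hr hr0
  have hfin : b.rnDeriv μ r ≠ ∞ := (hr.trans_lt ENNReal.one_lt_top).ne
  have h2 : thetaDensity κ μ b r ≠ 0 := by
    rw [thetaDensity, min_eq_left hr]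
    exact mul_ne_zero hr0.ne' (by simpa using Real.exp_pos _)
  simp only [Function.comp_apply, negLog, h2, if_false]
  rw [thetaDensity, min_eq_left hr, ENNReal.toReal_mul, ENNReal.toReal_ofReal (Real.exp_nonneg _),
    Real.log_mul (ENNReal.toReal_pos hr0.ne' hfin).ne' (Real.exp_pos _).ne', Real.log_exp]
  congr 1
  ring

/-- Chain rule for densities: `dl/dQ_μ = (dl/dλ_b) · e τ exp(-cost)`, so that `τ` cancels and the
cost integrates to a number fixed by `c`. The work lies in matching infinite values: the negative
part of the integrand always has finite integral, so each failure of absolute continuity or of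
integrability makes both sides `⊤`. -/
theorem rateMi_eq (hκ : ∀ r s, κ r s = κ s r) (h0 : ∀ r s, 0 ≤ κ r s)
    (hc : Continuous (Function.uncurry κ)) [IsFiniteMeasure b] [IsFiniteMeasure c]
    [IsFiniteMeasure (minimizer κ b)] (hb : b ≤ μ) (hcb : c ≪ b)
    (hlog : Integrable (fun r => Real.log (b.rnDeriv μ r).toReal) c)
    {l : Measure (Config S)} [IsFiniteMeasure l] (hlc : integratedConfig l = c) :
    rateMi κ μ l = (klDiv l (minimizer κ b) : EReal) + (rateConst κ μ b c : EReal) := by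
  set Q := poissonLaw μ with hQ
  set D := minimizerDensity κ μ b with hDdef
  have hD : Measurable D := measurable_minimizerDensity hκ h0 hc μ b
  have hτ := measurable_tau hκ h0 hc
  have hmin : minimizer κ b = Q.withDensity D := minimizer_eq_withDensity hκ h0 hc hb
  have hmQ : minimizer κ b ≪ Q := hmin ▸ withDensity_absolutelyContinuous _ _
  by_cases hlQ : l ≪ Q
  swap
  · rw [rateMi, if_neg hlQ, klDiv_of_not_ac fun h => hlQ (h.trans hmQ)]
    simp
  rw [rateMi, if_pos hlQ, hlc]
  set ℓ := l.rnDeriv Q with hℓ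
  set f : Config S → EReal :=
    fun k => ENNReal.log (ℓ k) - ENNReal.log (ENNReal.ofReal (tau κ k)) with hf
  set m : ℝ := ∫ r, (kernelInt κ b r - Real.log (b.rnDeriv μ r).toReal) ∂c with hm
  obtain ⟨hcost, hm0⟩ := lintegral_logCost h0 hc hb hcb hlog hlc
  have hcm : Measurable (logCost κ μ b) := measurable_logCost hc μ b
  have hcost_ne : ∫⁻ k, logCost κ μ b k ∂l ≠ ∞ := by rw [hcost]; exact ENNReal.ofReal_ne_top
  have hcost_fin : ∀ᵐ k ∂l, logCost κ μ b k < ∞ := ae_lt_top hcm hcost_ne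
  have hℓpos : ∀ᵐ k ∂l, 0 < ℓ k := Measure.rnDeriv_pos hlQ
  have hℓfin : ∀ᵐ k ∂l, ℓ k < ∞ := hlQ.ae_le (Measure.rnDeriv_lt_top l Q)
  have hDT : ∀ k, logCost κ μ b k < ∞ → D k = ENNReal.ofReal
      (Real.exp 1 * (tau κ k * Real.exp (-(logCost κ μ b k).toReal))) := by
    intro k hk
    rw [hDdef, minimizerDensity, expNeg, if_neg hk.ne, ← ENNReal.ofReal_mul (tau_nonneg h0 k),
      ← ENNReal.ofReal_mul (Real.exp_nonneg _)]
  have hlogD : ∀ k, 0 < tau κ k → Real.log (Real.exp 1 * (tau κ k *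
      Real.exp (-(logCost κ μ b k).toReal))) = 1 + Real.log (tau κ k) - (logCost κ μ b k).toReal := by
    intro k hk
    rw [Real.log_mul (Real.exp_pos _).ne' (by positivity), Real.log_mul hk.ne' (by positivity),
      Real.log_exp, Real.log_exp]
    ring
  -- By `log x ≤ x - 1` at `x = D/ℓ`, the negative part is at most `D/ℓ` plus the cost. The first
  -- integrates to at most the mass of `λ_b`, the second to a finite number.
  have hneg : ∫⁻ k, (-f k).toENNReal ∂l ≠ ∞ := by
    have hbd : ∀ᵐ k ∂l, (-f k).toENNReal ≤ D k / ℓ k + logCost κ μ b k := by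
      filter_upwards [hcost_fin, hℓpos, hℓfin] with k h1 h2 h3
      have hℓr : 0 < (ℓ k).toReal := ENNReal.toReal_pos h2.ne' h3.ne
      have hlogℓ : ENNReal.log (ℓ k) = ((Real.log (ℓ k).toReal : ℝ) : EReal) :=
        ENNReal.log_pos_real h2.ne' h3.ne
      rcases (tau_nonneg h0 k).eq_or_lt with hT | hT
      · simp only [hf, hlogℓ, ← hT, ENNReal.ofReal_zero, ENNReal.log_zero, EReal.coe_sub_bot,
          EReal.neg_top, EReal.toENNReal_bot]
        exact zero_le
      · simp only [hf, hlogℓ, ENNReal.log_ofReal_of_pos hT]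
        rw [← EReal.coe_sub, ← EReal.coe_neg, EReal.real_coe_toENNReal, hDT k h1]
        set d := Real.exp 1 * (tau κ k * Real.exp (-(logCost κ μ b k).toReal)) with hd
        have hdpos : 0 < d := by positivity
        have e1 : ENNReal.ofReal d / ℓ k = ENNReal.ofReal (d / (ℓ k).toReal) := by
          rw [ENNReal.ofReal_div_of_pos hℓr, ENNReal.ofReal_toReal h3.ne]
        have e2 : logCost κ μ b k = ENNReal.ofReal (logCost κ μ b k).toReal :=
          (ENNReal.ofReal_toReal h1.ne).symm
        rw [e1, e2]
        refine ofReal_log_le (by positivity) ENNReal.toReal_nonneg ?_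
        have e3 := hlogD k hT
        rw [← hd] at e3
        have e4 := Real.log_le_sub_one_of_pos (x := d / (ℓ k).toReal) (by positivity)
        rw [Real.log_div hdpos.ne' hℓr.ne', e3] at e4
        linarith
    refine ne_top_of_le_ne_top ?_ (lintegral_mono_ae hbd)
    rw [lintegral_add_right _ hcm]
    refine ENNReal.add_ne_top.2 ⟨?_, hcost_ne⟩
    have e1 : ∫⁻ k, D k / ℓ k ∂l ≤ ∫⁻ k, D k ∂Q := by
      conv_lhs => rw [← Measure.withDensity_rnDeriv_eq l Q hlQ]
      rw [lintegral_withDensity_eq_lintegral_mul _ (Measure.measurable_rnDeriv l Q)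
        (hD.fun_div (Measure.measurable_rnDeriv l Q))]
      refine lintegral_mono fun k => ?_
      exact ENNReal.mul_div_le
    refine ne_top_of_le_ne_top ?_ e1
    rw [← setLIntegral_univ, ← withDensity_apply _ MeasurableSet.univ, ← hmin]
    exact measure_ne_top _ _
  have hQ1 : Q.real Set.univ = 1 := by simp [Measure.real]
  rw [hQ1]
  by_cases hT : ∀ᵐ k ∂l, 0 < tau κ k
  swap
  -- If `τ` vanishes with positive `l`-measure, then `l` charges a null set of `λ_b`, and the
  -- integrand is `+∞` there.
  · have hnac : ¬ l ≪ minimizer κ b := by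
      intro hac
      have hQT : ∀ᵐ k ∂(Q.withDensity D), 0 < tau κ k := ?_
      · exact hT (hac.ae_le (hmin ▸ hQT))
      rw [ae_withDensity_iff hD]
      refine Filter.Eventually.of_forall fun k hk => ?_
      refine (tau_nonneg h0 k).lt_of_ne fun h => hk ?_
      simp [hDdef, minimizerDensity, ← h]
    rw [klDiv_of_not_ac hnac, extIntegral_eq_top ?_ hneg]
    · rw [EReal.top_add_coe, EReal.coe_ennreal_top, EReal.top_add_coe]
    · by_contra hne
      refine hT ?_
      have hmeas : Measurable fun k => (f k).toENNReal :=
        ((ENNReal.measurable_log.comp (Measure.measurable_rnDeriv l Q)).sub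
          (ENNReal.measurable_log.comp hτ)).ereal_toENNReal
      filter_upwards [ae_lt_top hmeas hne, hℓpos, hℓfin] with k h1 h2 h3
      refine (tau_nonneg h0 k).lt_of_ne fun h => h1.ne ?_
      simp only [hf, ← h, ENNReal.log_pos_real h2.ne' h3.ne, ENNReal.ofReal_zero, ENNReal.log_zero,
        EReal.coe_sub_bot, EReal.toENNReal_top]
  have hac : l ≪ minimizer κ b := by
    refine Measure.AbsolutelyContinuous.mk fun N hN hN0 => ?_
    rw [hmin, withDensity_apply_eq_zero hD] at hN0
    have h1 := hlQ hN0
    have h2 : ∀ᵐ k ∂l, D k ≠ 0 := by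
      filter_upwards [hT, hcost_fin] with k h1 h2
      rw [hDT k h2]
      simp only [ne_eq, ENNReal.ofReal_eq_zero, not_le]
      positivity
    refine measure_mono_null (t := {k | D k ≠ 0} ∩ N ∪ {k | ¬ D k ≠ 0}) (fun k hk => ?_)
      (measure_union_null h1 h2)
    by_cases hk0 : D k ≠ 0
    · exact Or.inl ⟨hk0, hk⟩
    · exact Or.inr hk0
  have hdD : (minimizer κ b).rnDeriv Q =ᵐ[l] D :=
    hlQ.ae_eq (hmin ▸ Measure.rnDeriv_withDensity Q hD)
  have hchain := hlQ.ae_eq (Measure.rnDeriv_mul_rnDeriv (κ := Q) hac)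
  -- The logarithm of the chain rule; every factor is positive and finite `l`-almost everywhere.
  have hfu : f =ᵐ[l] fun k =>
      ((llr l (minimizer κ b) k + (1 - (logCost κ μ b k).toReal) : ℝ) : EReal) := by
    filter_upwards [hT, hcost_fin, hℓpos, hℓfin, hdD, hchain, Measure.rnDeriv_pos hac,
      hac.ae_le (Measure.rnDeriv_lt_top l (minimizer κ b))] with k h1 h2 h3 h4 h5 h6 h7 h8
    simp only [hf, ENNReal.log_pos_real h3.ne' h4.ne, ENNReal.log_ofReal_of_pos h1]
    rw [← EReal.coe_sub]
    congr 1
    rw [Pi.mul_apply, h5, hDT k h2] at h6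
    have h9 := congrArg (fun x => Real.log x.toReal) h6
    simp only [ENNReal.toReal_mul] at h9
    rw [Real.log_mul (ENNReal.toReal_pos h7.ne' h8.ne).ne' (by
      rw [ENNReal.toReal_ofReal (by positivity)]; positivity),
      ENNReal.toReal_ofReal (by positivity), hlogD k h1] at h9
    rw [llr, hℓ, ← h9]
    ring
  have hci : Integrable (fun k => (logCost κ μ b k).toReal) l :=
    integrable_toReal_of_lintegral_ne_top hcm.aemeasurable hcost_ne
  have hcv : ∫ k, (logCost κ μ b k).toReal ∂l = m := by
    rw [integral_toReal hcm.aemeasurable hcost_fin, hcost, ENNReal.toReal_ofReal hm0]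
  have hvi : Integrable (fun k => 1 - (logCost κ μ b k).toReal) l := (integrable_const 1).sub hci
  rw [extIntegral_congr hfu]
  have hneg' : ∫⁻ k, ENNReal.ofReal (-(llr l (minimizer κ b) k +
      (1 - (logCost κ μ b k).toReal))) ∂l ≠ ∞ := by
    rw [lintegral_congr_ae (g := fun k => (-f k).toENNReal)]
    · exact hneg
    · filter_upwards [hfu] with k hk
      rw [hk]
      rfl
  by_cases hint : Integrable (llr l (minimizer κ b)) l
  · rw [extIntegral_coe (u := fun k => llr l (minimizer κ b) k + (1 - (logCost κ μ b k).toReal))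
      (hint.add hvi), integral_add hint hvi, integral_sub (integrable_const 1) hci,
      hcv, klDiv_of_ac_of_integrable hac hint]
    have hkl := integral_llr_add_sub_measure_univ_nonneg hac hint
    rw [EReal.coe_ennreal_ofReal, max_eq_left hkl, ← EReal.coe_add, ← EReal.coe_add]
    congr 1
    have hmsplit : m = ∫ r, kernelInt κ b r ∂c - ∫ r, Real.log (b.rnDeriv μ r).toReal ∂c :=
      integral_sub (integrable_kernelInt hc b c) hlog
    rw [hmsplit, rateConst]
    simp only [integral_const, smul_eq_mul, mul_one]
    ring
  · rw [klDiv_of_not_integrable hint, extIntegral_eq_top ?_ hneg']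
    · rw [EReal.top_add_coe, EReal.coe_ennreal_top, EReal.top_add_coe]
    -- If the positive part had finite integral too, then the integrand, and with it `llr`, would be
    -- integrable.
    · by_contra hne
      refine hint ?_
      have hmeas : Measurable fun k => llr l (minimizer κ b) k + (1 - (logCost κ μ b k).toReal) :=
        (measurable_llr _ _).add (measurable_const.sub hcm.ennreal_toReal)
      have hu : Integrable (fun k => llr l (minimizer κ b) k + (1 - (logCost κ μ b k).toReal)) l := by
        refine ⟨hmeas.aestronglyMeasurable, ?_⟩
        rw [hasFiniteIntegral_iff_enorm]
        have : ∀ k, ‖llr l (minimizer κ b) k + (1 - (logCost κ μ b k).toReal)‖ₑ ≤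
            ENNReal.ofReal (llr l (minimizer κ b) k + (1 - (logCost κ μ b k).toReal)) +
            ENNReal.ofReal (-(llr l (minimizer κ b) k + (1 - (logCost κ μ b k).toReal))) := by
          intro k
          rw [← ofReal_norm, Real.norm_eq_abs]
          rcases abs_cases (llr l (minimizer κ b) k + (1 - (logCost κ μ b k).toReal)) with h | h
          · rw [h.1]; exact le_self_add
          · rw [h.1]; exact le_add_self
        refine (lintegral_mono this).trans_lt ?_
        rw [lintegral_add_left hmeas.ennreal_ofReal]
        exact ENNReal.add_lt_top.2 ⟨lt_top_iff_ne_top.2 hne, lt_top_iff_ne_top.2 hneg'⟩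
      have := hu.sub hvi
      refine this.congr (Filter.Eventually.of_forall fun k => ?_)
      simp
end RateFormula

open Filter
open scoped Topology

/-! ### Densities and the Schur test. -/

section Densities

variable {S : Type*} [MeasurableSpace S]

theorem integral_withDensity_ofReal (c : Measure S) {u : S → ℝ} (hu : Measurable u)
    (hu0 : ∀ r, 0 ≤ u r) (f : S → ℝ) :
    ∫ r, f r ∂(c.withDensity fun r => ENNReal.ofReal (u r)) = ∫ r, u r * f r ∂c := by
  rw [integral_withDensity_eq_integral_toReal_smul hu.ennreal_ofReal
    (Eventually.of_forall fun _ => ENNReal.ofReal_lt_top)]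
  refine integral_congr_ae (Eventually.of_forall fun r => ?_)
  simp only [ENNReal.toReal_ofReal (hu0 r), smul_eq_mul]

theorem withDensity_ofReal_mul (c : Measure S) {u v : S → ℝ} (hu : Measurable u)
    (hu0 : ∀ r, 0 ≤ u r) (hv : Measurable v) :
    (c.withDensity fun r => ENNReal.ofReal (u r)).withDensity (fun r => ENNReal.ofReal (v r)) =
      c.withDensity fun r => ENNReal.ofReal (u r * v r) := by
  rw [← withDensity_mul c hu.ennreal_ofReal hv.ennreal_ofReal]
  refine congrArg _ (funext fun r => ?_)
  rw [Pi.mul_apply, ENNReal.ofReal_mul (hu0 r)]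

theorem lintegral_sq_le_mul_lintegral_sq (ρ : Measure S) {u : S → ℝ≥0∞} (hu : Measurable u) :
    (∫⁻ s, u s ∂ρ) ^ 2 ≤ ρ Set.univ * ∫⁻ s, u s ^ 2 ∂ρ := by
  have h := ENNReal.lintegral_mul_le_Lp_mul_Lq ρ Real.HolderConjugate.two_two
    (f := fun _ => 1) aemeasurable_const hu.aemeasurable
  simp only [Pi.mul_apply, one_mul, ENNReal.rpow_ofNat, one_pow, lintegral_one] at h
  have hsq : ∀ a : ℝ≥0∞, (a ^ (1 / 2 : ℝ)) ^ 2 = a := fun a => by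
    rw [← ENNReal.rpow_ofNat, ← ENNReal.rpow_mul]
    norm_num
  have h2 := pow_le_pow_left' h 2
  rwa [mul_pow, hsq, hsq] at h2

/-- The Schur test for a symmetric kernel. -/
theorem lintegral_kernel_sq_le {k : S → S → ℝ≥0∞} (hk : Measurable (Function.uncurry k))
    (hsymm : ∀ r s, k r s = k s r) (β : Measure S) [IsFiniteMeasure β] {h : S → ℝ≥0∞}
    (hh : Measurable h) (hh0 : ∀ r, h r ≠ 0) (hht : ∀ r, h r ≠ ∞)
    (hle : ∀ r, ∫⁻ s, k r s * h s ∂β ≤ h r) {F : S → ℝ≥0∞} (hF : Measurable F) :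
    ∫⁻ r, (∫⁻ s, k r s * F s ∂β) ^ 2 ∂β ≤ ∫⁻ r, F r ^ 2 ∂β := by
  have hkr : ∀ r, Measurable (k r) := fun r => hk.comp measurable_prodMk_left
  have hu : Measurable fun s => F s / h s := hF.fun_div hh
  -- Cauchy–Schwarz for `F/h` under the measure `k(r, s) h(s) β(ds)`, whose mass is at most `h(r)`.
  -- The supersolution bound is used again after exchanging the integrals, thanks to symmetry.
  have h1 : ∀ r, (∫⁻ s, k r s * F s ∂β) ^ 2 ≤
      ∫⁻ s, h r * (k r s * (h s * (F s / h s) ^ 2)) ∂β := by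
    intro r
    have hd : Measurable fun s => k r s * h s := (hkr r).mul hh
    have := lintegral_sq_le_mul_lintegral_sq (β.withDensity fun s => k r s * h s) hu
    rw [lintegral_withDensity_eq_lintegral_mul _ hd hu,
      lintegral_withDensity_eq_lintegral_mul _ hd (hu.pow_const 2),
      withDensity_apply _ MeasurableSet.univ, Measure.restrict_univ] at this
    have e1 : ∀ s, ((fun s => k r s * h s) * fun s => F s / h s) s = k r s * F s := fun s => by
      rw [Pi.mul_apply, mul_assoc, ENNReal.mul_div_cancel (hh0 s) (hht s)]
    simp only [e1] at this
    refine this.trans ((mul_le_mul_left (hle r) _).trans_eq ?_)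
    rw [lintegral_const_mul' _ _ (hht r)]
    congr 1
    refine lintegral_congr fun s => ?_
    rw [Pi.mul_apply, mul_assoc]
  calc ∫⁻ r, (∫⁻ s, k r s * F s ∂β) ^ 2 ∂β
      ≤ ∫⁻ r, ∫⁻ s, h r * (k r s * (h s * (F s / h s) ^ 2)) ∂β ∂β := lintegral_mono h1
    _ = ∫⁻ s, ∫⁻ r, h r * (k r s * (h s * (F s / h s) ^ 2)) ∂β ∂β := by
        refine lintegral_lintegral_swap (Measurable.aemeasurable ?_)
        exact (hh.comp measurable_fst).mul (hk.mul
          (((hh.mul (hu.pow_const 2))).comp measurable_snd))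
    _ ≤ ∫⁻ s, F s ^ 2 ∂β := by
        refine lintegral_mono fun s => ?_
        have e1 : ∀ r, h r * (k r s * (h s * (F s / h s) ^ 2)) =
            (k s r * h r) * (h s * (F s / h s) ^ 2) := fun r => by
          rw [hsymm r s]; ring
        simp only [e1]
        rw [lintegral_mul_const _ ((hkr s).fun_mul hh)]
        refine (mul_le_mul_left (hle s) _).trans_eq ?_
        have e2 : h s * (h s * (F s / h s) ^ 2) = (h s * (F s / h s)) ^ 2 := by ring
        rw [e2, ENNReal.mul_div_cancel (hh0 s) (hht s)]

/-- For a nonnegative kernel, replacing `f` by `|f|` can only increase the image pointwise, so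
finite nonnegative measurable test functions suffice. -/
theorem opNorm_le_one_of_lintegral_le {κ : S → S → ℝ} (h0 : ∀ r s, 0 ≤ κ r s) {β : Measure S}
    (h : ∀ F : S → ℝ≥0∞, Measurable F → (∀ r, F r ≠ ∞) →
      ∫⁻ r, (∫⁻ s, ENNReal.ofReal (κ r s) * F s ∂β) ^ 2 ∂β ≤ ∫⁻ r, F r ^ 2 ∂β) :
    opNorm κ β ≤ 1 := by
  refine iSup_le fun f => iSup_le fun hf => iSup_le fun hf1 => ?_
  set F := hf.1.mk f
  have hF : StronglyMeasurable F := hf.1.stronglyMeasurable_mk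
  have hfF : f =ᵐ[β] F := hf.1.ae_eq_mk
  have h1 := h (fun r => ‖F r‖ₑ) hF.measurable.enorm fun r => enorm_ne_top
  rw [← eLpNorm_two_sq, ← eLpNorm_congr_ae hfF, hf1] at h1
  rw [← ENNReal.pow_le_pow_left_iff two_ne_zero, eLpNorm_two_sq]
  refine le_trans (lintegral_mono fun r => ?_) h1
  refine pow_le_pow_left' ((enorm_integral_le_lintegral_enorm _).trans_eq ?_) 2
  refine lintegral_congr_ae ?_
  filter_upwards [hfF] with s hs
  rw [enorm_mul, hs, Real.enorm_eq_ofReal (h0 r s)]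

end Densities

/-! ### The characteristic equation, solved by monotone iteration. -/

section Characteristic

variable {S : Type*} [MetricSpace S] [CompactSpace S] [MeasurableSpace S] [BorelSpace S]
  {κ : S → S → ℝ}

/-- The Schur test applies to each `w n · c`, with its own supersolution `h n`; monotone
convergence, in the inner and then the outer integral, carries the bound to `v · c`. The limit of
the `h n` may vanish, so it cannot serve as a test function itself. -/
theorem opNorm_le_one_of_monotone_limit (hκ : ∀ r s, κ r s = κ s r) (h0 : ∀ r s, 0 ≤ κ r s)
    (hc : Continuous (Function.uncurry κ)) {c : Measure S} [IsFiniteMeasure c]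
    {w : ℕ → S → ℝ} {v : S → ℝ} (hw : ∀ n, Measurable (w n)) (hv : Measurable v)
    (hmono : ∀ r, Monotone fun n => w n r) (hlim : ∀ r, Tendsto (fun n => w n r) atTop (𝓝 (v r)))
    (hv0 : ∀ r, 0 < v r) (hw1 : ∀ n r, w n r ≤ 1)
    {h : ℕ → S → ℝ} (hh : ∀ n, Measurable (h n)) (hh0 : ∀ n r, 0 < h n r)
    (hle : ∀ n r, ∫⁻ s, ENNReal.ofReal (κ r s) * ENNReal.ofReal (h n s)
      ∂(c.withDensity fun r => ENNReal.ofReal (w n r)) ≤ ENNReal.ofReal (h n r)) :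
    opNorm κ (c.withDensity fun r => ENNReal.ofReal (v r)) ≤ 1 := by
  refine opNorm_le_one_of_lintegral_le h0 fun F hF hFt => ?_
  have hk : Measurable (Function.uncurry fun r s => ENNReal.ofReal (κ r s)) :=
    hc.measurable.ennreal_ofReal
  have hkr : ∀ r, Measurable fun s => ENNReal.ofReal (κ r s) :=
    fun r => (continuous_kernel_right hc r).measurable.ennreal_ofReal
  have hwm : ∀ r, Monotone fun n => ENNReal.ofReal (w n r) :=
    fun r n m hnm => ENNReal.ofReal_le_ofReal (hmono r hnm)
  have hwv : ∀ n r, ENNReal.ofReal (w n r) ≤ ENNReal.ofReal (v r) :=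
    fun n r => ENNReal.ofReal_le_ofReal ((hmono r).ge_of_tendsto (hlim r) n)
  have hlim' : ∀ r, Tendsto (fun n => ENNReal.ofReal (w n r)) atTop (𝓝 (ENNReal.ofReal (v r))) :=
    fun r => ENNReal.tendsto_ofReal (hlim r)
  -- Positivity of the limit keeps multiplication in `[0, ∞]` continuous where the other factor is
  -- infinite.
  have hpos : ∀ r, ENNReal.ofReal (v r) ≠ 0 := fun r => by simpa using hv0 r
  have hinner : ∀ {u : S → ℝ}, Measurable u → ∀ r,
      ∫⁻ s, ENNReal.ofReal (κ r s) * F s ∂(c.withDensity fun r => ENNReal.ofReal (u r)) =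
        ∫⁻ s, ENNReal.ofReal (u s) * (ENNReal.ofReal (κ r s) * F s) ∂c := fun hu r =>
    lintegral_withDensity_eq_lintegral_mul c hu.ennreal_ofReal ((hkr r).mul hF)
  have hmeas : ∀ {u : S → ℝ}, Measurable u → Measurable fun r =>
      ∫⁻ s, ENNReal.ofReal (u s) * (ENNReal.ofReal (κ r s) * F s) ∂c := fun hu =>
    Measurable.lintegral_prod_right
      ((hu.ennreal_ofReal.comp measurable_snd).mul (hk.mul (hF.comp measurable_snd)))
  have houter : ∀ {u : S → ℝ}, Measurable u →
      ∫⁻ r, (∫⁻ s, ENNReal.ofReal (κ r s) * F s ∂(c.withDensity fun r => ENNReal.ofReal (u r))) ^ 2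
        ∂(c.withDensity fun r => ENNReal.ofReal (u r)) =
        ∫⁻ r, ENNReal.ofReal (u r) *
          (∫⁻ s, ENNReal.ofReal (u s) * (ENNReal.ofReal (κ r s) * F s) ∂c) ^ 2 ∂c := fun hu => by
    simp only [hinner hu]
    exact lintegral_withDensity_eq_lintegral_mul c hu.ennreal_ofReal ((hmeas hu).pow_const 2)
  have hin_mono : ∀ r, Monotone fun n =>
      ∫⁻ s, ENNReal.ofReal (w n s) * (ENNReal.ofReal (κ r s) * F s) ∂c := fun r n m hnm =>
    lintegral_mono fun s => mul_le_mul_left (hwm s hnm) _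
  have hin_lim : ∀ r, Tendsto (fun n =>
      ∫⁻ s, ENNReal.ofReal (w n s) * (ENNReal.ofReal (κ r s) * F s) ∂c) atTop
      (𝓝 (∫⁻ s, ENNReal.ofReal (v s) * (ENNReal.ofReal (κ r s) * F s) ∂c)) := fun r =>
    lintegral_tendsto_of_tendsto_of_monotone
      (fun n => ((hw n).ennreal_ofReal.mul ((hkr r).mul hF)).aemeasurable)
      (Eventually.of_forall fun s n m hnm => mul_le_mul_left (hwm s hnm) _)
      (Eventually.of_forall fun s => ENNReal.Tendsto.mul_const (hlim' s) (Or.inl (hpos s)))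
  rw [houter hv]
  refine le_of_tendsto' (lintegral_tendsto_of_tendsto_of_monotone (fun n =>
      ((hw n).ennreal_ofReal.mul ((hmeas (hw n)).pow_const 2)).aemeasurable)
    (Eventually.of_forall fun r n m hnm =>
      mul_le_mul' (hwm r hnm) (pow_le_pow_left' (hin_mono r hnm) 2))
    (Eventually.of_forall fun r => ENNReal.Tendsto.mul (hlim' r) (Or.inl (hpos r))
      ((ENNReal.continuous_pow 2).tendsto _ |>.comp (hin_lim r))
      (Or.inr ENNReal.ofReal_ne_top))) fun n => ?_
  have hfin : IsFiniteMeasure (c.withDensity fun r => ENNReal.ofReal (w n r)) := by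
    refine isFiniteMeasure_withDensity (ne_top_of_le_ne_top (measure_ne_top c Set.univ) ?_)
    rw [← lintegral_one]
    exact lintegral_mono fun r => ENNReal.ofReal_le_one.2 (hw1 n r)
  have := lintegral_kernel_sq_le hk (fun r s => by rw [hκ r s])
    (c.withDensity fun r => ENNReal.ofReal (w n r)) (hh n).ennreal_ofReal
    (fun r => by simpa using hh0 n r) (fun r => ENNReal.ofReal_ne_top) (hle n) hF
  rw [houter (hw n)] at this
  refine this.trans ?_
  refine lintegral_mono' (withDensity_mono (Eventually.of_forall fun r => hwv n r)) le_rfl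

end Characteristic

section Characteristic

variable {S : Type*} [MetricSpace S] [CompactSpace S] [MeasurableSpace S] [BorelSpace S]
  {κ : S → S → ℝ}

theorem div_one_add_mono {x y : ℝ} (hx : 0 ≤ x) (hxy : x ≤ y) : x / (1 + x) ≤ y / (1 + y) := by
  rw [div_le_div_iff₀ (by linarith) (by linarith)]
  nlinarith

theorem div_one_add_nonneg {x : ℝ} (hx : 0 ≤ x) : 0 ≤ x / (1 + x) := by positivity

theorem div_one_add_le_one {x : ℝ} (hx : 0 ≤ x) : x / (1 + x) ≤ 1 := by
  rw [div_le_one (by linarith)]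
  linarith

/-- The monotone map `g ↦ κ (g / (1 + g) c)`, whose fixed points correspond to the solutions of
the characteristic equation. -/
noncomputable def charMap {S : Type*} [MeasurableSpace S] (κ : S → S → ℝ) (c : Measure S)
    (g : S → ℝ) (r : S) : ℝ :=
  ∫ s, κ r s * (g s / (1 + g s)) ∂c

/-- Iterates of the characteristic map from above, shifted by a positive null sequence. -/
noncomputable def charIter {S : Type*} [MeasurableSpace S] (κ : S → S → ℝ) (c : Measure S)
    (K : ℝ) : ℕ → S → ℝ
  | 0 => fun _ => K + 1
  | n + 1 => fun r => 1 / ((n : ℝ) + 2) + charMap κ c (charIter κ c K n) r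

/-- The measure `c / (1 + g)`. -/
noncomputable def charMeasure {S : Type*} [MeasurableSpace S] (c : Measure S) (g : S → ℝ) :
    Measure S :=
  c.withDensity fun r => ENNReal.ofReal (1 / (1 + g r))

variable {c : Measure S} [IsFiniteMeasure c] {g g' : S → ℝ}

theorem integrable_div_one_add (hg : Measurable g) (hg0 : ∀ r, 0 ≤ g r) :
    Integrable (fun s => g s / (1 + g s)) c :=
  Integrable.of_bound (hg.div (hg.const_add 1)).aestronglyMeasurable 1
    (Eventually.of_forall fun s => by
      rw [Real.norm_eq_abs, abs_of_nonneg (div_one_add_nonneg (hg0 s))]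
      exact div_one_add_le_one (hg0 s))

theorem continuous_charMap (hc : Continuous (Function.uncurry κ)) (hg : Measurable g)
    (hg0 : ∀ r, 0 ≤ g r) : Continuous (charMap κ c g) :=
  continuous_integral_kernel_mul hc (integrable_div_one_add hg hg0)

theorem charMap_nonneg (h0 : ∀ r s, 0 ≤ κ r s) (hg0 : ∀ r, 0 ≤ g r) (r : S) :
    0 ≤ charMap κ c g r :=
  integral_nonneg fun s => mul_nonneg (h0 r s) (div_one_add_nonneg (hg0 s))

theorem charMap_mono (hc : Continuous (Function.uncurry κ)) (h0 : ∀ r s, 0 ≤ κ r s)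
    (hg : Measurable g) (hg0 : ∀ r, 0 ≤ g r) (hg' : Measurable g') (hle : ∀ r, g r ≤ g' r) (r : S) :
    charMap κ c g r ≤ charMap κ c g' r :=
  integral_mono (integrable_kernel_mul hc (integrable_div_one_add hg hg0) r)
    (integrable_kernel_mul hc
      (integrable_div_one_add hg' fun s => (hg0 s).trans (hle s)) r) fun s =>
    mul_le_mul_of_nonneg_left (div_one_add_mono (hg0 s) (hle s)) (h0 r s)

theorem charMap_le (hc : Continuous (Function.uncurry κ)) (h0 : ∀ r s, 0 ≤ κ r s)
    (hg : Measurable g) (hg0 : ∀ r, 0 ≤ g r) (r : S) : charMap κ c g r ≤ kernelInt κ c r :=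
  integral_mono (integrable_kernel_mul hc (integrable_div_one_add hg hg0) r)
    (integrable_kernel hc c r) fun s =>
    mul_le_of_le_one_right (h0 r s) (div_one_add_le_one (hg0 s))

section Iter

variable {K : ℝ}

theorem charIter_pos_measurable (hc : Continuous (Function.uncurry κ)) (h0 : ∀ r s, 0 ≤ κ r s)
    (hK0 : 0 ≤ K) (n : ℕ) : (∀ r, 0 < charIter κ c K n r) ∧ Measurable (charIter κ c K n) := by
  induction n with
  | zero => exact ⟨fun r => by simp only [charIter]; linarith, measurable_const⟩
  | succ n ih =>
    have hn : ∀ r, 0 ≤ charIter κ c K n r := fun r => (ih.1 r).le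
    exact ⟨fun r => add_pos_of_pos_of_nonneg (by positivity) (charMap_nonneg h0 hn r),
      (continuous_charMap hc ih.2 hn).measurable.const_add _⟩

/-- The start `K + 1` dominates its successor, which is at most `1/2 + K`; afterwards the map is
monotone and the shifts decrease. As a shift is positive, each iterate is a strictly positive
supersolution, which is what the Schur test needs. -/
theorem charIter_succ_le (hc : Continuous (Function.uncurry κ)) (h0 : ∀ r s, 0 ≤ κ r s)
    (hK0 : 0 ≤ K) (hK : ∀ r, kernelInt κ c r ≤ K) (n : ℕ) :
    ∀ r, charIter κ c K (n + 1) r ≤ charIter κ c K n r := by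
  induction n with
  | zero =>
    intro r
    have h := charIter_pos_measurable (c := c) hc h0 hK0 0
    have := charMap_le (c := c) hc h0 h.2 (fun r => (h.1 r).le) r
    have := hK r
    simp only [charIter] at *
    norm_num
    linarith
  | succ n ih =>
    intro r
    have h := charIter_pos_measurable (c := c) hc h0 hK0 n
    have h' := charIter_pos_measurable (c := c) hc h0 hK0 (n + 1)
    have := charMap_mono (c := c) hc h0 h'.2 (fun r => (h'.1 r).le) h.2 ih r
    have e : 1 / (((n + 1 : ℕ) : ℝ) + 2) ≤ 1 / ((n : ℝ) + 2) :=
      one_div_le_one_div_of_le (by positivity) (by push_cast; linarith)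
    exact add_le_add e this

theorem antitone_charIter (hc : Continuous (Function.uncurry κ)) (h0 : ∀ r s, 0 ≤ κ r s)
    (hK0 : 0 ≤ K) (hK : ∀ r, kernelInt κ c r ≤ K) (r : S) :
    Antitone fun n => charIter κ c K n r :=
  antitone_nat_of_succ_le fun n => charIter_succ_le hc h0 hK0 hK n r

/-- Every bounded fixed point lies below all iterates. -/
theorem le_charIter (hc : Continuous (Function.uncurry κ)) (h0 : ∀ r s, 0 ≤ κ r s)
    (hK0 : 0 ≤ K) (hK : ∀ r, kernelInt κ c r ≤ K) (hg : Measurable g) (hg0 : ∀ r, 0 ≤ g r)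
    (hfix : ∀ r, g r = charMap κ c g r) (n : ℕ) : ∀ r, g r ≤ charIter κ c K n r := by
  induction n with
  | zero =>
    intro r
    have := charMap_le (c := c) hc h0 hg hg0 r
    have := hK r
    have := hfix r
    simp only [charIter]
    linarith
  | succ n ih =>
    intro r
    have h := charIter_pos_measurable (c := c) hc h0 hK0 n
    have h1 := charMap_mono (c := c) hc h0 hg hg0 h.2 ih r
    have h2 : (0 : ℝ) ≤ 1 / ((n : ℝ) + 2) := by positivity
    rw [hfix r]
    simp only [charIter]
    linarith

/-- The maximal fixed point of the characteristic map. -/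
noncomputable def charLimit {S : Type*} [MeasurableSpace S] (κ : S → S → ℝ) (c : Measure S)
    (K : ℝ) (r : S) : ℝ :=
  ⨅ n, charIter κ c K n r

theorem bddBelow_charIter (hc : Continuous (Function.uncurry κ)) (h0 : ∀ r s, 0 ≤ κ r s)
    (hK0 : 0 ≤ K) (r : S) : BddBelow (Set.range fun n => charIter κ c K n r) :=
  ⟨0, by rintro _ ⟨n, rfl⟩; exact ((charIter_pos_measurable hc h0 hK0 n).1 r).le⟩

theorem tendsto_charIter (hc : Continuous (Function.uncurry κ)) (h0 : ∀ r s, 0 ≤ κ r s)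
    (hK0 : 0 ≤ K) (hK : ∀ r, kernelInt κ c r ≤ K) (r : S) :
    Tendsto (fun n => charIter κ c K n r) atTop (𝓝 (charLimit κ c K r)) :=
  tendsto_atTop_ciInf (antitone_charIter hc h0 hK0 hK r) (bddBelow_charIter hc h0 hK0 r)

theorem measurable_charLimit (hc : Continuous (Function.uncurry κ)) (h0 : ∀ r s, 0 ≤ κ r s)
    (hK0 : 0 ≤ K) : Measurable (charLimit κ c K) :=
  Measurable.iInf fun n => (charIter_pos_measurable hc h0 hK0 n).2

theorem charLimit_nonneg (hc : Continuous (Function.uncurry κ)) (h0 : ∀ r s, 0 ≤ κ r s)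
    (hK0 : 0 ≤ K) (r : S) : 0 ≤ charLimit κ c K r :=
  le_ciInf fun n => ((charIter_pos_measurable hc h0 hK0 n).1 r).le

/-- The shifts tend to zero, and the map passes to the limit by dominated convergence, since `g/(1 +
g) ≤ 1` and the kernel is bounded. -/
theorem charLimit_eq_charMap (hc : Continuous (Function.uncurry κ)) (h0 : ∀ r s, 0 ≤ κ r s)
    (hK0 : 0 ≤ K) (hK : ∀ r, kernelInt κ c r ≤ K) (r : S) :
    charLimit κ c K r = charMap κ c (charLimit κ c K) r := by
  obtain ⟨M, -, hM⟩ := exists_kernel_bound hc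
  have h1 := (tendsto_charIter (c := c) hc h0 hK0 hK r).comp (tendsto_add_atTop_nat 1)
  refine tendsto_nhds_unique h1 ?_
  have h2 : Tendsto (fun n : ℕ => 1 / ((n : ℝ) + 2)) atTop (𝓝 0) := by
    have := (tendsto_one_div_add_atTop_nhds_zero_nat (𝕜 := ℝ)).comp (tendsto_add_atTop_nat 1)
    refine this.congr fun n => ?_
    simp only [Function.comp_apply]
    push_cast
    ring
  have h3 : Tendsto (fun n => charMap κ c (charIter κ c K n) r) atTop
      (𝓝 (charMap κ c (charLimit κ c K) r)) := by
    refine tendsto_integral_of_dominated_convergence (fun s => M) (fun n => ?_)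
      (integrable_const M) (fun n => ?_) (Eventually.of_forall fun s => ?_)
    · have h := charIter_pos_measurable (c := c) hc h0 hK0 n
      exact (integrable_kernel_mul hc
        (integrable_div_one_add h.2 fun r => (h.1 r).le) r).1
    · refine Eventually.of_forall fun s => ?_
      have h := (charIter_pos_measurable (c := c) hc h0 hK0 n).1 s
      rw [norm_mul, Real.norm_eq_abs, Real.norm_eq_abs, abs_of_nonneg (div_one_add_nonneg h.le)]
      exact (mul_le_of_le_one_right (abs_nonneg _) (div_one_add_le_one h.le)).trans (hM r s)
    · have h := tendsto_charIter (c := c) hc h0 hK0 hK s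
      exact (h.div (h.const_add 1)
        (by have := charLimit_nonneg (c := c) hc h0 hK0 s; positivity)).const_mul _
  have := h2.add h3
  rw [zero_add] at this
  exact this

end Iter

theorem charMeasure_add (hg : Measurable g) (hg0 : ∀ r, 0 ≤ g r) (c : Measure S) :
    charMeasure c g + c.withDensity (fun r => ENNReal.ofReal (g r / (1 + g r))) = c := by
  rw [charMeasure, ← withDensity_add_left (by fun_prop)]
  conv_rhs => rw [← withDensity_one (μ := c)]
  refine congrArg _ (funext fun r => ?_)
  have := hg0 r
  rw [Pi.add_apply, ← ENNReal.ofReal_add (by positivity) (by positivity), ← add_div,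
    div_self (by positivity), ENNReal.ofReal_one, Pi.one_apply]

end Characteristic

section Characteristic

variable {S : Type*} [MetricSpace S] [CompactSpace S] [MeasurableSpace S] [BorelSpace S]
  {κ : S → S → ℝ} {c : Measure S} [IsFiniteMeasure c] {g : S → ℝ}

theorem charMeasure_le (hg : Measurable g) (hg0 : ∀ r, 0 ≤ g r) (c : Measure S) :
    charMeasure c g ≤ c := by
  conv_rhs => rw [← charMeasure_add hg hg0 c]
  exact Measure.le_add_right le_rfl

theorem sub_charMeasure (hg : Measurable g) (hg0 : ∀ r, 0 ≤ g r) (c : Measure S)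
    [IsFiniteMeasure c] :
    c - charMeasure c g = c.withDensity fun r => ENNReal.ofReal (g r / (1 + g r)) := by
  have : IsFiniteMeasure (charMeasure c g) := isFiniteMeasure_of_le c (charMeasure_le hg hg0 c)
  have h := Measure.add_sub_cancel (ν := charMeasure c g)
    (μ := c.withDensity fun r => ENNReal.ofReal (g r / (1 + g r)))
  rwa [add_comm, charMeasure_add hg hg0] at h

theorem kernelInt_sub_charMeasure (hg : Measurable g) (hg0 : ∀ r, 0 ≤ g r) (r : S) :
    kernelInt κ (c - charMeasure c g) r = charMap κ c g r := by
  rw [sub_charMeasure hg hg0, kernelInt, integral_withDensity_ofReal c (by fun_prop)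
    fun s => div_one_add_nonneg (hg0 s)]
  exact integral_congr_ae (Eventually.of_forall fun s => mul_comm _ _)

theorem charMeasure_mem (hg : Measurable g) (hg0 : ∀ r, 0 ≤ g r)
    (hfix : ∀ r, g r = charMap κ c g r) : charMeasure c g ∈ characteristicSolutions κ c := by
  refine ⟨charMeasure_le hg hg0 c, ?_⟩
  simp only [kernelInt_sub_charMeasure hg hg0, ← hfix]
  rw [sub_charMeasure hg hg0, charMeasure, withDensity_ofReal_mul c (by fun_prop)
    (fun r => by have := hg0 r; positivity) hg]
  refine congrArg _ (funext fun r => ?_)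
  rw [one_div_mul_eq_div]

/-- With `g = κ(c - b)` the equation is `c - b = g b`, that is `c = (1 + g) b`, and `1 + g` is
invertible. Together with `charMeasure_mem` this turns solutions into fixed points, with equality at
every point and not just almost everywhere. -/
theorem eq_charMeasure_of_mem (hc : Continuous (Function.uncurry κ)) (h0 : ∀ r s, 0 ≤ κ r s)
    {b : Measure S} (hb : b ∈ characteristicSolutions κ c) :
    b = charMeasure c (kernelInt κ (c - b)) ∧
      ∀ r, kernelInt κ (c - b) r = charMap κ c (kernelInt κ (c - b)) r := by
  obtain ⟨hbc, hsol⟩ := hb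
  have : IsFiniteMeasure b := isFiniteMeasure_of_le c hbc
  have : IsFiniteMeasure (c - b) := isFiniteMeasure_of_le c Measure.sub_le
  set g := kernelInt κ (c - b) with hgdef
  have hg : Measurable g := (continuous_kernelInt hc _).measurable
  have hg0 : ∀ r, 0 ≤ g r := kernelInt_nonneg h0 _
  have hadd : c = b.withDensity fun r => ENNReal.ofReal (1 + g r) := by
    have h1 : b.withDensity (fun r => ENNReal.ofReal (1 + g r)) =
        b + b.withDensity fun r => ENNReal.ofReal (g r) := by
      have h2 := withDensity_add_left (μ := b) measurable_one fun r => ENNReal.ofReal (g r)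
      rw [withDensity_one] at h2
      rw [← h2]
      refine congrArg _ (funext fun r => ?_)
      rw [Pi.add_apply, ENNReal.ofReal_add zero_le_one (hg0 r), ENNReal.ofReal_one, Pi.one_apply]
    rw [h1, hsol, add_comm, Measure.sub_add_cancel_of_le hbc]
  have hbeq : b = charMeasure c g := by
    rw [charMeasure]
    conv_rhs => rw [hadd, withDensity_ofReal_mul b (by fun_prop)
      (fun r => by have := hg0 r; positivity) (by fun_prop)]
    conv_lhs => rw [← withDensity_one (μ := b)]
    refine congrArg _ (funext fun r => ?_)
    have := hg0 r
    rw [mul_one_div_cancel (by positivity), ENNReal.ofReal_one, Pi.one_apply]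
  refine ⟨hbeq, fun r => ?_⟩
  conv_lhs => rw [hgdef, hbeq, kernelInt_sub_charMeasure hg hg0]

/-- The iterates `h n` are positive supersolutions for the kernel under `c/(1 + h n)`, and these
measures increase to `c/(1 + g)`. -/
theorem opNorm_charMeasure_le_one (hκ : ∀ r s, κ r s = κ s r) (h0 : ∀ r s, 0 ≤ κ r s)
    (hc : Continuous (Function.uncurry κ)) {K : ℝ} (hK0 : 0 ≤ K) (hK : ∀ r, kernelInt κ c r ≤ K) :
    opNorm κ (charMeasure c (charLimit κ c K)) ≤ 1 := by
  have hI := charIter_pos_measurable (c := c) hc h0 hK0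
  have hL0 := charLimit_nonneg (c := c) hc h0 hK0
  refine opNorm_le_one_of_monotone_limit (w := fun n r => 1 / (1 + charIter κ c K n r)) hκ h0 hc
    (fun n => by have := (hI n).2; fun_prop)
    (by have := measurable_charLimit (c := c) hc h0 hK0; fun_prop) (fun r n m hnm => ?_)
    (fun r => ?_) (fun r => by have := hL0 r; positivity)
    (fun n r => by
      have := (hI n).1 r
      rw [div_le_one (by linarith)]
      linarith) (h := charIter κ c K) (fun n => (hI n).2)
    (fun n r => (hI n).1 r) fun n r => ?_
  · have := antitone_charIter (c := c) hc h0 hK0 hK r hnm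
    have := (hI m).1 r
    exact one_div_le_one_div_of_le (by linarith) (by simp only at *; linarith)
  · exact tendsto_const_nhds.div ((tendsto_charIter (c := c) hc h0 hK0 hK r).const_add 1)
      (by have := hL0 r; positivity)
  · have hm := (hI n).2
    rw [lintegral_withDensity_eq_lintegral_mul c (by fun_prop)
      ((continuous_kernel_right hc r).measurable.ennreal_ofReal.fun_mul hm.ennreal_ofReal)]
    have e : ∀ s, ((fun r => ENNReal.ofReal (1 / (1 + charIter κ c K n r))) *
        fun s => ENNReal.ofReal (κ r s) * ENNReal.ofReal (charIter κ c K n s)) s =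
        ENNReal.ofReal (κ r s) * ENNReal.ofReal (charIter κ c K n s / (1 + charIter κ c K n s)) := by
      intro s
      have := (hI n).1 s
      rw [Pi.mul_apply, mul_left_comm, ← ENNReal.ofReal_mul (by positivity), one_div_mul_eq_div]
    simp only [e]
    rw [← ofReal_integral_kernel_mul hc h0
      (integrable_div_one_add hm fun r => ((hI n).1 r).le)
      fun s => div_one_add_nonneg ((hI n).1 s).le]
    refine ENNReal.ofReal_le_ofReal (le_trans ?_ (charIter_succ_le (c := c) hc h0 hK0 hK n r))
    exact le_add_of_nonneg_left (by positivity)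

/-- The fixed point equation says that `g` is an eigenfunction with eigenvalue one on `L²` of `c/(1
+ g)`. A norm below one would force `g = 0` almost everywhere, hence `c - b = g b = 0`. -/
theorem one_le_opNorm_charMeasure (h0 : ∀ r s, 0 ≤ κ r s)
    (hc : Continuous (Function.uncurry κ)) (hg : Measurable g) (hg0 : ∀ r, 0 ≤ g r)
    (hfix : ∀ r, g r = charMap κ c g r) (hne : charMeasure c g ≠ c) :
    1 ≤ opNorm κ (charMeasure c g) := by
  have hfin : IsFiniteMeasure (charMeasure c g) := isFiniteMeasure_of_le c (charMeasure_le hg hg0 c)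
  obtain ⟨M, -, hM⟩ := exists_kernel_bound hc
  have hmem : MemLp g 2 (charMeasure c g) :=
    MemLp.of_bound hg.aestronglyMeasurable (M * c.real Set.univ) (Eventually.of_forall fun r => by
      rw [Real.norm_eq_abs, abs_of_nonneg (hg0 r), hfix r]
      exact (charMap_le hc h0 hg hg0 r).trans (kernelInt_le hM c r))
  have heig : (fun r => ∫ s, κ r s * g s ∂(charMeasure c g)) = g := by
    ext r
    rw [charMeasure, integral_withDensity_ofReal c (by fun_prop)
      (fun r => by have := hg0 r; positivity), hfix r, charMap]
    refine integral_congr_ae (Eventually.of_forall fun s => ?_)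
    simp only
    rw [mul_left_comm, one_div_mul_eq_div]
  have h := eLpNorm_kernel_le κ (charMeasure c g) hmem
  rw [heig] at h
  by_contra hlt
  rw [not_le] at hlt
  have hz : eLpNorm g 2 (charMeasure c g) = 0 := by
    by_contra hnz
    have := ENNReal.mul_lt_mul_left hnz hmem.2.ne hlt
    rw [one_mul] at this
    exact absurd h (not_le.2 this)
  rw [eLpNorm_eq_zero_iff hmem.1 two_ne_zero] at hz
  have h1 := (charMeasure_mem hg hg0 hfix).2
  simp only [kernelInt_sub_charMeasure hg hg0, ← hfix] at h1
  have h2 : c - charMeasure c g = 0 := by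
    rw [← h1, withDensity_eq_zero_iff (by fun_prop)]
    filter_upwards [hz] with r hr
    simp [hr]
  refine hne ?_
  have h3 := Measure.sub_add_cancel_of_le (charMeasure_le hg hg0 c)
  rwa [h2, zero_add] at h3

/-- Above criticality, the smallest nontrivial solution of the characteristic equation is
critical. -/
theorem exists_isLeast_characteristicSolutions (hκ : ∀ r s, κ r s = κ s r)
    (h0 : ∀ r s, 0 ≤ κ r s) (hc : Continuous (Function.uncurry κ)) (hcrit : 1 < opNorm κ c) :
    ∃ g : S → ℝ, Continuous g ∧ (∀ r, 0 ≤ g r) ∧ (∀ r, kernelInt κ (c - charMeasure c g) r = g r) ∧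
      IsLeast {b | b ∈ characteristicSolutions κ c ∧ b ≠ c} (charMeasure c g) ∧
      opNorm κ (charMeasure c g) = 1 := by
  obtain ⟨M, hM0, hM⟩ := exists_kernel_bound hc
  set K := M * c.real Set.univ with hKdef
  have hK0 : 0 ≤ K := by positivity
  have hK : ∀ r, kernelInt κ c r ≤ K := kernelInt_le hM c
  have hg := measurable_charLimit (c := c) hc h0 hK0
  have hg0 := charLimit_nonneg (c := c) hc h0 hK0
  have hfix := charLimit_eq_charMap (c := c) hc h0 hK0 hK
  have hle := opNorm_charMeasure_le_one hκ h0 hc hK0 hK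
  -- Supercriticality enters only here: the limit measure has norm at most one and `c` does not.
  have hne : charMeasure c (charLimit κ c K) ≠ c := fun h => by
    rw [h] at hle
    exact absurd hcrit (not_lt.2 hle)
  refine ⟨charLimit κ c K, ?_, hg0, fun r => ?_, ⟨⟨charMeasure_mem hg hg0 hfix, hne⟩, ?_⟩,
    le_antisymm hle (one_le_opNorm_charMeasure h0 hc hg hg0 hfix hne)⟩
  · rw [funext hfix]
    exact continuous_charMap hc hg hg0
  · rw [kernelInt_sub_charMeasure hg hg0, ← hfix]
  · rintro b ⟨hb, -⟩
    obtain ⟨h1, h2⟩ := eq_charMeasure_of_mem hc h0 hb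
    have : IsFiniteMeasure (c - b) := isFiniteMeasure_of_le c Measure.sub_le
    rw [h1]
    refine withDensity_mono (Eventually.of_forall fun r => ?_)
    have h3 := kernelInt_nonneg h0 (c - b) r
    refine ENNReal.ofReal_le_ofReal (one_div_le_one_div_of_le (by linarith) ?_)
    -- Any other solution comes from a fixed point below every iterate, and a smaller `g` means a
    -- larger `c/(1 + g)`.
    have : kernelInt κ (c - b) r ≤ charLimit κ c K r := le_ciInf fun n =>
      le_charIter hc h0 hK0 hK (continuous_kernelInt hc _).measurable
        (kernelInt_nonneg h0 _) h2 n r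
    linarith

end Characteristic

/-! ### Evaluating the constants and the mesoscopic rate. -/

section Rates

variable {S : Type*} [MetricSpace S] [CompactSpace S] [MeasurableSpace S] [BorelSpace S]
  {κ : S → S → ℝ} {μ b c : Measure S} [IsProbabilityMeasure μ]

/-- Under `μ` the integrand becomes `p log p` with `p = dc/dμ ∈ [0, 1]`, which is bounded. -/
theorem integrable_log_rnDeriv (hc : c ≤ μ) :
    Integrable (fun r => Real.log (c.rnDeriv μ r).toReal) c := by
  have : IsFiniteMeasure c := isFiniteMeasure_of_le μ hc
  rw [← integrable_rnDeriv_smul_iff (Measure.absolutelyContinuous_of_le hc)]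
  have hm : Measurable fun r => (c.rnDeriv μ r).toReal :=
    (Measure.measurable_rnDeriv c μ).ennreal_toReal
  refine Integrable.of_bound (hm.smul hm.log).aestronglyMeasurable 1 ?_
  filter_upwards [Measure.rnDeriv_le_one_of_le hc] with r hr
  have hle : (c.rnDeriv μ r).toReal ≤ 1 :=
    ENNReal.toReal_le_of_le_ofReal zero_le_one (by simpa using hr)
  rcases (ENNReal.toReal_nonneg (a := c.rnDeriv μ r)).eq_or_lt with h | h
  · rw [← h]
    simp
  · rw [smul_eq_mul, mul_comm]
    exact (Real.abs_log_mul_self_lt _ h hle).le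

/-- The logarithm of the density differs from `log (dc/dμ)` by `log (1 + g)`, which is continuous on
a compact space. -/
theorem integrable_log_rnDeriv_charMeasure {g : S → ℝ} (hg : Continuous g) (hg0 : ∀ r, 0 ≤ g r)
    (hc : c ≤ μ) :
    Integrable (fun r => Real.log ((charMeasure c g).rnDeriv μ r).toReal) c := by
  have : IsFiniteMeasure c := isFiniteMeasure_of_le μ hc
  have hcμ := Measure.absolutelyContinuous_of_le hc
  have hbc : charMeasure c g ≪ c := withDensity_absolutelyContinuous _ _
  have hgm := hg.measurable
  have : IsFiniteMeasure (charMeasure c g) :=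
    isFiniteMeasure_of_le c (charMeasure_le hgm hg0 c)
  have h1 : ∀ᵐ r ∂c, (charMeasure c g).rnDeriv c r * c.rnDeriv μ r =
      (charMeasure c g).rnDeriv μ r := hcμ.ae_le (Measure.rnDeriv_mul_rnDeriv hbc)
  have h2 : ∀ᵐ r ∂c, (charMeasure c g).rnDeriv c r = ENNReal.ofReal (1 / (1 + g r)) :=
    Measure.rnDeriv_withDensity c (by fun_prop)
  have hcont : Continuous fun r => Real.log (1 + g r) :=
    (hg.const_add 1).log fun r => (by linarith [hg0 r] : 0 < 1 + g r).ne'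
  have h3 : Integrable (fun r => Real.log (1 + g r)) c :=
    hcont.integrable_of_hasCompactSupport (HasCompactSupport.of_compactSpace _)
  refine ((integrable_log_rnDeriv hc).sub h3).congr ?_
  filter_upwards [h1, h2, Measure.rnDeriv_pos hcμ, hcμ.ae_le (Measure.rnDeriv_lt_top c μ)]
    with r h1 h2 h4 h5
  have := hg0 r
  rw [← h1, h2, ENNReal.toReal_mul, ENNReal.toReal_ofReal (by positivity),
    Real.log_mul (by positivity) (ENNReal.toReal_pos h4.ne' h5.ne).ne', one_div, Real.log_inv,
    Pi.sub_apply]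
  ring

theorem rateConst_le_constrainedInf (hκ : ∀ r s, κ r s = κ s r) (h0 : ∀ r s, 0 ≤ κ r s)
    (hc : Continuous (Function.uncurry κ)) [IsFiniteMeasure b] [IsFiniteMeasure c]
    [IsFiniteMeasure (minimizer κ b)] (hb : b ≤ μ) (hcb : c ≪ b)
    (hlog : Integrable (fun r => Real.log (b.rnDeriv μ r).toReal) c) :
    (rateConst κ μ b c : EReal) ≤ constrainedInf κ μ c := by
  refine le_sInf ?_
  rintro _ ⟨l, ⟨⟨hfin, -, -⟩, hlc⟩, rfl⟩
  rw [rateMi_eq hκ h0 hc hb hcb hlog hlc]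
  exact le_add_of_nonneg_left (EReal.coe_ennreal_nonneg _)

theorem minimizer_mem_stateSpace (hκ : ∀ r s, κ r s = κ s r) (h0 : ∀ r s, 0 ≤ κ r s)
    (hc : Continuous (Function.uncurry κ)) (hb : b ≤ μ) (hcrit : opNorm κ b ≤ 1) :
    minimizer κ b ∈ stateSpace μ := by
  have : IsFiniteMeasure b := isFiniteMeasure_of_le μ hb
  refine ⟨(minimizer_mass hκ h0 hc b hcrit).1, minimizer_zero hκ h0 hc b, ?_⟩
  rwa [integratedConfig_minimizer_eq hκ h0 hc b hcrit]

theorem rateMi_minimizer (hκ : ∀ r s, κ r s = κ s r) (h0 : ∀ r s, 0 ≤ κ r s)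
    (hc : Continuous (Function.uncurry κ)) (hb : b ≤ μ) (hcrit : opNorm κ b ≤ 1) :
    rateMi κ μ (minimizer κ b) = (rateConst κ μ b b : EReal) := by
  have : IsFiniteMeasure b := isFiniteMeasure_of_le μ hb
  have := (minimizer_mass hκ h0 hc b hcrit).1
  rw [rateMi_eq hκ h0 hc hb Measure.AbsolutelyContinuous.rfl (integrable_log_rnDeriv hb)
    (integratedConfig_minimizer_eq hκ h0 hc b hcrit), klDiv_self]
  simp

theorem constrainedInf_eq (hκ : ∀ r s, κ r s = κ s r) (h0 : ∀ r s, 0 ≤ κ r s)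
    (hc : Continuous (Function.uncurry κ)) (hb : b ≤ μ) (hcrit : opNorm κ b ≤ 1) :
    constrainedInf κ μ b = (rateConst κ μ b b : EReal) := by
  have : IsFiniteMeasure b := isFiniteMeasure_of_le μ hb
  have := (minimizer_mass hκ h0 hc b hcrit).1
  refine le_antisymm ?_ (rateConst_le_constrainedInf hκ h0 hc hb Measure.AbsolutelyContinuous.rfl
    (integrable_log_rnDeriv hb))
  rw [← rateMi_minimizer hκ h0 hc hb hcrit]
  exact sInf_le ⟨_, ⟨minimizer_mem_stateSpace hκ h0 hc hb hcrit,
    integratedConfig_minimizer_eq hκ h0 hc b hcrit⟩, rfl⟩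

/-- The minimal value is a real number, so equality forces the divergence to be zero and not merely
to be absorbed by `⊤`. -/
theorem eq_minimizer_of_rateMi_eq (hκ : ∀ r s, κ r s = κ s r) (h0 : ∀ r s, 0 ≤ κ r s)
    (hc : Continuous (Function.uncurry κ)) (hb : b ≤ μ) (hcrit : opNorm κ b ≤ 1)
    {l : Measure (Config S)} [IsFiniteMeasure l] (hlb : integratedConfig l = b)
    (h : rateMi κ μ l = (rateConst κ μ b b : EReal)) : l = minimizer κ b := by
  have : IsFiniteMeasure b := isFiniteMeasure_of_le μ hb
  have := (minimizer_mass hκ h0 hc b hcrit).1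
  rw [rateMi_eq hκ h0 hc hb Measure.AbsolutelyContinuous.rfl (integrable_log_rnDeriv hb) hlb] at h
  rw [← klDiv_eq_zero_iff]
  by_cases ht : klDiv l (minimizer κ b) = ∞
  · rw [ht, EReal.coe_ennreal_top, EReal.top_add_coe] at h
    exact absurd h (EReal.coe_ne_top _).symm
  · rw [← EReal.coe_ennreal_toReal ht, ← EReal.coe_add, EReal.coe_eq_coe_iff] at h
    exact (ENNReal.toReal_eq_zero_iff _).1 (by linarith) |>.resolve_right ht

theorem extIntegral_log_rnDeriv {ν m : Measure S} {p : S → ℝ≥0∞}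
    (hp : ν.rnDeriv m =ᵐ[ν] p) (hp0 : ∀ᵐ r ∂ν, 0 < p r) (hpt : ∀ᵐ r ∂ν, p r < ∞)
    (hint : Integrable (fun r => Real.log (p r).toReal) ν) :
    extIntegral ν (fun r => ENNReal.log (ν.rnDeriv m r)) =
      ((∫ r, Real.log (p r).toReal ∂ν : ℝ) : EReal) := by
  rw [← extIntegral_coe hint]
  refine extIntegral_congr ?_
  filter_upwards [hp, hp0, hpt] with r h1 h2 h3
  rw [h1, ENNReal.log_pos_real h2.ne' h3.ne]

/-- By the mass formula `|b| - |λ_b| = ½ ⟨b, κb⟩`; combined with `-⟨b, κb⟩ + ½ ⟨b, κμ⟩` this is `½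
⟨b, κ(μ - b)⟩`. -/
theorem rateConst_self (hκ : ∀ r s, κ r s = κ s r) (h0 : ∀ r s, 0 ≤ κ r s)
    (hc : Continuous (Function.uncurry κ)) (hb : b ≤ μ) (hcrit : opNorm κ b ≤ 1) :
    (rateConst κ μ b b : EReal) = extIntegral b (fun r => ENNReal.log (b.rnDeriv μ r))
      + ((1 / 2 * ∫ r, kernelInt κ (μ - b) r ∂b : ℝ) : EReal) := by
  have : IsFiniteMeasure b := isFiniteMeasure_of_le μ hb
  have : IsFiniteMeasure (μ - b) := isFiniteMeasure_of_le μ Measure.sub_le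
  have hbμ := Measure.absolutelyContinuous_of_le hb
  rw [extIntegral_log_rnDeriv (ae_eq_refl _) (Measure.rnDeriv_pos hbμ)
    (hbμ.ae_le (Measure.rnDeriv_lt_top b μ)) (integrable_log_rnDeriv hb), ← EReal.coe_add]
  congr 1
  have h1 : ∀ r, kernelInt κ (μ - b) r = kernelInt κ μ r - kernelInt κ b r := by
    intro r
    have h := integral_add_measure (integrable_kernel hc (μ - b) r) (integrable_kernel hc b r)
    rw [Measure.sub_add_cancel_of_le hb] at h
    exact eq_sub_of_add_eq h.symm
  simp only [h1]
  rw [integral_sub (integrable_kernelInt hc μ b) (integrable_kernelInt hc b b), rateConst,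
    (minimizer_mass hκ h0 hc b hcrit).2]
  ring

theorem integral_kernelInt_comm (hκ : ∀ r s, κ r s = κ s r)
    (hc : Continuous (Function.uncurry κ)) (ν ν' : Measure S) [IsFiniteMeasure ν]
    [IsFiniteMeasure ν'] : ∫ r, kernelInt κ ν r ∂ν' = ∫ r, kernelInt κ ν' r ∂ν := by
  simp only [kernelInt]
  rw [integral_integral_swap (hc.integrable_of_hasCompactSupport
    (HasCompactSupport.of_compactSpace _))]
  simp only [hκ]

/-- Since `c - b = g b` and `κ(c - b) = g`, the factor `g` cancels: the density of `c - b` with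
respect to `g μ` is `db/dμ`. -/
theorem rateMe_sub_eq {g : S → ℝ} (hg : Continuous g)
    (hg0 : ∀ r, 0 ≤ g r) (hcμ : c ≤ μ) (hb : charMeasure c g ∈ characteristicSolutions κ c)
    (hgk : ∀ r, kernelInt κ (c - charMeasure c g) r = g r) :
    rateMe κ μ (c - charMeasure c g) =
      ((∫ r, Real.log ((charMeasure c g).rnDeriv μ r).toReal ∂(c - charMeasure c g)
        + 1 / 2 * ∫ r, kernelInt κ μ r ∂(c - charMeasure c g) : ℝ) : EReal) := by
  obtain ⟨hbc, hsol⟩ := hb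
  have hlog := integrable_log_rnDeriv_charMeasure hg hg0 hcμ
  set b := charMeasure c g
  have hbμ := Measure.absolutelyContinuous_of_le (hbc.trans hcμ)
  have : IsFiniteMeasure c := isFiniteMeasure_of_le μ hcμ
  have : IsFiniteMeasure b := isFiniteMeasure_of_le c hbc
  have hgm : Measurable fun r => ENNReal.ofReal (g r) := hg.measurable.ennreal_ofReal
  have hpm := Measure.measurable_rnDeriv b μ
  simp only [hgk] at hsol
  have hνb : c - b ≪ b := hsol ▸ withDensity_absolutelyContinuous _ _
  have hν : (μ.withDensity fun r => ENNReal.ofReal (g r)).withDensity (b.rnDeriv μ) = c - b := by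
    rw [← withDensity_mul μ hgm hpm, mul_comm, withDensity_mul μ hpm hgm,
      Measure.withDensity_rnDeriv_eq b μ hbμ, hsol]
  have hac : c - b ≪ μ.withDensity fun r => ENNReal.ofReal (g r) :=
    hν ▸ withDensity_absolutelyContinuous _ _
  have hrn : (c - b).rnDeriv (μ.withDensity fun r => ENNReal.ofReal (g r)) =ᵐ[c - b]
      b.rnDeriv μ := by
    refine hac.ae_eq ?_
    have h := Measure.rnDeriv_withDensity (μ.withDensity fun r => ENNReal.ofReal (g r)) hpm
    rwa [hν] at h
  rw [rateMe, funext hgk, if_pos hac, extIntegral_log_rnDeriv hrn (hνb.ae_le (Measure.rnDeriv_pos hbμ))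
    (hνb.ae_le (hbμ.ae_le (Measure.rnDeriv_lt_top b μ))) (hlog.mono_measure Measure.sub_le),
    ← EReal.coe_add]

/-- Apart from the mass of `λ_b`, the constant is linear in its last argument, so the difference is
a sum of terms in `c - b`. There `|c - b|` cancels against `⟨c - b, κb⟩`, which by symmetry is `⟨b,
κ(c - b)⟩ = ⟨b, g⟩ = |c - b|`. -/
theorem rateConst_charMeasure (hκ : ∀ r s, κ r s = κ s r)
    (hc : Continuous (Function.uncurry κ)) {g : S → ℝ} (hg : Continuous g)
    (hg0 : ∀ r, 0 ≤ g r) (hcμ : c ≤ μ) (hb : charMeasure c g ∈ characteristicSolutions κ c)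
    (hgk : ∀ r, kernelInt κ (c - charMeasure c g) r = g r) :
    rateConst κ μ (charMeasure c g) c = rateConst κ μ (charMeasure c g) (charMeasure c g) +
      (∫ r, Real.log ((charMeasure c g).rnDeriv μ r).toReal ∂(c - charMeasure c g)
        + 1 / 2 * ∫ r, kernelInt κ μ r ∂(c - charMeasure c g)) := by
  obtain ⟨hbc, hsol⟩ := hb
  have hlog := integrable_log_rnDeriv_charMeasure hg hg0 hcμ
  set b := charMeasure c g
  have : IsFiniteMeasure c := isFiniteMeasure_of_le μ hcμ
  have : IsFiniteMeasure b := isFiniteMeasure_of_le c hbc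
  have : IsFiniteMeasure (c - b) := isFiniteMeasure_of_le c Measure.sub_le
  have hsplit : ∀ {f : S → ℝ}, Integrable f c → ∫ r, f r ∂c = ∫ r, f r ∂(c - b) + ∫ r, f r ∂b := by
    intro f hf
    conv_lhs => rw [← Measure.sub_add_cancel_of_le hbc]
    exact integral_add_measure (hf.mono_measure Measure.sub_le) (hf.mono_measure hbc)
  have hmass : (c - b).real Set.univ = ∫ r, kernelInt κ b r ∂(c - b) := by
    rw [integral_kernelInt_comm hκ hc]
    simp only [hgk] at hsol ⊢
    have h1 : ∫ r, (1 : ℝ) ∂(c - b) = ∫ r, g r * 1 ∂b := by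
      conv_lhs => rw [← hsol]
      exact integral_withDensity_ofReal b hg.measurable hg0 _
    simpa using h1
  have hone := hsplit (integrable_const (1 : ℝ))
  simp only [integral_const, smul_eq_mul, mul_one] at hone
  rw [rateConst, rateConst, hsplit hlog, hsplit (integrable_kernelInt hc b c),
    hsplit (integrable_kernelInt hc μ c), hone, ← hmass]
  ring

end Rates

end SparseGraph

theorem proposition6p1 {S : Type*} [MetricSpace S] [CompactSpace S] [MeasurableSpace S]
    [BorelSpace S] (μ : Measure S) [IsProbabilityMeasure μ] (κ : S → S → ℝ)
    (hκ_cont : Continuous (Function.uncurry κ)) (hκ_nonneg : ∀ r s, 0 ≤ κ r s)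
    (hκ_symm : ∀ r s, κ r s = κ s r) (c : Measure S) (hc : c ≤ μ) :
    (opNorm κ c ≤ 1 →
      constrainedInf κ μ c =
          extIntegral c (fun r => ENNReal.log (c.rnDeriv μ r))
            + ((1 / 2 * ∫ r, kernelInt κ (μ - c) r ∂c : ℝ) : EReal) ∧
        (minimizer κ c ∈ stateSpace μ ∧ integratedConfig (minimizer κ c) = c) ∧
        rateMi κ μ (minimizer κ c) = constrainedInf κ μ c ∧
        ∀ l ∈ stateSpace μ, integratedConfig l = c →
          rateMi κ μ l = constrainedInf κ μ c → l = minimizer κ c) ∧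
    (1 < opNorm κ c →
      ∃ b : Measure S, IsLeast {b' | b' ∈ characteristicSolutions κ c ∧ b' ≠ c} b ∧
        opNorm κ b = 1 ∧
        constrainedInf κ μ b + rateMe κ μ (c - b) ≤ constrainedInf κ μ c) := by
  have : IsFiniteMeasure c := isFiniteMeasure_of_le μ hc
  refine ⟨fun hcrit => ?_, fun hcrit => ?_⟩
  · have hinf := constrainedInf_eq hκ_symm hκ_nonneg hκ_cont hc hcrit
    refine ⟨hinf.trans (rateConst_self hκ_symm hκ_nonneg hκ_cont hc hcrit),
      ⟨minimizer_mem_stateSpace hκ_symm hκ_nonneg hκ_cont hc hcrit,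
        integratedConfig_minimizer_eq hκ_symm hκ_nonneg hκ_cont c hcrit⟩,
      (rateMi_minimizer hκ_symm hκ_nonneg hκ_cont hc hcrit).trans hinf.symm, ?_⟩
    rintro l ⟨hfin, -, -⟩ hlc hl
    exact eq_minimizer_of_rateMi_eq hκ_symm hκ_nonneg hκ_cont hc hcrit hlc (hl.trans hinf)
  · obtain ⟨g, hg, hg0, hgk, hleast, hone⟩ :=
      exists_isLeast_characteristicSolutions hκ_symm hκ_nonneg hκ_cont hcrit
    refine ⟨charMeasure c g, hleast, hone, ?_⟩
    have hsol := hleast.1.1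
    have hbμ : charMeasure c g ≤ μ := hsol.1.trans hc
    have : IsFiniteMeasure (charMeasure c g) := isFiniteMeasure_of_le c hsol.1
    have := (minimizer_mass hκ_symm hκ_nonneg hκ_cont (charMeasure c g) hone.le).1
    have hgm := hg.measurable
    -- The density `1/(1 + g)` vanishes nowhere, so the reference measure for `b*` can be used for
    -- laws with integrated configuration `c`.
    have hcb : c ≪ charMeasure c g := withDensity_absolutelyContinuous' (by fun_prop)
      (Filter.Eventually.of_forall fun r => by
        have := hg0 r
        simp only [ne_eq, ENNReal.ofReal_eq_zero, not_le]
        positivity)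
    rw [constrainedInf_eq hκ_symm hκ_nonneg hκ_cont hbμ hone.le,
      rateMe_sub_eq hg hg0 hc hsol hgk, ← EReal.coe_add,
      ← rateConst_charMeasure hκ_symm hκ_cont hg hg0 hc hsol hgk]
    exact rateConst_le_constrainedInf hκ_symm hκ_nonneg hκ_cont hbμ hcb
      (integrable_log_rnDeriv_charMeasure hg hg0 hc)
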